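/- **The algorithm.** Let $G$ be a graph with $n$ nodes and $l\ge 0$ an integer. The algorithm $\mathcal A(G,l)$ allocates $n$ balls one after another to the nodes (bins) of $G$, which are empty at the start. Each ball, independently of the past, picks a node $u_0$ uniformly at random and performs a non-backtracking random walk $(u_0,u_1,\dots,u_l)$ of length $l$: in each step it moves to a uniformly random neighbour of the current node, except that it never traverses the same edge twice in a row. The ball is then placed on a visited node of minimum current load, ties being broken uniformly at random. Let $m^*$ be the maximum load of a node after all $n$ balls have been placed. **Parameters.** For a $d$-regular graph $G$ on $n$ nodes put $$\gamma_G=\sqrt{\log_d n},\qquad k=\max\{4,\lfloor l/\gamma_G\rfloor\},\qquad h=\left\lceil \frac{\log\log n}{\log(k-2)}\right\rceil .$$ **Theorem.** There are absolute constants $C,c>0$ such that the following holds. Consider any sequence of triples $(G,d,l)$, where $G$ is a $d$-regular graph on $n$ nodes and $l\ge 0$ is an integer, such that, along the sequence, $n\to\infty$, $d/\log n\to\infty$, and $G$ has girth at least $10hl$ for all but finitely many members. Then each bound below holds with probability at least $1-n^{-c}$ for all but finitely many members of the sequence. 1. If $l\to\infty$ and eventually $l\le 4\gamma_G$, then $$m^*\le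 C\cdot\frac{\log_d n\cdot\log\log n}{l^2}.$$ 2. If eventually $l\ge 4\gamma_G$, then $$m^*\le C\cdot\frac{\log\log n}{\log(l/\gamma_G)}.$$ 3. In particular, if for some fixed $\varepsilon\in(0,1)$ eventually $l=\lfloor(\log n)^{(1+\varepsilon)/2}\rfloor$, then $m^*\le C/\varepsilon$. -/

import Mathlib

open Filter Asymptotics

namespace BalancedAllocation

noncomputable section

variable {V : Type*} [Fintype V] [Nonempty V]

/-- The uniform distribution on the finite set `s`. For `s = ∅` the value is a mere convention (the
uniform distribution on all of `V`); in a `d`-regular graph with `d ≥ 2` every set that is sampled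
from in the process below is nonempty, so the convention is never used there. -/
def uniformOn (s : Finset V) : PMF V :=
  open Classical in
  if hs : s.Nonempty then PMF.uniformOfFinset s hs else PMF.uniformOfFintype V

/-- The neighbours of `u` that a non-backtracking walk standing at `u` may step to; `prev` is the
node visited just before `u`, or `none` at the start of the walk. -/
def nextNodes (G : SimpleGraph V) (prev : Option V) (u : V) : Finset V :=
  open Classical in
  Finset.univ.filter fun v => G.Adj u v ∧ prev ≠ some v

/-- Law of the list of the `l + 1` nodes `u = u₀, u₁, …, u_l` visited by a non-backtracking random
walk that makes `l` steps from `u`, having arrived at `u` from `prev`: in each step it moves to a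
uniformly random neighbour, but never traverses the same edge twice in a row. -/
def nbWalkFrom (G : SimpleGraph V) : ℕ → Option V → V → PMF (List V)
  | 0, _, u => PMF.pure [u]
  | l + 1, prev, u =>
      (uniformOn (nextNodes G prev u)).bind fun v =>
        (nbWalkFrom G l (some u) v).map (List.cons u)

/-- Law of a non-backtracking random walk of length `l` from a uniformly random node. -/
def nbWalk (G : SimpleGraph V) (l : ℕ) : PMF (List V) :=
  (PMF.uniformOfFintype V).bind fun u => nbWalkFrom G l none u

/-- The visited nodes that have minimum load among all visited nodes. -/
def leastLoaded (load : V → ℕ) (W : List V) : Finset V :=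
  open Classical in
  W.toFinset.filter fun v => ∀ u ∈ W, load v ≤ load u

/-- One round of `𝒜(G, l)` from a given load vector: sample a walk of length `l`, and place a ball
on a least-loaded visited node, ties being broken uniformly at random. -/
def allocRound (G : SimpleGraph V) (l : ℕ) (load : V → ℕ) : PMF (V → ℕ) :=
  open Classical in
  (nbWalk G l).bind fun W =>
    (uniformOn (leastLoaded load W)).map fun v => Function.update load v (load v + 1)

/-- Law of the load vector after `t` balls have been allocated by `𝒜(G, l)`, all bins being empty
at the start. -/
def loads (G : SimpleGraph V) (l : ℕ) : ℕ → PMF (V → ℕ)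
  | 0 => PMF.pure fun _ => 0
  | t + 1 => (loads G l t).bind (allocRound G l)

/-- The maximum load over all bins. -/
def maxLoad (load : V → ℕ) : ℕ := Finset.univ.sup load

/-- The probability that the maximum load attained by `𝒜(G, l)`, after as many balls as there are
nodes have been allocated, is at most `b`. -/
def probMaxLoadLE (G : SimpleGraph V) (l : ℕ) (b : ℝ) : ℝ :=
  ((loads G l (Fintype.card V)).toOuterMeasure {load | (maxLoad load : ℝ) ≤ b}).toReal

/-- `γ = √(log_d n)`. -/
def gam (n d : ℕ) : ℝ := √(Real.logb d n)

/-- `k = max {4, ⌊l / γ⌋}`. -/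
def kParam (n d l : ℕ) : ℕ := max 4 ⌊(l : ℝ) / gam n d⌋₊

/-- `h = ⌈log log n / log (k - 2)⌉`. -/
def hParam (n d l : ℕ) : ℕ :=
  ⌈Real.log (Real.log n) / Real.log ((kParam n d l : ℝ) - 2)⌉₊

end

end BalancedAllocation

namespace BalancedAllocation
noncomputable section
open scoped ENNReal

/-! ### Expectations with respect to a `PMF` -/

/-! The argument is a witness-structure argument, run batch by batch. The `n` balls are cut into 641
batches of at most `n / 640`. It suffices that a batch started from loads at most `M` ends, outside
an event of probability `O(log n) / n`, with loads at most `M + (h + 1) * ρ` (`pr_batch_le`).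

Suppose some node ends above that level. The ball that reached the level went to a least-loaded node
of its walk, so every node of that walk is at least as loaded. Each of them has therefore received
`ρ` balls in the `ρ` levels below, and the walks of those balls meet the first walk. Iterating gives
connected families of walks. If a family of `m` walks always visits at least about `l * m / 4`
nodes, each strip of `ρ` levels multiplies its size by about `ρ * l / 4`, so `h` strips yield `T =
⌈log n⌉` walks. The last strip leaves a crowded family: all its visited nodes receive `ρ` further
balls above `M` (`exists_crowded_family`).

Two estimates exclude this. First, connected families with few nodes are unlikely
(`pr_small_family_le`). Large girth makes each walk a path and leaves at most one non-backtracking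
walk of given length between two nodes, so each node saved by revisiting old ones costs a factor `1
/ (d - 1)` (`ex_nbWalk_meets_pow`). Second, crowded families are unlikely (`pr_crowded_family_le`).
As long as every neighbourhood has few nodes above `M`, a round puts its ball on a given node loaded
at least `M` with probability at most `16 / n` (`pr_stepLaw_place_le`), since a walk through the
node usually offers many equally good bins. This condition persists because `d` is large compared
with `log n` (`pr_not_goodThrough_le`). The walks are independent of the past, so both events reduce
to independent walks (`ex_hist_witness_le`).

The girth also forces `2 * h * l ≤ log_d n` (`two_mul_hParam_mul_le_logb`), which makes the
parameters compatible: `g = 2` and `ρ` of order `log_d n / l²` for short walks, `g = k - 2` and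
constant `ρ` for long ones. -/

/-- The expectation of `f` under `p`. -/
def ex {α : Type*} (p : PMF α) (f : α → ℝ≥0∞) : ℝ≥0∞ := ∑' a, p a * f a

section Expectation
variable {α β : Type*}

lemma ex_pure (a : α) (f : α → ℝ≥0∞) : ex (PMF.pure a) f = f a := by
  unfold ex
  rw [tsum_eq_single a]
  · simp
  · intro b hb; simp [PMF.pure_apply, hb]

lemma ex_bind (p : PMF α) (q : α → PMF β) (f : β → ℝ≥0∞) :
    ex (p.bind q) f = ex p fun a => ex (q a) f := by
  unfold ex
  simp only [PMF.bind_apply, ← ENNReal.tsum_mul_right, ← ENNReal.tsum_mul_left]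
  rw [ENNReal.tsum_comm]
  simp only [mul_assoc]

lemma ex_map (p : PMF α) (g : α → β) (f : β → ℝ≥0∞) : ex (p.map g) f = ex p (f ∘ g) := by
  rw [← PMF.bind_pure_comp, ex_bind]
  simp [ex_pure, Function.comp_def]

lemma ex_mono_support (p : PMF α) {f g : α → ℝ≥0∞} (h : ∀ a ∈ p.support, f a ≤ g a) :
    ex p f ≤ ex p g := by
  refine ENNReal.tsum_le_tsum fun a => ?_
  by_cases ha : p a = 0
  · simp [ha]
  · exact mul_le_mul_right (h a ((PMF.mem_support_iff p a).2 ha)) _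

lemma ex_mono (p : PMF α) {f g : α → ℝ≥0∞} (h : ∀ a, f a ≤ g a) : ex p f ≤ ex p g :=
  ex_mono_support p fun a _ => h a

lemma ex_const (p : PMF α) (c : ℝ≥0∞) : ex p (fun _ => c) = c := by
  simp [ex, ENNReal.tsum_mul_right, p.tsum_coe]

lemma ex_add (p : PMF α) (f g : α → ℝ≥0∞) : ex p (fun a => f a + g a) = ex p f + ex p g := by
  simp [ex, mul_add, ENNReal.tsum_add]

lemma ex_mul_left (p : PMF α) (c : ℝ≥0∞) (f : α → ℝ≥0∞) :
    ex p (fun a => c * f a) = c * ex p f := by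
  simp only [ex, ← ENNReal.tsum_mul_left, mul_left_comm]

lemma ex_mul_right (p : PMF α) (c : ℝ≥0∞) (f : α → ℝ≥0∞) :
    ex p (fun a => f a * c) = ex p f * c := by
  simp only [mul_comm _ c, ex_mul_left]

lemma ex_sum {ι : Type*} (p : PMF α) (s : Finset ι) (f : ι → α → ℝ≥0∞) :
    ex p (fun a => ∑ i ∈ s, f i a) = ∑ i ∈ s, ex p (f i) := by
  classical
  induction s using Finset.induction_on with
  | empty => simp [ex]
  | insert i s hi ih => simp only [Finset.sum_insert hi, ex_add, ih]

lemma ex_tsum {ι : Type*} (p : PMF α) (f : ι → α → ℝ≥0∞) :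
    ex p (fun a => ∑' i, f i a) = ∑' i, ex p (f i) := by
  simp only [ex, ← ENNReal.tsum_mul_left]
  rw [ENNReal.tsum_comm]

open Classical in
/-- The probability that `P` holds under `p`. -/
def pr (p : PMF α) (P : α → Prop) : ℝ≥0∞ := ex p fun a => if P a then 1 else 0

lemma pr_eq_ex (p : PMF α) (P : α → Prop) [DecidablePred P] :
    pr p P = ex p fun a => if P a then 1 else 0 := by
  unfold pr
  congr!

lemma pr_eq_toOuterMeasure (p : PMF α) (P : α → Prop) : pr p P = p.toOuterMeasure {a | P a} := by
  classical
  rw [PMF.toOuterMeasure_apply, pr, ex]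
  refine tsum_congr fun a => ?_
  by_cases h : P a <;> simp [h]

lemma pr_mono_support (p : PMF α) {P Q : α → Prop} (h : ∀ a ∈ p.support, P a → Q a) :
    pr p P ≤ pr p Q := by
  refine ex_mono_support p fun a ha => ?_
  by_cases hP : P a
  · simp [hP, h a ha hP]
  · simp [hP]

lemma pr_mono (p : PMF α) {P Q : α → Prop} (h : ∀ a, P a → Q a) : pr p P ≤ pr p Q :=
  pr_mono_support p fun a _ => h a

lemma pr_le_one (p : PMF α) (P : α → Prop) : pr p P ≤ 1 :=
  (ex_mono p fun a => by split_ifs <;> simp).trans_eq (ex_const p 1)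

lemma pr_or_le (p : PMF α) (P Q : α → Prop) : pr p (fun a => P a ∨ Q a) ≤ pr p P + pr p Q := by
  unfold pr
  rw [← ex_add]
  refine ex_mono p fun a => ?_
  by_cases hP : P a <;> by_cases hQ : Q a <;> simp [hP, hQ]

lemma pr_exists_mem_le {ι : Type*} (p : PMF α) (s : Finset ι) (P : ι → α → Prop) :
    pr p (fun a => ∃ i ∈ s, P i a) ≤ ∑ i ∈ s, pr p (P i) := by
  classical
  unfold pr
  rw [← ex_sum]
  refine ex_mono p fun a => ?_
  split_ifs with h
  · obtain ⟨i, hi, hP⟩ := h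
    calc (1 : ℝ≥0∞) = if P i a then 1 else 0 := by simp [hP]
      _ ≤ _ := Finset.single_le_sum (f := fun i => if P i a then (1 : ℝ≥0∞) else 0)
        (fun _ _ => zero_le) hi
  · exact zero_le

lemma pr_exists_le {ι : Type*} [Fintype ι] (p : PMF α) (P : ι → α → Prop) :
    pr p (fun a => ∃ i, P i a) ≤ ∑ i, pr p (P i) := by
  simpa using pr_exists_mem_le p Finset.univ P

lemma pr_add_pr_not (p : PMF α) (P : α → Prop) : pr p P + pr p (fun a => ¬ P a) = 1 := by
  unfold pr
  rw [← ex_add]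
  refine Eq.trans ?_ (ex_const p 1)
  congr 1
  ext a
  by_cases h : P a <;> simp [h]

end Expectation

variable {V : Type*} [Fintype V] [Nonempty V]

lemma ex_uniformOfFintype (f : V → ℝ≥0∞) :
    ex (PMF.uniformOfFintype V) f = (Fintype.card V : ℝ≥0∞)⁻¹ * ∑ v, f v := by
  simp [ex, Finset.mul_sum, tsum_fintype]

lemma ex_uniformOn {s : Finset V} (hs : s.Nonempty) (f : V → ℝ≥0∞) :
    ex (uniformOn s) f = (s.card : ℝ≥0∞)⁻¹ * ∑ v ∈ s, f v := by
  classical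
  rw [uniformOn, dif_pos hs, ex, tsum_fintype, Finset.mul_sum]
  simp only [PMF.uniformOfFinset_apply, ite_mul, zero_mul]
  rw [← Finset.sum_filter]
  simp

lemma support_uniformOn {s : Finset V} (hs : s.Nonempty) : (uniformOn s).support = s := by
  classical
  rw [uniformOn, dif_pos hs, PMF.support_uniformOfFinset]

/-! ### Non-backtracking lists -/

section Graph
variable {V : Type*}

/-- Consecutive nodes are adjacent, and no edge is traversed twice in a row. -/
def IsNB (G : SimpleGraph V) (W : List V) : Prop :=
  W.IsChain G.Adj ∧ ∀ a b c, [a, b, c] <:+: W → a ≠ c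

lemma isNB_reverse {G : SimpleGraph V} {W : List V} (h : IsNB G W) : IsNB G W.reverse := by
  refine ⟨?_, fun a b c habc => ?_⟩
  · rw [List.isChain_reverse]
    exact h.1.imp fun a b hab => hab.symm
  · refine (h.2 c b a ?_).symm
    rw [← List.reverse_infix]
    simpa using habc

lemma isNB_singleton (G : SimpleGraph V) (u : V) : IsNB G [u] :=
  ⟨List.isChain_singleton u, fun a b c h => by simpa using h.length_le⟩

lemma isNB_pair {G : SimpleGraph V} {p u : V} : IsNB G [p, u] ↔ G.Adj p u :=
  ⟨fun h => by simpa using h.1, fun h => ⟨by simpa using h, fun a b c h => by simpa using h.length_le⟩⟩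

lemma isNB_cons_cons {G : SimpleGraph V} {p u : V} {W : List V} :
    IsNB G (p :: u :: W) ↔ G.Adj p u ∧ W.head? ≠ some p ∧ IsNB G (u :: W) := by
  unfold IsNB
  rw [List.isChain_cons_cons]
  constructor
  · rintro ⟨⟨h1, h2⟩, h3⟩
    refine ⟨h1, ?_, h2, fun a b c h => h3 a b c (h.trans (List.suffix_cons _ _).isInfix)⟩
    intro h
    cases W with
    | nil => simp at h
    | cons w t =>
      simp only [List.head?_cons, Option.some.injEq] at h
      exact h3 p u w (List.IsPrefix.isInfix ⟨t, rfl⟩) h.symm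
  · rintro ⟨h1, h2, h3, h4⟩
    refine ⟨⟨h1, h3⟩, fun a b c h => ?_⟩
    rcases List.infix_cons_iff.1 h with h | h
    · cases W with
      | nil => simpa using h.length_le
      | cons w t =>
        simp only [List.cons_prefix_cons, List.nil_prefix, and_true] at h
        obtain ⟨rfl, rfl, rfl⟩ := h
        intro hh; simp [hh] at h2
    · exact h4 a b c h

/-- The form in which non-backtracking enters the girth argument: in a forest, a walk whose
consecutive edges differ is a path. -/
lemma isChain_edges_of_isNB {G : SimpleGraph V} : ∀ {u v : V} (p : G.Walk u v),
    IsNB G p.support → List.IsChain (· ≠ ·) p.edges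
  | _, _, .nil, _ => by simp
  | _, _, .cons h .nil, _ => by simp
  | u, _, .cons (v := v) h (.cons (v := w) h' p), hp => by
    simp only [SimpleGraph.Walk.support_cons] at hp
    rw [isNB_cons_cons] at hp
    have ih := isChain_edges_of_isNB (.cons h' p) (by simpa using hp.2.2)
    simp only [SimpleGraph.Walk.edges_cons, List.isChain_cons_cons] at ih ⊢
    refine ⟨?_, ih⟩
    have hne : w ≠ u := by
      have := hp.2.1
      rw [← SimpleGraph.Walk.cons_tail_support, List.head?_cons] at this
      simpa using this
    intro he
    rw [Sym2.eq_iff] at he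
    rcases he with ⟨h1, h2⟩ | ⟨h1, h2⟩
    · exact h.ne h1
    · exact hne h1.symm

/-- The edges of `p` and `q` span a subgraph with too few edges to contain a cycle of length at
least the girth, hence a forest. In a forest non-backtracking walks are paths, and the path between
two nodes is unique. -/
lemma walk_unique_of_egirth {G : SimpleGraph V} {u v : V} (p q : G.Walk u v)
    (hp : List.IsChain (· ≠ ·) p.edges) (hq : List.IsChain (· ≠ ·) q.edges)
    (hg : ((p.length + q.length : ℕ) : ℕ∞) < G.egirth) : p.IsPath ∧ p = q := by
  classical
  let H : SimpleGraph V := SimpleGraph.fromEdgeSet {e | e ∈ p.edges ++ q.edges}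
  have hHG : H ≤ G := by
    intro a b hab
    have := (SimpleGraph.fromEdgeSet_adj _).1 hab
    rcases List.mem_append.1 this.1 with h | h
    · exact SimpleGraph.Walk.adj_of_mem_edges p h
    · exact SimpleGraph.Walk.adj_of_mem_edges q h
  have hHe : ∀ e ∈ H.edgeSet, e ∈ p.edges ++ q.edges := by
    intro e he
    rw [SimpleGraph.edgeSet_fromEdgeSet] at he
    exact he.1
  have hac : H.IsAcyclic := by
    intro a c hc
    have h1 : G.egirth ≤ (c.mapLe hHG).length := SimpleGraph.egirth_le_length (hc.mapLe hHG)
    have h2 : (c.mapLe hHG).length ≤ p.length + q.length := by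
      rw [SimpleGraph.Walk.length_map, ← SimpleGraph.Walk.length_edges c]
      have := (hc.edges_nodup.subperm fun e he =>
        hHe e (SimpleGraph.Walk.edges_subset_edgeSet c he)).length_le
      simpa using this
    exact absurd (lt_of_le_of_lt (h1.trans (by exact_mod_cast h2)) hg) (lt_irrefl _)
  have hpm : ∀ e ∈ p.edges, e ∈ H.edgeSet := fun e he => by
    rw [SimpleGraph.edgeSet_fromEdgeSet]
    exact ⟨by simp [he], G.not_isDiag_of_mem_edgeSet (SimpleGraph.Walk.edges_subset_edgeSet p he)⟩
  have hqm : ∀ e ∈ q.edges, e ∈ H.edgeSet := fun e he => by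
    rw [SimpleGraph.edgeSet_fromEdgeSet]
    exact ⟨by simp [he], G.not_isDiag_of_mem_edgeSet (SimpleGraph.Walk.edges_subset_edgeSet q he)⟩
  have hp' : (p.transfer H hpm).IsPath :=
    (hac.isPath_iff_isChain _).2 (by rwa [SimpleGraph.Walk.edges_transfer])
  have hq' : (q.transfer H hqm).IsPath :=
    (hac.isPath_iff_isChain _).2 (by rwa [SimpleGraph.Walk.edges_transfer])
  have heq : p.transfer H hpm = q.transfer H hqm :=
    congrArg Subtype.val ((hac.subsingleton_path _ _).elim ⟨_, hp'⟩ ⟨_, hq'⟩)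
  refine ⟨?_, ?_⟩
  · rw [SimpleGraph.Walk.isPath_def] at hp' ⊢
    simpa using hp'
  · apply SimpleGraph.Walk.ext_support
    have := congrArg SimpleGraph.Walk.support heq
    simpa using this

lemma exists_walk_of_isNB {G : SimpleGraph V} {W : List V} (h : IsNB G W) {x y : V}
    (hx : W.head? = some x) (hy : W.getLast? = some y) :
    ∃ p : G.Walk x y, p.support = W ∧ List.IsChain (· ≠ ·) p.edges := by
  have hne : W ≠ [] := by rintro rfl; simp at hx
  have hx' : W.head hne = x := by
    have := List.head?_eq_some_head hne; rw [hx] at this; simpa using this.symm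
  have hy' : W.getLast hne = y := by
    have := List.getLast?_eq_some_getLast hne; rw [hy] at this; simpa using this.symm
  subst hx' hy'
  refine ⟨.ofSupport W hne h.1, SimpleGraph.Walk.support_ofSupport hne h.1,
    isChain_edges_of_isNB _ ?_⟩
  rwa [SimpleGraph.Walk.support_ofSupport]

lemma IsNB.eq_of_egirth {G : SimpleGraph V} {W W' : List V} (h : IsNB G W) (h' : IsNB G W')
    {x y : V} {s : ℕ} (hx : W.head? = some x) (hx' : W'.head? = some x)
    (hy : W.getLast? = some y) (hy' : W'.getLast? = some y) (hl : W.length = s + 1)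
    (hl' : W'.length = s + 1) (hg : ((2 * s : ℕ) : ℕ∞) < G.egirth) : W = W' := by
  obtain ⟨p, rfl, hp⟩ := exists_walk_of_isNB h hx hy
  obtain ⟨q, rfl, hq⟩ := exists_walk_of_isNB h' hx' hy'
  simp only [SimpleGraph.Walk.length_support, add_left_inj] at hl hl'
  rw [(walk_unique_of_egirth p q hp hq (by rwa [hl, hl', ← two_mul])).2]

lemma IsNB.nodup_of_egirth {G : SimpleGraph V} {W : List V} (h : IsNB G W)
    {s : ℕ} (hl : W.length = s + 1) (hg : ((2 * s : ℕ) : ℕ∞) < G.egirth) : W.Nodup := by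
  have hne : W ≠ [] := by rintro rfl; simp at hl
  obtain ⟨p, hpW, hp⟩ := exists_walk_of_isNB h (List.head?_eq_some_head hne)
    (List.getLast?_eq_some_getLast hne)
  rw [← hpW, SimpleGraph.Walk.length_support, add_left_inj] at hl
  rw [← hpW]
  exact (walk_unique_of_egirth p p hp hp (by rwa [hl, ← two_mul])).1.support_nodup

end Graph

/-! ### The law of the non-backtracking walk -/

section Law
variable {G : SimpleGraph V} {d : ℕ}

omit [Nonempty V] in
lemma mem_nextNodes {prev : Option V} {u v : V} :
    v ∈ nextNodes G prev u ↔ G.Adj u v ∧ prev ≠ some v := by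
  simp [nextNodes]

omit [Nonempty V] in
lemma card_nextNodes_some (hreg : ∀ u, (nextNodes G none u).card = d) {u p : V}
    (h : G.Adj u p) : (nextNodes G (some p) u).card = d - 1 := by
  classical
  have : nextNodes G (some p) u = (nextNodes G none u).erase p := by
    ext v; simp only [mem_nextNodes, Finset.mem_erase]; grind
  rw [this, Finset.card_erase_of_mem (by simp [mem_nextNodes, h]), hreg]

omit [Nonempty V] in
lemma le_card_nextNodes (hreg : ∀ u, (nextNodes G none u).card = d) (prev : Option V) (u : V) :
    d - 1 ≤ (nextNodes G prev u).card := by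
  classical
  cases prev with
  | none => rw [hreg]; omega
  | some p =>
    have : (nextNodes G none u).erase p ⊆ nextNodes G (some p) u := by
      intro v; simp only [mem_nextNodes, Finset.mem_erase]; grind
    have := Finset.card_le_card this
    have h2 := Finset.pred_card_le_card_erase (s := nextNodes G none u) (a := p)
    rw [hreg] at h2
    omega

omit [Nonempty V] in
lemma nextNodes_nonempty (hreg : ∀ u, (nextNodes G none u).card = d) (hd : 2 ≤ d)
    (prev : Option V) (u : V) : (nextNodes G prev u).Nonempty := by
  have := le_card_nextNodes hreg prev u
  exact Finset.card_pos.1 (by omega)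

lemma ex_nbWalkFrom_succ (l : ℕ) (prev : Option V) (u : V) (f : List V → ℝ≥0∞) :
    ex (nbWalkFrom G (l + 1) prev u) f =
      ex (uniformOn (nextNodes G prev u)) fun v =>
        ex (nbWalkFrom G l (some u) v) fun W => f (u :: W) := by
  simp only [nbWalkFrom, ex_bind, ex_map, Function.comp_def]

lemma ex_nbWalk (l : ℕ) (f : List V → ℝ≥0∞) :
    ex (nbWalk G l) f =
      (Fintype.card V : ℝ≥0∞)⁻¹ * ∑ u, ex (nbWalkFrom G l none u) f := by
  rw [nbWalk, ex_bind, ex_uniformOfFintype]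

lemma apply_eq_ex {α : Type*} [DecidableEq α] (p : PMF α) (a : α) :
    p a = ex p fun b => if b = a then 1 else 0 := by
  rw [ex, tsum_eq_single a]
  · simp
  · intro b hb; simp [hb]

lemma nbWalkFrom_succ_apply_nil (l : ℕ) (prev : Option V) (u : V) :
    nbWalkFrom G (l + 1) prev u [] = 0 := by
  classical
  rw [apply_eq_ex, ex_nbWalkFrom_succ]
  simp [ex_const]

open Classical in
lemma nbWalkFrom_succ_apply_cons (hreg : ∀ u, (nextNodes G none u).card = d) (hd : 2 ≤ d)
    (l : ℕ) (prev : Option V) (u a : V) (W : List V) :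
    nbWalkFrom G (l + 1) prev u (a :: W) = if a = u then
      ((nextNodes G prev u).card : ℝ≥0∞)⁻¹ * ∑ v ∈ nextNodes G prev u, nbWalkFrom G l (some u) v W
      else 0 := by
  rw [apply_eq_ex, ex_nbWalkFrom_succ, ex_uniformOn (nextNodes_nonempty hreg hd _ _)]
  split_ifs with h
  · subst h
    simp [← apply_eq_ex]
  · simp [Ne.symm h, ex_const]

open Classical in
-- With a predecessor given, every step has exactly `d - 1` choices, so all admissible lists are
-- equally likely. Prepending `p` lets `IsNB` also forbid an immediate return to `p`.
lemma nbWalkFrom_some_apply (hreg : ∀ u, (nextNodes G none u).card = d) (hd : 2 ≤ d)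
    (l : ℕ) {p u : V} (h : G.Adj u p) (W : List V) :
    nbWalkFrom G l (some p) u W =
      if W.length = l + 1 ∧ W.head? = some u ∧ IsNB G (p :: W) then ((d - 1 : ℕ) : ℝ≥0∞)⁻¹ ^ l
      else 0 := by
  induction l generalizing p u W with
  | zero =>
    rw [nbWalkFrom, PMF.pure_apply, pow_zero]
    congr 1
    rw [eq_iff_iff]
    constructor
    · rintro rfl; simpa [isNB_pair] using h.symm
    · rintro ⟨h1, h2, -⟩
      rw [zero_add, List.length_eq_one_iff] at h1
      obtain ⟨a, rfl⟩ := h1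
      simpa using h2
  | succ l ih =>
    rcases W with _ | ⟨a, W⟩
    · simp [nbWalkFrom_succ_apply_nil]
    rw [nbWalkFrom_succ_apply_cons hreg hd, card_nextNodes_some hreg h]
    by_cases hau : a = u
    swap
    · simp [hau]
    subst hau
    rw [if_pos rfl]
    have hsum : ∑ v ∈ nextNodes G (some p) a, nbWalkFrom G l (some a) v W =
        ∑ v ∈ nextNodes G (some p) a, if W.length = l + 1 ∧ W.head? = some v ∧ IsNB G (a :: W)
          then ((d - 1 : ℕ) : ℝ≥0∞)⁻¹ ^ l else 0 :=
      Finset.sum_congr rfl fun v hv => ih (mem_nextNodes.1 hv).1.symm W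
    rw [hsum]
    rcases W with _ | ⟨b, W⟩
    · simp
    simp only [List.head?_cons, Option.some.injEq, List.length_cons, add_left_inj]
    rw [isNB_cons_cons (p := p), List.head?_cons]
    by_cases hW : W.length = l ∧ IsNB G (a :: b :: W)
    · by_cases hb : b ∈ nextNodes G (some p) a
      · rw [Finset.sum_eq_single b (fun v _ hvb => by simp [Ne.symm hvb]) (fun hb' => absurd hb hb')]
        have hb2 := (mem_nextNodes.1 hb).2
        simp only [ne_eq, Option.some.injEq] at hb2
        rw [if_pos ⟨hW.1, rfl, hW.2⟩, if_pos, pow_succ', ]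
        exact ⟨hW.1, trivial, h.symm, by simpa using Ne.symm hb2, hW.2⟩
      · rw [Finset.sum_eq_zero, mul_zero, if_neg]
        · rintro ⟨h1, -, h2, h3, h4⟩
          apply hb
          rw [mem_nextNodes]
          refine ⟨(isNB_cons_cons.1 h4).1, ?_⟩
          intro hh; exact h3 hh.symm
        · intro v hv
          rw [if_neg]
          rintro ⟨-, rfl, -⟩
          exact hb hv
    · rw [Finset.sum_eq_zero, mul_zero, if_neg]
      · rintro ⟨h1, -, h2, h3, h4⟩
        exact hW ⟨h1, h4⟩
      · intro v hv
        rw [if_neg]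
        rintro ⟨h1, -, h2⟩
        exact hW ⟨h1, h2⟩

/-- The probability of each non-backtracking walk of length `l` from a given node. -/
def walkWeight (d : ℕ) : ℕ → ℝ≥0∞
  | 0 => 1
  | l + 1 => (d : ℝ≥0∞)⁻¹ * ((d - 1 : ℕ) : ℝ≥0∞)⁻¹ ^ l

lemma walkWeight_le (d l : ℕ) : walkWeight d l ≤ ((d - 1 : ℕ) : ℝ≥0∞)⁻¹ ^ l := by
  cases l with
  | zero => simp [walkWeight]
  | succ l =>
    rw [walkWeight, pow_succ']
    gcongr
    omega

open Classical in
lemma nbWalkFrom_none_apply (hreg : ∀ u, (nextNodes G none u).card = d) (hd : 2 ≤ d)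
    (l : ℕ) {u : V} (W : List V) :
    nbWalkFrom G l none u W =
      if W.length = l + 1 ∧ W.head? = some u ∧ IsNB G W then walkWeight d l else 0 := by
  cases l with
  | zero =>
    rw [nbWalkFrom, PMF.pure_apply, walkWeight]
    congr 1
    rw [eq_iff_iff]
    constructor
    · rintro rfl; simp [isNB_singleton]
    · rintro ⟨h1, h2, -⟩
      rw [zero_add, List.length_eq_one_iff] at h1
      obtain ⟨a, rfl⟩ := h1
      simpa using h2
  | succ l =>
    rcases W with _ | ⟨a, W⟩
    · simp [nbWalkFrom_succ_apply_nil]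
    rw [nbWalkFrom_succ_apply_cons hreg hd, hreg]
    by_cases hau : a = u
    swap
    · simp [hau]
    subst hau
    rw [if_pos rfl]
    have hsum : ∑ v ∈ nextNodes G none a, nbWalkFrom G l (some a) v W =
        ∑ v ∈ nextNodes G none a, if W.length = l + 1 ∧ W.head? = some v ∧ IsNB G (a :: W)
          then ((d - 1 : ℕ) : ℝ≥0∞)⁻¹ ^ l else 0 :=
      Finset.sum_congr rfl fun v hv =>
        nbWalkFrom_some_apply hreg hd l (mem_nextNodes.1 hv).1.symm W
    rw [hsum]
    rcases W with _ | ⟨b, W⟩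
    · simp
    simp only [List.head?_cons, Option.some.injEq, List.length_cons, add_left_inj, true_and]
    by_cases hW : W.length = l ∧ IsNB G (a :: b :: W)
    · rw [Finset.sum_eq_single b (fun v _ hvb => by simp [Ne.symm hvb])]
      · rw [if_pos ⟨hW.1, rfl, hW.2⟩, if_pos hW, walkWeight]
      · intro hb
        exact absurd (mem_nextNodes.2 ⟨(isNB_cons_cons.1 hW.2).1, by simp⟩) hb
    · rw [Finset.sum_eq_zero, mul_zero, if_neg hW]
      intro v hv
      rw [if_neg]
      rintro ⟨h1, -, h2⟩
      exact hW ⟨h1, h2⟩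

open Classical in
lemma nbWalk_apply (hreg : ∀ u, (nextNodes G none u).card = d) (hd : 2 ≤ d)
    (l : ℕ) (W : List V) :
    nbWalk G l W =
      if W.length = l + 1 ∧ IsNB G W then (Fintype.card V : ℝ≥0∞)⁻¹ * walkWeight d l else 0 := by
  rw [apply_eq_ex, ex_nbWalk]
  simp only [← apply_eq_ex, nbWalkFrom_none_apply hreg hd]
  rcases W with _ | ⟨a, W⟩
  · simp
  simp only [List.head?_cons, Option.some.injEq]
  rw [Finset.sum_eq_single a (fun v _ hv => by simp [Ne.symm hv]) (by simp)]
  simp only [true_and]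
  split_ifs <;> simp

lemma mem_support_nbWalk (hreg : ∀ u, (nextNodes G none u).card = d) (hd : 2 ≤ d)
    {l : ℕ} {W : List V} (h : W ∈ (nbWalk G l).support) : W.length = l + 1 ∧ IsNB G W := by
  classical
  rw [PMF.mem_support_iff, nbWalk_apply hreg hd] at h
  by_contra hh
  exact h (if_neg hh)

lemma nbWalk_apply_le (hreg : ∀ u, (nextNodes G none u).card = d) (hd : 2 ≤ d)
    (l : ℕ) (W : List V) :
    nbWalk G l W ≤ (Fintype.card V : ℝ≥0∞)⁻¹ * walkWeight d l := by
  classical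
  rw [nbWalk_apply hreg hd]
  split_ifs <;> simp

/-- All non-backtracking lists of `l + 1` nodes have the same probability, and reversal permutes
them. -/
lemma ex_nbWalk_reverse (hreg : ∀ u, (nextNodes G none u).card = d) (hd : 2 ≤ d)
    (l : ℕ) (f : List V → ℝ≥0∞) :
    ex (nbWalk G l) (fun W => f W.reverse) = ex (nbWalk G l) f := by
  classical
  unfold ex
  rw [← (Equiv.ofBijective _ List.reverse_involutive.bijective).tsum_eq]
  refine tsum_congr fun W => ?_
  simp only [Equiv.ofBijective_apply, List.reverse_reverse]
  congr 1
  rw [nbWalk_apply hreg hd, nbWalk_apply hreg hd, List.length_reverse]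
  congr 2
  rw [eq_iff_iff]
  exact ⟨fun h => by simpa using isNB_reverse h, isNB_reverse⟩

/-- Each neighbour of `v` is an allowed first step for exactly `d - 1` of the `d` possible
predecessors, so averaging over the predecessor gives the walk without memory. -/
lemma sum_ex_nbWalkFrom_some (hreg : ∀ u, (nextNodes G none u).card = d) (hd : 2 ≤ d)
    (l : ℕ) (v : V) (f : List V → ℝ≥0∞) :
    ∑ u ∈ nextNodes G none v, ex (nbWalkFrom G l (some u) v) f =
      d * ex (nbWalkFrom G l none v) f := by
  have hd0 : (d : ℝ≥0∞) ≠ 0 := Nat.cast_ne_zero.2 (by omega)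
  have hd1 : ((d - 1 : ℕ) : ℝ≥0∞) ≠ 0 := Nat.cast_ne_zero.2 (by omega)
  cases l with
  | zero => simp [nbWalkFrom, hreg]
  | succ l =>
    classical
    simp only [ex_nbWalkFrom_succ]
    rw [ex_uniformOn (nextNodes_nonempty hreg hd _ _), hreg, ← mul_assoc,
      ENNReal.mul_inv_cancel hd0 (by simp), one_mul]
    set g : V → ℝ≥0∞ := fun w => ex (nbWalkFrom G l (some v) w) fun W => f (v :: W)
    calc ∑ u ∈ nextNodes G none v, ex (uniformOn (nextNodes G (some u) v)) g
        = ∑ u ∈ nextNodes G none v, ((d - 1 : ℕ) : ℝ≥0∞)⁻¹ *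
            ∑ w ∈ nextNodes G none v, if w = u then 0 else g w := by
          refine Finset.sum_congr rfl fun u hu => ?_
          rw [ex_uniformOn (nextNodes_nonempty hreg hd _ _),
            card_nextNodes_some hreg (mem_nextNodes.1 hu).1]
          congr 1
          have : nextNodes G (some u) v = (nextNodes G none v).filter fun w => ¬ w = u := by
            ext w; simp only [mem_nextNodes, Finset.mem_filter]; grind
          rw [this, Finset.sum_filter]
          refine Finset.sum_congr rfl fun w _ => ?_
          by_cases h : w = u <;> simp [h]
      _ = ((d - 1 : ℕ) : ℝ≥0∞)⁻¹ * ∑ w ∈ nextNodes G none v, ((d - 1 : ℕ) : ℝ≥0∞) * g w := by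
          rw [← Finset.mul_sum, Finset.sum_comm]
          congr 1
          refine Finset.sum_congr rfl fun w hw => ?_
          have : ∀ u, (if w = u then 0 else g w) = if u ≠ w then g w else 0 := fun u => by
            by_cases h : u = w
            · simp [h]
            · simp [h, Ne.symm h]
          simp only [this]
          rw [← Finset.sum_filter, Finset.sum_const, nsmul_eq_mul, Finset.filter_ne',
            Finset.card_erase_of_mem hw, hreg]
      _ = _ := by
          rw [← Finset.mul_sum, ← mul_assoc, ENNReal.inv_mul_cancel hd1 (by simp), one_mul]

/-- Stationarity: the first step is a uniformly random directed edge, so the second node is uniform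
and its predecessor is a uniformly random neighbour. -/
lemma ex_nbWalk_tail (hreg : ∀ u, (nextNodes G none u).card = d) (hd : 2 ≤ d)
    (l : ℕ) (f : List V → ℝ≥0∞) :
    ex (nbWalk G (l + 1)) (fun W => f W.tail) = ex (nbWalk G l) f := by
  classical
  have hd0 : (d : ℝ≥0∞) ≠ 0 := Nat.cast_ne_zero.2 (by omega)
  rw [ex_nbWalk, ex_nbWalk]
  congr 1
  simp only [ex_nbWalkFrom_succ, List.tail_cons]
  calc ∑ u, ex (uniformOn (nextNodes G none u)) (fun v => ex (nbWalkFrom G l (some u) v) f)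
      = ∑ u, ∑ v, if G.Adj u v then (d : ℝ≥0∞)⁻¹ * ex (nbWalkFrom G l (some u) v) f else 0 := by
        refine Finset.sum_congr rfl fun u _ => ?_
        rw [ex_uniformOn (nextNodes_nonempty hreg hd _ _), hreg, Finset.mul_sum,
          ← Finset.sum_filter]
        refine Finset.sum_congr ?_ fun _ _ => rfl
        ext w; simp [mem_nextNodes]
    _ = ∑ v, (d : ℝ≥0∞)⁻¹ * ∑ u ∈ nextNodes G none v, ex (nbWalkFrom G l (some u) v) f := by
        rw [Finset.sum_comm]
        refine Finset.sum_congr rfl fun v _ => ?_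
        rw [Finset.mul_sum, ← Finset.sum_filter]
        refine Finset.sum_congr ?_ fun _ _ => rfl
        ext w; simp [mem_nextNodes, G.adj_comm]
    _ = _ := by
        refine Finset.sum_congr rfl fun v _ => ?_
        rw [sum_ex_nbWalkFrom_some hreg hd, ← mul_assoc, ENNReal.inv_mul_cancel hd0 (by simp),
          one_mul]

lemma ex_nbWalk_drop (hreg : ∀ u, (nextNodes G none u).card = d) (hd : 2 ≤ d)
    (l i : ℕ) (f : List V → ℝ≥0∞) :
    ex (nbWalk G (l + i)) (fun W => f (W.drop i)) = ex (nbWalk G l) f := by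
  induction i with
  | zero => simp
  | succ i ih =>
    rw [← ih, ← add_assoc, ← ex_nbWalk_tail hreg hd (l + i)]
    simp [List.drop_tail]

lemma ex_nbWalk_take (hreg : ∀ u, (nextNodes G none u).card = d) (hd : 2 ≤ d)
    (l i : ℕ) (f : List V → ℝ≥0∞) :
    ex (nbWalk G (l + i)) (fun W => f (W.take (l + 1))) = ex (nbWalk G l) f := by
  rw [← ex_nbWalk_reverse hreg hd l f, ← ex_nbWalk_drop hreg hd l i,
    ← ex_nbWalk_reverse hreg hd (l + i)]
  refine le_antisymm (ex_mono_support _ fun W hW => ?_) (ex_mono_support _ fun W hW => ?_) <;>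
  · have := (mem_support_nbWalk hreg hd hW).1
    rw [List.take_reverse, this]
    simp [show l + i + 1 - (l + 1) = i by omega]

end Law

/-! ### How a walk meets a given set of nodes -/

section Hitting
variable {G : SimpleGraph V} {d : ℕ}

open Classical in
-- By stationarity position `i` is uniform, and conditioned on its value the rest of the walk is a
-- fresh walk from there.
lemma ex_nbWalk_getElem? (hreg : ∀ u, (nextNodes G none u).card = d) (hd : 2 ≤ d)
    {l i : ℕ} (hi : i ≤ l) (x : V) (f : List V → ℝ≥0∞) :
    ex (nbWalk G l) (fun W => if W[i]? = some x then f (W.drop i) else 0) =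
      (Fintype.card V : ℝ≥0∞)⁻¹ * ex (nbWalkFrom G (l - i) none x) f := by
  have h := ex_nbWalk_drop hreg hd (l - i) i fun W => if W.head? = some x then f W else 0
  rw [Nat.sub_add_cancel hi] at h
  simp only [List.head?_drop] at h
  rw [h, ex_nbWalk]
  congr 1
  rw [Finset.sum_eq_single x]
  · refine le_antisymm (ex_mono_support _ fun W hW => ?_) (ex_mono_support _ fun W hW => ?_) <;>
    · rw [PMF.mem_support_iff, nbWalkFrom_none_apply hreg hd] at hW
      have : W.head? = some x := by
        by_contra hh; exact hW (if_neg fun h => hh h.2.1)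
      rw [if_pos this]
  · intro v _ hv
    rw [← nonpos_iff_eq_zero, ← ex_const (nbWalkFrom G (l - i) none v) 0]
    refine ex_mono_support _ fun W hW => ?_
    rw [PMF.mem_support_iff, nbWalkFrom_none_apply hreg hd] at hW
    have : W.head? = some v := by
      by_contra hh; exact hW (if_neg fun h => hh h.2.1)
    rw [this, if_neg (by simpa using hv), ex_const]
  · simp

lemma pr_nbWalk_getElem? (hreg : ∀ u, (nextNodes G none u).card = d) (hd : 2 ≤ d)
    {l i : ℕ} (hi : i ≤ l) (x : V) :
    pr (nbWalk G l) (fun W => W[i]? = some x) = (Fintype.card V : ℝ≥0∞)⁻¹ := by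
  classical
  have := ex_nbWalk_getElem? hreg hd hi x fun _ => 1
  rw [ex_const, mul_one] at this
  rw [pr_eq_ex, ← this]

omit [Fintype V] [Nonempty V] in
lemma exists_lt_getElem?_of_mem {W : List V} {l : ℕ} (hW : W.length = l + 1) {x : V}
    (hx : x ∈ W) : ∃ i ∈ Finset.range (l + 1), W[i]? = some x := by
  obtain ⟨i, hi, rfl⟩ := List.getElem_of_mem hx
  exact ⟨i, by simpa [hW] using hi, by simp⟩

lemma pr_nbWalk_meets (hreg : ∀ u, (nextNodes G none u).card = d) (hd : 2 ≤ d)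
    (l : ℕ) (U : Finset V) :
    pr (nbWalk G l) (fun W => ∃ x ∈ U, x ∈ W) ≤
      (l + 1 : ℕ) * U.card * (Fintype.card V : ℝ≥0∞)⁻¹ := by
  calc pr (nbWalk G l) (fun W => ∃ x ∈ U, x ∈ W)
      ≤ pr (nbWalk G l) (fun W => ∃ q ∈ Finset.range (l + 1) ×ˢ U, W[q.1]? = some q.2) := by
        refine pr_mono_support _ fun W hW => ?_
        rintro ⟨x, hx, hxW⟩
        obtain ⟨i, hi, hix⟩ := exists_lt_getElem?_of_mem (mem_support_nbWalk hreg hd hW).1 hxW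
        exact ⟨(i, x), Finset.mem_product.2 ⟨hi, hx⟩, hix⟩
    _ ≤ ∑ q ∈ Finset.range (l + 1) ×ˢ U, pr (nbWalk G l) (fun W => W[q.1]? = some q.2) :=
        pr_exists_mem_le _ _ _
    _ = ∑ q ∈ Finset.range (l + 1) ×ˢ U, (Fintype.card V : ℝ≥0∞)⁻¹ := by
        refine Finset.sum_congr rfl fun q hq => ?_
        have := Finset.mem_range.1 (Finset.mem_product.1 hq).1
        exact pr_nbWalk_getElem? hreg hd (by omega) _
    _ = _ := by simp [Finset.card_product]

/-- The girth leaves at most one non-backtracking walk of length `s` from `x` to `y`, so the event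
has at most one atom. -/
lemma pr_nbWalk_endpoints (hreg : ∀ u, (nextNodes G none u).card = d) (hd : 2 ≤ d)
    {s : ℕ} (hg : ((2 * s : ℕ) : ℕ∞) < G.egirth) (x y : V) :
    pr (nbWalk G s) (fun W => W.head? = some x ∧ W.getLast? = some y) ≤
      (Fintype.card V : ℝ≥0∞)⁻¹ * walkWeight d s := by
  classical
  by_cases h : ∃ W₀ ∈ (nbWalk G s).support, W₀.head? = some x ∧ W₀.getLast? = some y
  · obtain ⟨W₀, hW₀, hx₀, hy₀⟩ := h
    have h0 := mem_support_nbWalk hreg hd hW₀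
    calc _ ≤ pr (nbWalk G s) (fun W => W = W₀) := by
          refine pr_mono_support _ fun W hW => ?_
          rintro ⟨hx, hy⟩
          have h1 := mem_support_nbWalk hreg hd hW
          exact h1.2.eq_of_egirth h0.2 hx hx₀ hy hy₀ h1.1 h0.1 hg
      _ = nbWalk G s W₀ := by
          rw [pr_eq_ex, apply_eq_ex]
      _ ≤ _ := nbWalk_apply_le hreg hd s W₀
  · push Not at h
    calc _ ≤ pr (nbWalk G s) (fun _ => False) :=
          pr_mono_support _ fun W hW hh => h W hW hh.1 hh.2
      _ = 0 := by simp [pr, ex_const]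
      _ ≤ _ := zero_le

lemma pr_nbWalk_getElem?_two (hreg : ∀ u, (nextNodes G none u).card = d) (hd : 2 ≤ d)
    {l i j : ℕ} (hij : i ≤ j) (hj : j ≤ l) (hg : ((2 * l : ℕ) : ℕ∞) < G.egirth) (x y : V) :
    pr (nbWalk G l) (fun W => W[i]? = some x ∧ W[j]? = some y) ≤
      (Fintype.card V : ℝ≥0∞)⁻¹ * ((d - 1 : ℕ) : ℝ≥0∞)⁻¹ ^ (j - i) := by
  classical
  obtain ⟨s, rfl⟩ := Nat.exists_eq_add_of_le hij
  obtain ⟨t, rfl⟩ := Nat.exists_eq_add_of_le hj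
  rw [show i + s - i = s by omega]
  have h := ex_nbWalk_drop hreg hd (s + t) i fun W =>
    if (W.take (s + 1)).head? = some x ∧ (W.take (s + 1)).getLast? = some y then 1 else 0
  rw [ex_nbWalk_take hreg hd s t fun W => if W.head? = some x ∧ W.getLast? = some y
    then 1 else 0] at h
  have hg' : ((2 * s : ℕ) : ℕ∞) < G.egirth :=
    lt_of_le_of_lt (by exact_mod_cast (by omega : 2 * s ≤ 2 * (i + s + t))) hg
  refine le_trans ?_ ((pr_nbWalk_endpoints hreg hd hg' x y).trans
    (mul_le_mul_right (walkWeight_le d s) _))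
  rw [pr_eq_ex, pr_eq_ex, ← show s + t + i = i + s + t by omega]
  refine le_trans ?_ (le_of_eq h)
  refine ex_mono_support _ fun W hW => ?_
  have hl := (mem_support_nbWalk hreg hd hW).1
  refine le_of_eq ?_
  congr 1
  rw [List.getLast?_eq_getElem?]
  simp only [List.head?_take, List.head?_drop, List.length_take, List.length_drop, hl]
  rw [List.getElem?_take, List.getElem?_drop]
  have : min (s + 1) (s + t + i + 1 - i) - 1 = s := by omega
  simp [this]

open Classical in
-- Let `i` and `j` be the first and last positions at which the walk is in `U`. The walk has at
-- least `l - (j - i)` nodes outside `U`, while hitting prescribed nodes at `i` and `j` costs `(d -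
-- 1)⁻¹ ^ (j - i)` besides `1 / n`. The two powers always multiply to `(d - 1)⁻¹ ^ l`; the square
-- counts the choices of positions and nodes.
lemma ex_nbWalk_meets_pow (hreg : ∀ u, (nextNodes G none u).card = d) (hd : 2 ≤ d)
    (l : ℕ) (hg : ((2 * l : ℕ) : ℕ∞) < G.egirth) (U : Finset V) :
    ex (nbWalk G l) (fun W => if ∃ x ∈ U, x ∈ W then
      ((d - 1 : ℕ) : ℝ≥0∞)⁻¹ ^ (W.toFinset \ U).card else 0) ≤
      ((l + 1 : ℕ) * U.card) ^ 2 * ((Fintype.card V : ℝ≥0∞)⁻¹ * ((d - 1 : ℕ) : ℝ≥0∞)⁻¹ ^ l) := by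
  set θ : ℝ≥0∞ := ((d - 1 : ℕ) : ℝ≥0∞)⁻¹ with hθ
  have hθ1 : θ ≤ 1 := by
    rw [hθ, ENNReal.inv_le_one]
    exact_mod_cast (by omega : 1 ≤ d - 1)
  set S := Finset.range (l + 1) ×ˢ U
  have key : ∀ W ∈ (nbWalk G l).support, (if ∃ x ∈ U, x ∈ W then θ ^ (W.toFinset \ U).card else 0) ≤
      ∑ q ∈ S, ∑ r ∈ S, if q.1 ≤ r.1 then θ ^ (l - (r.1 - q.1)) *
        (if W[q.1]? = some q.2 ∧ W[r.1]? = some r.2 then 1 else 0) else 0 := by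
    intro W hW
    obtain ⟨hl, hnb⟩ := mem_support_nbWalk hreg hd hW
    have hnd := hnb.nodup_of_egirth hl hg
    split_ifs with h
    swap
    · exact zero_le
    let I := (Finset.range (l + 1)).filter fun i => ∃ x ∈ U, W[i]? = some x
    have hI : I.Nonempty := by
      obtain ⟨x, hx, hxW⟩ := h
      obtain ⟨i, hi, hix⟩ := exists_lt_getElem?_of_mem hl hxW
      exact ⟨i, by simp only [I, Finset.mem_filter]; exact ⟨hi, x, hx, hix⟩⟩
    have hi := I.min'_mem hI
    have hj := I.max'_mem hI
    set i := I.min' hI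
    set j := I.max' hI
    have hij : i ≤ j := I.min'_le_max' hI
    simp only [I, Finset.mem_filter] at hi hj
    obtain ⟨hi1, x, hx, hix⟩ := hi
    obtain ⟨hj1, y, hy, hjy⟩ := hj
    have hcard : (W.toFinset ∩ U).card ≤ j + 1 - i := by
      rw [← Nat.card_Icc]
      refine Finset.card_le_card_of_surjOn (fun k => W.getD k x) ?_
      intro z hz
      have hz' := Finset.mem_inter.1 (Finset.mem_coe.1 hz)
      obtain ⟨k, hk, hkz⟩ := exists_lt_getElem?_of_mem hl (List.mem_toFinset.1 hz'.1)
      have hkI : k ∈ I := Finset.mem_filter.2 ⟨hk, z, hz'.2, hkz⟩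
      refine ⟨k, ?_, ?_⟩
      · simpa using ⟨I.min'_le k hkI, I.le_max' k hkI⟩
      · simp [List.getD_eq_getElem?_getD, hkz]
    -- The walk has `l + 1` distinct nodes, of which at most `j + 1 - i` lie in `U`.
    have hsd : l - (j - i) ≤ (W.toFinset \ U).card := by
      have h1 := Finset.card_sdiff_add_card_inter W.toFinset U
      rw [List.toFinset_card_of_nodup hnd, hl] at h1
      omega
    calc θ ^ (W.toFinset \ U).card ≤ θ ^ (l - (j - i)) := pow_le_pow_right_of_le_one' hθ1 hsd
      _ = if i ≤ j then θ ^ (l - (j - i)) *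
          (if W[i]? = some x ∧ W[j]? = some y then 1 else 0) else 0 := by simp [hij, hix, hjy]
      _ ≤ ∑ r ∈ S, if i ≤ r.1 then θ ^ (l - (r.1 - i)) *
          (if W[i]? = some x ∧ W[r.1]? = some r.2 then 1 else 0) else 0 :=
          Finset.single_le_sum (f := fun r : ℕ × V => if i ≤ r.1 then θ ^ (l - (r.1 - i)) *
            (if W[i]? = some x ∧ W[r.1]? = some r.2 then (1 : ℝ≥0∞) else 0) else 0)
            (fun _ _ => zero_le) (Finset.mem_product.2 ⟨hj1, hy⟩ : (j, y) ∈ S)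
      _ ≤ _ :=
          Finset.single_le_sum (f := fun q : ℕ × V => ∑ r ∈ S, if q.1 ≤ r.1 then
            θ ^ (l - (r.1 - q.1)) *
            (if W[q.1]? = some q.2 ∧ W[r.1]? = some r.2 then (1 : ℝ≥0∞) else 0) else 0)
            (fun _ _ => zero_le) (Finset.mem_product.2 ⟨hi1, hx⟩ : (i, x) ∈ S)
  refine (ex_mono_support _ key).trans ?_
  simp only [ex_sum]
  calc _ ≤ ∑ q ∈ S, ∑ r ∈ S, (Fintype.card V : ℝ≥0∞)⁻¹ * θ ^ l := by
        refine Finset.sum_le_sum fun q hq => Finset.sum_le_sum fun r hr => ?_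
        have hr1 := Finset.mem_range.1 (Finset.mem_product.1 hr).1
        split_ifs with hqr
        · rw [ex_mul_left, ← pr_eq_ex]
          calc _ ≤ θ ^ (l - (r.1 - q.1)) * ((Fintype.card V : ℝ≥0∞)⁻¹ * θ ^ (r.1 - q.1)) :=
                mul_le_mul_right
                  (pr_nbWalk_getElem?_two hreg hd hqr (by omega) hg q.2 r.2) _
            _ = _ := by
                rw [mul_left_comm, ← pow_add, Nat.sub_add_cancel (by omega)]
        · rw [ex_const]; exact zero_le
    _ = _ := by
        simp only [Finset.sum_const, nsmul_eq_mul, S, Finset.card_product, Finset.card_range]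
        push_cast
        ring

end Hitting

/-! ### Near-uniformity of a single placement -/

section Placement
variable {G : SimpleGraph V} {d : ℕ}

/-- Every node has at most a tenth of its `d` neighbours loaded above level `M`. -/
def Good (G : SimpleGraph V) (d M : ℕ) (load : V → ℕ) : Prop :=
  ∀ w, 10 * ((nextNodes G none w).filter fun v => M < load v).card ≤ d

omit [Nonempty V] in
lemma nextNodes_subset (prev : Option V) (u : V) : nextNodes G prev u ⊆ nextNodes G none u := by
  intro v; simp only [mem_nextNodes]; grind

/-- Under `Good`, each step reaches a node of load at most `M` with probability at least `4 / 5`,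
even with one neighbour forbidden. The offset `a` accumulates the nodes already counted, so that the
induction can go forward along the walk. -/
lemma ex_nbWalkFrom_inv_countP_le (hreg : ∀ u, (nextNodes G none u).card = d) (hd : 2 ≤ d)
    {M : ℕ} {load : V → ℕ} (hgood : Good G d M load) (r : ℕ) (prev : Option V) (u : V) (a : ℕ)
    (ha : 1 ≤ a) :
    ex (nbWalkFrom G r prev u) (fun W => ((a + W.countP (load · ≤ M) : ℕ) : ℝ≥0∞)⁻¹) ≤
      ENNReal.ofReal (1 / ((a : ℝ) + (if load u ≤ M then 1 else 0) + r / 4)) := by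
  induction r generalizing prev u a with
  | zero =>
    rw [nbWalkFrom, ex_pure, one_div, ENNReal.ofReal_inv_of_pos (by positivity)]
    refine le_of_eq ?_
    congr 1
    rw [← ENNReal.ofReal_natCast]
    congr 1
    by_cases h : load u ≤ M <;> simp [h]
  | succ r ih =>
    rw [ex_nbWalkFrom_succ]
    set b : ℕ := a + if load u ≤ M then 1 else 0 with hb
    have hab : 1 ≤ b := by omega
    have hbr : (b : ℝ) = (a : ℝ) + (if load u ≤ M then 1 else 0) := by
      rw [hb]; push_cast; rfl
    have hb1 : (1 : ℝ) ≤ b := by exact_mod_cast hab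
    rw [← hbr]
    set S := nextNodes G prev u
    have hS : S.Nonempty := nextNodes_nonempty hreg hd prev u
    have hScard : d - 1 ≤ S.card := le_card_nextNodes hreg prev u
    set k := (S.filter fun v => ¬ load v ≤ M).card with hk
    have hkd : 10 * k ≤ d := by
      refine le_trans ?_ (hgood u)
      gcongr 10 * ?_
      refine Finset.card_le_card fun v hv => ?_
      have := Finset.mem_filter.1 hv
      exact Finset.mem_filter.2 ⟨nextNodes_subset prev u this.1, by simpa using this.2⟩
    have h5 : 5 * k ≤ S.card := by omega
    rw [ex_uniformOn hS]
    have hcard : (0 : ℝ) < S.card := by exact_mod_cast Finset.card_pos.2 hS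
    calc (S.card : ℝ≥0∞)⁻¹ * ∑ v ∈ S, ex (nbWalkFrom G r (some u) v)
            (fun W => ((a + (u :: W).countP (load · ≤ M) : ℕ) : ℝ≥0∞)⁻¹)
        ≤ (S.card : ℝ≥0∞)⁻¹ * ∑ v ∈ S,
            ENNReal.ofReal (1 / ((b : ℝ) + (if load v ≤ M then 1 else 0) + r / 4)) := by
          gcongr with v hv
          refine le_trans (le_of_eq ?_) (ih (some u) v b hab)
          congr 1
          ext W
          congr 2
          rw [List.countP_cons, hb]
          simp only [decide_eq_true_eq]
          omega
      _ = ENNReal.ofReal ((S.card : ℝ)⁻¹ *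
            ∑ v ∈ S, 1 / ((b : ℝ) + (if load v ≤ M then 1 else 0) + r / 4)) := by
          rw [ENNReal.ofReal_mul (by positivity), ENNReal.ofReal_inv_of_pos hcard,
            ENNReal.ofReal_natCast, ENNReal.ofReal_sum_of_nonneg]
          intro v _; positivity
      _ ≤ ENNReal.ofReal (1 / ((b : ℝ) + (r + 1 : ℕ) / 4)) := by
          apply ENNReal.ofReal_le_ofReal
          have hsum : ∑ v ∈ S, 1 / ((b : ℝ) + (if load v ≤ M then 1 else 0) + r / 4) =
              ((S.card : ℝ) - k) * (1 / (b + 1 + r / 4)) + k * (1 / (b + r / 4)) := by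
            rw [← Finset.sum_filter_add_sum_filter_not S fun v => load v ≤ M]
            have h1 : ((S.filter fun v => load v ≤ M).card : ℝ) = S.card - k := by
              rw [eq_sub_iff_add_eq, hk]
              exact_mod_cast Finset.card_filter_add_card_filter_not (s := S) (fun v => load v ≤ M)
            congr 1
            · rw [← h1, ← nsmul_eq_mul, ← Finset.sum_const]
              refine Finset.sum_congr rfl fun v hv => ?_
              rw [if_pos (Finset.mem_filter.1 hv).2]
            · rw [hk, ← nsmul_eq_mul, ← Finset.sum_const]
              refine Finset.sum_congr rfl fun v hv => ?_
              rw [if_neg (Finset.mem_filter.1 hv).2, add_zero]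
          rw [hsum]
          have h5' : 5 * (k : ℝ) ≤ S.card := by exact_mod_cast h5
          push_cast
          set c : ℝ := b + r / 4 with hc
          have hr : (0 : ℝ) ≤ r / 4 := by positivity
          have hc1 : 1 ≤ c := by linarith
          rw [show (b : ℝ) + 1 + r / 4 = c + 1 by ring, show (b : ℝ) + (r + 1) / 4 = c + 1 / 4 by ring]
          have e1 : 0 ≤ 1 / c - 1 / (c + 1) := by
            rw [sub_nonneg]; apply one_div_le_one_div_of_le <;> linarith
          -- Averaging reciprocals loses against averaging counts: a step adds one with probability
          -- `4 / 5`, but only `1 / 4` is credited, which suffices for all `c ≥ 1`.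
          have e2 : 4 / 5 * (1 / (c + 1)) + 1 / 5 * (1 / c) ≤ 1 / (c + 1 / 4) := by
            rw [← sub_nonneg]
            have : 1 / (c + 1 / 4) - (4 / 5 * (1 / (c + 1)) + 1 / 5 * (1 / c)) =
              (11 / 20 * c - 1 / 20) / (c * (c + 1) * (c + 1 / 4)) := by
              field_simp
              ring
            rw [this]
            apply div_nonneg
            · linarith
            · positivity
          refine le_trans ?_ e2
          rw [inv_mul_le_iff₀ hcard]
          nlinarith [mul_nonneg (sub_nonneg.2 h5') e1]

omit [Nonempty V] in
lemma mem_leastLoaded {load : V → ℕ} {W : List V} {v : V} :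
    v ∈ leastLoaded load W ↔ v ∈ W ∧ ∀ u ∈ W, load v ≤ load u := by
  simp [leastLoaded]

omit [Nonempty V] in
lemma leastLoaded_nonempty (load : V → ℕ) {W : List V} (hW : W ≠ []) :
    (leastLoaded load W).Nonempty := by
  classical
  have hne : W.toFinset.Nonempty := by
    simpa using hW
  obtain ⟨v, hv, hmin⟩ := W.toFinset.exists_min_image load hne
  exact ⟨v, mem_leastLoaded.2 ⟨by simpa using hv, fun u hu => hmin u (by simpa using hu)⟩⟩

open Classical in
-- If `u` is least loaded on `W` and has load at least `M`, then every node of `W` with load at most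
-- `M` ties with it, and `u` gets the ball with probability one over the number of ties. The `1 +`
-- and the factor `2` cover the case that there is no such node.
lemma ex_leastLoaded_le (load : V → ℕ) (M : ℕ) {W : List V} (hW : W.Nodup) (hne : W ≠ []) (u : V) :
    ex (uniformOn (leastLoaded load W)) (fun v => if v = u ∧ M ≤ load u then 1 else 0) ≤
      if u ∈ W then 2 * ((1 + W.countP (load · ≤ M) : ℕ) : ℝ≥0∞)⁻¹ else 0 := by
  rw [ex_uniformOn (leastLoaded_nonempty load hne)]
  by_cases h : u ∈ leastLoaded load W ∧ M ≤ load u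
  swap
  · rw [Finset.sum_eq_zero, mul_zero]
    · exact zero_le
    · intro v hv
      rw [if_neg]
      rintro ⟨rfl, hM⟩
      exact h ⟨hv, hM⟩
  obtain ⟨hu, hM⟩ := h
  obtain ⟨huW, humin⟩ := mem_leastLoaded.1 hu
  have hpos : 0 < (leastLoaded load W).card := Finset.card_pos.2 ⟨u, hu⟩
  have hsum : ∑ v ∈ leastLoaded load W, (if v = u ∧ M ≤ load u then (1 : ℝ≥0∞) else 0) = 1 := by
    simp [hM, hu]
  rw [hsum, mul_one, if_pos huW]
  have hc : W.countP (load · ≤ M) ≤ (leastLoaded load W).card := by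
    rw [List.countP_eq_length_filter, ← List.toFinset_card_of_nodup (hW.filter _)]
    refine Finset.card_le_card fun v hv => ?_
    simp only [List.toFinset_filter, Finset.mem_filter, List.mem_toFinset,
      decide_eq_true_eq] at hv
    rw [mem_leastLoaded]
    refine ⟨hv.1, fun w hw => ?_⟩
    exact hv.2.trans (hM.trans (humin w hw))
  have h2 : 1 + W.countP (load · ≤ M) ≤ 2 * (leastLoaded load W).card := by omega
  have h3 : ((1 + W.countP (load · ≤ M) : ℕ) : ℝ≥0∞) ≤ 2 * ((leastLoaded load W).card : ℝ≥0∞) := by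
    exact_mod_cast h2
  calc ((leastLoaded load W).card : ℝ≥0∞)⁻¹
      = 2 * (2 * ((leastLoaded load W).card : ℝ≥0∞))⁻¹ := by
        rw [ENNReal.mul_inv (by simp) (by simp), ← mul_assoc,
          ENNReal.mul_inv_cancel (by simp) (by simp), one_mul]
    _ ≤ _ := by gcongr

open Classical in
-- If `u` sits in the first half of the walk, at least `l / 2` fresh steps follow, and the expected
-- reciprocal is at most `8 / (l + 1)`; the second half follows by reversal. Each of the `l + 1`
-- positions equals `u` with probability `1 / n`, so the length cancels.
lemma ex_nbWalk_mem_inv_countP_le (hreg : ∀ u, (nextNodes G none u).card = d) (hd : 2 ≤ d)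
    (l : ℕ) {M : ℕ} {load : V → ℕ} (hgood : Good G d M load) (u : V) :
    ex (nbWalk G l) (fun W => if u ∈ W then ((1 + W.countP (load · ≤ M) : ℕ) : ℝ≥0∞)⁻¹ else 0) ≤
      8 * (Fintype.card V : ℝ≥0∞)⁻¹ := by
  set A : ℝ≥0∞ := (Fintype.card V : ℝ≥0∞)⁻¹ * ENNReal.ofReal (8 / (l + 1)) with hA
  have hdrop : ∀ i ≤ l, l ≤ 2 * (l - i) → ex (nbWalk G l) (fun W => if W[i]? = some u then
      ((1 + W.countP (load · ≤ M) : ℕ) : ℝ≥0∞)⁻¹ else 0) ≤ A := by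
    intro i hi hil
    calc _ ≤ ex (nbWalk G l) (fun W => if W[i]? = some u then
          ((1 + (W.drop i).countP (load · ≤ M) : ℕ) : ℝ≥0∞)⁻¹ else 0) := by
          refine ex_mono _ fun W => ?_
          split_ifs
          · gcongr
            exact (List.drop_sublist i W).countP_le
          · rfl
      _ = _ := ex_nbWalk_getElem? hreg hd hi u
            fun W => ((1 + W.countP (load · ≤ M) : ℕ) : ℝ≥0∞)⁻¹
      _ ≤ _ := by
          rw [hA]
          refine mul_le_mul_right
            ((ex_nbWalkFrom_inv_countP_le hreg hd hgood (l - i) none u 1 le_rfl).trans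
              (ENNReal.ofReal_le_ofReal ?_)) _
          have h1 : (l : ℝ) ≤ 2 * ((l - i : ℕ) : ℝ) := by exact_mod_cast hil
          have h2 : (0 : ℝ) ≤ if load u ≤ M then 1 else 0 := by positivity
          have hl : (0 : ℝ) ≤ l := by positivity
          rw [div_le_div_iff₀ (by positivity) (by positivity)]
          push_cast
          linarith
  have hone : ∀ i ≤ l, ex (nbWalk G l) (fun W => if W[i]? = some u then
      ((1 + W.countP (load · ≤ M) : ℕ) : ℝ≥0∞)⁻¹ else 0) ≤ A := by
    intro i hi
    by_cases hil : l ≤ 2 * (l - i)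
    · exact hdrop i hi hil
    · rw [← ex_nbWalk_reverse hreg hd]
      refine le_trans (ex_mono_support _ fun W hW => ?_) (hdrop (l - i) (by omega) (by omega))
      have hl := (mem_support_nbWalk hreg hd hW).1
      rw [List.getElem?_reverse (by omega), hl, List.countP_reverse,
        show l + 1 - 1 - i = l - i by omega]
  calc _ ≤ ex (nbWalk G l) (fun W => ∑ i ∈ Finset.range (l + 1), if W[i]? = some u then
          ((1 + W.countP (load · ≤ M) : ℕ) : ℝ≥0∞)⁻¹ else 0) := by
        refine ex_mono_support _ fun W hW => ?_
        split_ifs with hu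
        · obtain ⟨i, hi, hiu⟩ :=
            exists_lt_getElem?_of_mem (mem_support_nbWalk hreg hd hW).1 hu
          calc _ = if W[i]? = some u then
              ((1 + W.countP (load · ≤ M) : ℕ) : ℝ≥0∞)⁻¹ else 0 := by rw [if_pos hiu]
            _ ≤ _ := Finset.single_le_sum (f := fun i => if W[i]? = some u then
                ((1 + W.countP (load · ≤ M) : ℕ) : ℝ≥0∞)⁻¹ else 0) (fun _ _ => zero_le) hi
        · exact zero_le
    _ ≤ ∑ i ∈ Finset.range (l + 1), A := by
        rw [ex_sum]
        exact Finset.sum_le_sum fun i hi => hone i (by have := Finset.mem_range.1 hi; omega)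
    _ = _ := by
        rw [Finset.sum_const, Finset.card_range, nsmul_eq_mul, hA, mul_left_comm, mul_comm]
        congr 1
        rw [← ENNReal.ofReal_natCast, ← ENNReal.ofReal_mul (by positivity)]
        push_cast
        rw [mul_div_cancel₀ _ (by positivity)]
        simp

/-- Law of one round: the sampled walk together with the node that receives the ball. -/
def stepLaw (G : SimpleGraph V) (l : ℕ) (load : V → ℕ) : PMF (List V × V) :=
  (nbWalk G l).bind fun W => (uniformOn (leastLoaded load W)).map (Prod.mk W)

lemma ex_stepLaw (l : ℕ) (load : V → ℕ) (f : List V × V → ℝ≥0∞) :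
    ex (stepLaw G l load) f =
      ex (nbWalk G l) fun W => ex (uniformOn (leastLoaded load W)) fun v => f (W, v) := by
  simp only [stepLaw, ex_bind, ex_map, Function.comp_def]

lemma mem_support_stepLaw (hreg : ∀ u, (nextNodes G none u).card = d) (hd : 2 ≤ d)
    {l : ℕ} {load : V → ℕ} {s : List V × V} (h : s ∈ (stepLaw G l load).support) :
    s.1.length = l + 1 ∧ IsNB G s.1 ∧ s.2 ∈ s.1 ∧ ∀ u ∈ s.1, load s.2 ≤ load u := by
  rw [stepLaw, PMF.mem_support_bind_iff] at h
  obtain ⟨W, hW, h⟩ := h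
  have hW' := mem_support_nbWalk hreg hd hW
  rw [PMF.mem_support_map_iff] at h
  obtain ⟨v, hv, rfl⟩ := h
  have hne : W ≠ [] := by rintro rfl; simp at hW'
  rw [support_uniformOn (leastLoaded_nonempty load hne)] at hv
  exact ⟨hW'.1, hW'.2, mem_leastLoaded.1 hv⟩

lemma pr_stepLaw_walk (l : ℕ) (load : V → ℕ) (W : List V) :
    pr (stepLaw G l load) (fun s => s.1 = W) = nbWalk G l W := by
  classical
  rw [pr_eq_ex, ex_stepLaw, apply_eq_ex]
  congr 1
  ext W'
  exact ex_const (uniformOn (leastLoaded load W')) (if W' = W then (1 : ℝ≥0∞) else 0)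

lemma pr_stepLaw_place_le (hreg : ∀ u, (nextNodes G none u).card = d) (hd : 2 ≤ d)
    {l : ℕ} (hg : ((2 * l : ℕ) : ℕ∞) < G.egirth) {M : ℕ} {load : V → ℕ}
    (hgood : Good G d M load) (U : Finset V) :
    pr (stepLaw G l load) (fun s => s.2 ∈ U ∧ M ≤ load s.2) ≤
      16 * U.card * (Fintype.card V : ℝ≥0∞)⁻¹ := by
  classical
  calc _ ≤ pr (stepLaw G l load) (fun s => ∃ u ∈ U, s.2 = u ∧ M ≤ load u) :=
        pr_mono _ fun s hs => ⟨s.2, hs.1, rfl, hs.2⟩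
    _ ≤ ∑ u ∈ U, pr (stepLaw G l load) (fun s => s.2 = u ∧ M ≤ load u) := pr_exists_mem_le _ _ _
    _ ≤ ∑ u ∈ U, 2 * (8 * (Fintype.card V : ℝ≥0∞)⁻¹) := by
        refine Finset.sum_le_sum fun u _ => ?_
        refine le_trans ?_ (mul_le_mul_right (ex_nbWalk_mem_inv_countP_le hreg hd l hgood u) 2)
        rw [pr_eq_ex, ex_stepLaw, ← ex_mul_left]
        refine ex_mono_support _ fun W hW => ?_
        obtain ⟨hl, hnb⟩ := mem_support_nbWalk hreg hd hW
        refine (ex_leastLoaded_le load M (hnb.nodup_of_egirth hl hg)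
          (by rintro rfl; simp at hl) u).trans ?_
        split_ifs <;> simp
    _ = _ := by
        rw [Finset.sum_const, nsmul_eq_mul]
        ring

end Placement

/-! ### The history of the process -/

section History

open Classical in
/-- The load vector after the rounds recorded in a history (latest round first), started from `x`. -/
def loadOf (x : V → ℕ) : List (List V × V) → V → ℕ
  | [] => x
  | s :: H => Function.update (loadOf x H) s.2 (loadOf x H s.2 + 1)

/-- The walk sampled by ball number `t`. -/
def walkAt : List (List V × V) → ℕ → List V
  | [], _ => []
  | s :: H, t => if t = H.length then s.1 else walkAt H t

/-- The node that receives ball number `t`. -/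
def nodeAt : List (List V × V) → ℕ → Option V
  | [], _ => none
  | s :: H, t => if t = H.length then some s.2 else nodeAt H t

/-- The load of the node that receives ball number `t`, just before it does. -/
def levelAt (x : V → ℕ) : List (List V × V) → ℕ → ℕ
  | [], _ => 0
  | s :: H, t => if t = H.length then loadOf x H s.2 else levelAt x H t

/-- Every round of the history started from a good load vector. -/
def GoodThrough (G : SimpleGraph V) (d M : ℕ) (x : V → ℕ) : List (List V × V) → Prop
  | [] => True
  | _ :: H => Good G d M (loadOf x H) ∧ GoodThrough G d M x H

/-- Law of the history of `t` rounds from the load vector `x`. -/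
def hist (G : SimpleGraph V) (l : ℕ) (x : V → ℕ) : ℕ → PMF (List (List V × V))
  | 0 => PMF.pure []
  | t + 1 => (hist G l x t).bind fun H => (stepLaw G l (loadOf x H)).map fun s => s :: H

/-- Law of the load vector after `t` rounds from the load vector `x`. -/
def loadsFrom (G : SimpleGraph V) (l : ℕ) (x : V → ℕ) : ℕ → PMF (V → ℕ)
  | 0 => PMF.pure x
  | t + 1 => (loadsFrom G l x t).bind (allocRound G l)

lemma loads_eq_loadsFrom (G : SimpleGraph V) (l t : ℕ) :
    loads G l t = loadsFrom G l (fun _ => 0) t := by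
  induction t with
  | zero => rfl
  | succ t ih => rw [loads, loadsFrom, ih]

lemma loadsFrom_add (G : SimpleGraph V) (l : ℕ) (x : V → ℕ) (a b : ℕ) :
    loadsFrom G l x (a + b) = (loadsFrom G l x a).bind fun y => loadsFrom G l y b := by
  induction b with
  | zero => simp [loadsFrom]
  | succ b ih => rw [← add_assoc, loadsFrom, ih, PMF.bind_bind]; rfl

lemma allocRound_eq (G : SimpleGraph V) (l : ℕ) (x : V → ℕ) (H : List (List V × V)) :
    allocRound G l (loadOf x H) = (stepLaw G l (loadOf x H)).map fun s => loadOf x (s :: H) := by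
  simp only [allocRound, stepLaw, PMF.map_bind, PMF.map_comp, Function.comp_def, loadOf]

lemma loadsFrom_eq_map (G : SimpleGraph V) (l : ℕ) (x : V → ℕ) (t : ℕ) :
    loadsFrom G l x t = (hist G l x t).map (loadOf x) := by
  induction t with
  | zero => simp [loadsFrom, hist, PMF.pure_map, loadOf]
  | succ t ih =>
    simp only [loadsFrom, hist, ih, PMF.bind_map, PMF.map_bind, PMF.map_comp, Function.comp_def,
      allocRound_eq]

lemma ex_hist_succ (G : SimpleGraph V) (l : ℕ) (x : V → ℕ) (t : ℕ)
    (f : List (List V × V) → ℝ≥0∞) :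
    ex (hist G l x (t + 1)) f =
      ex (hist G l x t) fun H => ex (stepLaw G l (loadOf x H)) fun s => f (s :: H) := by
  simp only [hist, ex_bind, ex_map, Function.comp_def]

lemma mem_support_hist_succ {G : SimpleGraph V} {l : ℕ} {x : V → ℕ} {t : ℕ}
    {H' : List (List V × V)} (h : H' ∈ (hist G l x (t + 1)).support) :
    ∃ s H, H' = s :: H ∧ H ∈ (hist G l x t).support ∧
      s ∈ (stepLaw G l (loadOf x H)).support := by
  rw [hist, PMF.mem_support_bind_iff] at h
  obtain ⟨H, hH, h⟩ := h
  rw [PMF.mem_support_map_iff] at h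
  obtain ⟨s, hs, rfl⟩ := h
  exact ⟨s, H, rfl, hH, hs⟩

lemma length_of_mem_support_hist {G : SimpleGraph V} {l : ℕ} {x : V → ℕ} {t : ℕ}
    {H : List (List V × V)} (h : H ∈ (hist G l x t).support) : H.length = t := by
  induction t generalizing H with
  | zero => simpa [hist] using h
  | succ t ih =>
    obtain ⟨s, H', rfl, hH, -⟩ := mem_support_hist_succ h
    simp [ih hH]

omit [Fintype V] [Nonempty V] in
lemma loadOf_le_cons (x : V → ℕ) (s : List V × V) (H : List (List V × V)) (v : V) :
    loadOf x H v ≤ loadOf x (s :: H) v := by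
  classical
  rw [loadOf, Function.update_apply]
  split_ifs with h
  · subst h; omega
  · exact le_rfl

variable {G : SimpleGraph V} {d : ℕ}

lemma walkAt_of_mem_support (hreg : ∀ u, (nextNodes G none u).card = d) (hd : 2 ≤ d)
    {l : ℕ} {x : V → ℕ} {τ : ℕ} {H : List (List V × V)} (h : H ∈ (hist G l x τ).support)
    {t : ℕ} (ht : t < τ) :
    (walkAt H t).length = l + 1 ∧ IsNB G (walkAt H t) ∧
      ∃ v, nodeAt H t = some v ∧ v ∈ walkAt H t ∧
        ∀ y ∈ walkAt H t, levelAt x H t ≤ loadOf x H y := by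
  induction τ generalizing H with
  | zero => omega
  | succ τ ih =>
    obtain ⟨s, H', rfl, hH, hs⟩ := mem_support_hist_succ h
    have hl := length_of_mem_support_hist hH
    rw [walkAt, nodeAt, levelAt, hl]
    by_cases htt : t = τ
    · simp only [htt, if_true]
      obtain ⟨h1, h2, h3, h4⟩ := mem_support_stepLaw hreg hd hs
      exact ⟨h1, h2, s.2, rfl, h3, fun y hy => (h4 y hy).trans (loadOf_le_cons x s H' y)⟩
    · simp only [htt, if_false]
      obtain ⟨h1, h2, v, h3, h4, h5⟩ := ih hH (by omega)
      exact ⟨h1, h2, v, h3, h4, fun y hy => (h5 y hy).trans (loadOf_le_cons x s H' y)⟩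

omit [Fintype V] [Nonempty V] in
-- Loads rise by one at a time, so every intermediate level is the level of some ball.
lemma exists_ball_at_level (x : V → ℕ) (H : List (List V × V)) (v : V) (j : ℕ) (hj : x v ≤ j)
    (hj' : j < loadOf x H v) :
    ∃ t < H.length, nodeAt H t = some v ∧ levelAt x H t = j := by
  classical
  induction H with
  | nil => simp only [loadOf] at hj'; omega
  | cons s H ih =>
    by_cases hjH : j < loadOf x H v
    · obtain ⟨t, ht, h1, h2⟩ := ih hjH
      refine ⟨t, by simp; omega, ?_, ?_⟩
      · rw [nodeAt, if_neg (by omega), h1]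
      · rw [levelAt, if_neg (by omega), h2]
    · rw [loadOf, Function.update_apply] at hj'
      split_ifs at hj' with hv
      · refine ⟨H.length, by simp, ?_, ?_⟩
        · rw [nodeAt, if_pos rfl, hv]
        · rw [levelAt, if_pos rfl, ← hv]; subst hv; omega
      · omega

/-- The product of the weights of all rounds of a history. -/
def histWeight (w : List (List V × V) → List V × V → ℝ≥0∞) : List (List V × V) → ℝ≥0∞
  | [] => 1
  | s :: H => w H s * histWeight w H

/-- A supermartingale bound: conditional expectations are peeled off one round at a time, starting
with the last. -/
lemma ex_histWeight_le {l : ℕ} {x : V → ℕ} (w : List (List V × V) → List V × V → ℝ≥0∞)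
    (p : ℕ → ℝ≥0∞) (h : ∀ H, ex (stepLaw G l (loadOf x H)) (w H) ≤ p H.length) (τ : ℕ) :
    ex (hist G l x τ) (histWeight w) ≤ ∏ t ∈ Finset.range τ, p t := by
  induction τ with
  | zero => simp [hist, ex_pure, histWeight]
  | succ τ ih =>
    rw [ex_hist_succ, Finset.prod_range_succ]
    calc _ ≤ ex (hist G l x τ) fun H => histWeight w H * p τ := by
          refine ex_mono_support _ fun H hH => ?_
          simp only [histWeight]
          rw [ex_mul_right, mul_comm]
          have := h H
          rw [length_of_mem_support_hist hH] at this
          exact mul_le_mul_right this _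
      _ ≤ _ := by
          rw [ex_mul_right]
          exact mul_le_mul_left ih _

/-- Ball number `t` was placed in `U` at a height above `M`. -/
def PlacedAbove (x : V → ℕ) (M : ℕ) (U : Finset V) (H : List (List V × V)) (t : ℕ) : Prop :=
  ∃ v ∈ U, nodeAt H t = some v ∧ M ≤ levelAt x H t

open Classical in
/-- The balls with numbers outside `ts` that were placed in `U` at a height above `M`. -/
def ballsAbove (x : V → ℕ) (M : ℕ) (ts : List ℕ) (U : Finset V) (H : List (List V × V)) :
    Finset ℕ :=
  (Finset.range H.length).filter fun t => t ∉ ts ∧ PlacedAbove x M U H t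

open Classical in
/-- The weights used to bound the joint law of the walks with numbers in `ts` and the number of
further balls placed in `U`. -/
def witnessWeight (G : SimpleGraph V) (d M : ℕ) (x : V → ℕ) (ts : List ℕ) (ω : ℕ → List V)
    (U : Finset V) (H : List (List V × V)) (s : List V × V) : ℝ≥0∞ :=
  if H.length ∈ ts then if s.1 = ω H.length then 1 else 0
  else if Good G d M (loadOf x H) then 1 + (if s.2 ∈ U ∧ M ≤ loadOf x H s.2 then 1 else 0) else 0

lemma ex_witnessWeight_le (hreg : ∀ u, (nextNodes G none u).card = d) (hd : 2 ≤ d)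
    {l : ℕ} (hg : ((2 * l : ℕ) : ℕ∞) < G.egirth) (M : ℕ) (x : V → ℕ) (ts : List ℕ)
    (ω : ℕ → List V) (U : Finset V) (H : List (List V × V)) :
    ex (stepLaw G l (loadOf x H)) (witnessWeight G d M x ts ω U H) ≤
      if H.length ∈ ts then nbWalk G l (ω H.length)
      else 1 + 16 * U.card * (Fintype.card V : ℝ≥0∞)⁻¹ := by
  classical
  unfold witnessWeight
  by_cases h1 : H.length ∈ ts
  · simp only [h1, if_true]
    rw [← pr_eq_ex, pr_stepLaw_walk]
  · simp only [h1, if_false]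
    by_cases h2 : Good G d M (loadOf x H)
    · simp only [h2, if_true]
      rw [ex_add, ex_const, ← pr_eq_ex]
      gcongr
      exact pr_stepLaw_place_le hreg hd hg h2 U
    · simp only [h2, if_false]
      rw [ex_const]
      exact zero_le

omit [Nonempty V] in
open Classical in
lemma le_histWeight_witnessWeight (M : ℕ) (x : V → ℕ) (ts : List ℕ)
    (ω : ℕ → List V) (U : Finset V) (H : List (List V × V)) (hgt : GoodThrough G d M x H)
    (hω : ∀ t ∈ ts, t < H.length → walkAt H t = ω t) :
    2 ^ (ballsAbove x M ts U H).card ≤ histWeight (witnessWeight G d M x ts ω U) H := by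
  induction H with
  | nil => simp [ballsAbove, histWeight]
  | cons s H ih =>
    have ih' := ih hgt.2 fun t ht htl => by
      have := hω t ht (by simp; omega)
      rwa [walkAt, if_neg (by omega)] at this
    have hpl : ∀ t < H.length, (PlacedAbove x M U (s :: H) t ↔ PlacedAbove x M U H t) := by
      intro t ht
      unfold PlacedAbove
      rw [nodeAt, levelAt, if_neg (by omega), if_neg (by omega)]
    have hlast : PlacedAbove x M U (s :: H) H.length ↔ s.2 ∈ U ∧ M ≤ loadOf x H s.2 := by
      unfold PlacedAbove
      rw [nodeAt, levelAt, if_pos rfl, if_pos rfl]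
      simp
    have hcard : (ballsAbove x M ts U (s :: H)).card = (ballsAbove x M ts U H).card +
        if H.length ∉ ts ∧ s.2 ∈ U ∧ M ≤ loadOf x H s.2 then 1 else 0 := by
      unfold ballsAbove
      rw [List.length_cons, Finset.range_add_one, Finset.filter_insert]
      have : (Finset.range H.length).filter (fun t => t ∉ ts ∧ PlacedAbove x M U (s :: H) t) =
          (Finset.range H.length).filter (fun t => t ∉ ts ∧ PlacedAbove x M U H t) :=
        Finset.filter_congr fun t ht => by rw [hpl t (Finset.mem_range.1 ht)]
      rw [this, hlast]
      split_ifs with h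
      · rw [Finset.card_insert_of_notMem (by simp)]
      · rfl
    rw [hcard, histWeight, pow_add, mul_comm]
    refine mul_le_mul' ?_ ih'
    unfold witnessWeight
    by_cases h1 : H.length ∈ ts
    · have := hω H.length h1 (by simp)
      rw [walkAt, if_pos rfl] at this
      simp [h1, this]
    · simp only [h1, not_false_iff, true_and, if_false, hgt.1, if_true]
      split_ifs
      · norm_num
      · simp

/-- Law of `m` independent non-backtracking walks. -/
def iidWalks (G : SimpleGraph V) (l : ℕ) : ℕ → PMF (List (List V))
  | 0 => PMF.pure []
  | m + 1 => (iidWalks G l m).bind fun Ws => (nbWalk G l).map fun W => W :: Ws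

lemma ex_iidWalks_succ (G : SimpleGraph V) (l m : ℕ) (f : List (List V) → ℝ≥0∞) :
    ex (iidWalks G l (m + 1)) f =
      ex (iidWalks G l m) fun Ws => ex (nbWalk G l) fun W => f (W :: Ws) := by
  simp only [iidWalks, ex_bind, ex_map, Function.comp_def]

lemma iidWalks_apply (G : SimpleGraph V) (l : ℕ) (Ws : List (List V)) :
    iidWalks G l Ws.length Ws = (Ws.map (nbWalk G l)).prod := by
  classical
  induction Ws with
  | nil => simp [iidWalks]
  | cons W Ws ih =>
    rw [apply_eq_ex, List.length_cons, ex_iidWalks_succ, List.map_cons, List.prod_cons, ← ih]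
    have : ∀ Ws', (ex (nbWalk G l) fun W' => if W' :: Ws' = W :: Ws then 1 else 0) =
        nbWalk G l W * if Ws' = Ws then 1 else 0 := by
      intro Ws'
      by_cases h : Ws' = Ws
      · simp only [h, List.cons.injEq, and_true, if_true, mul_one]
        rw [← apply_eq_ex]
      · simp only [h, List.cons.injEq, and_false, if_false, mul_zero]
        exact ex_const _ _
    simp only [this, ex_mul_left]
    rw [← apply_eq_ex]

lemma prod_range_ite_mem_le {τ : ℕ} {ts : List ℕ} (hts : ts.Nodup) (hlt : ∀ t ∈ ts, t < τ)
    (q : ℕ → ℝ≥0∞) {c : ℝ≥0∞} (hc : 1 ≤ c) :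
    ∏ t ∈ Finset.range τ, (if t ∈ ts then q t else c) ≤ (ts.map q).prod * c ^ τ := by
  calc _ ≤ ∏ t ∈ Finset.range τ, ((if t ∈ ts then q t else 1) * c) := by
        refine Finset.prod_le_prod' fun t _ => ?_
        split_ifs
        · exact le_mul_of_one_le_right' hc
        · simp
    _ = _ := by
        rw [Finset.prod_mul_distrib, Finset.prod_const, Finset.card_range,
          ← Finset.prod_filter, ← List.prod_toFinset _ hts]
        congr 2
        ext t
        simp only [Finset.mem_filter, Finset.mem_range, List.mem_toFinset]
        exact ⟨fun h => h.2, fun h => ⟨hlt t h, h⟩⟩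

open Classical in
-- Decouples the process. The set `F` may depend on walks sampled later than the balls being
-- counted, so the expectation is split over the values `Ws` of all walks in `ts`. For fixed `Ws`
-- the set is deterministic: rounds in `ts` contribute the probability of the prescribed walk, and
-- every other round contributes at most `1 + 16 |F| / n`.
lemma ex_hist_witness_le (hreg : ∀ u, (nextNodes G none u).card = d) (hd : 2 ≤ d)
    {l : ℕ} (hg : ((2 * l : ℕ) : ℕ∞) < G.egirth) (M : ℕ) (x : V → ℕ) {τ : ℕ} {ts : List ℕ}
    (hts : ts.Nodup) (hlt : ∀ t ∈ ts, t < τ) (f : List (List V) → ℝ≥0∞)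
    (F : List (List V) → Finset V) :
    ex (hist G l x τ) (fun H => if GoodThrough G d M x H then
      f (ts.map (walkAt H)) * 2 ^ (ballsAbove x M ts (F (ts.map (walkAt H))) H).card else 0) ≤
    ex (iidWalks G l ts.length) fun Ws =>
      f Ws * (1 + 16 * (F Ws).card * (Fintype.card V : ℝ≥0∞)⁻¹) ^ τ := by
  set g : List (List V) → List (List V × V) → ℝ≥0∞ := fun Ws H =>
    if GoodThrough G d M x H ∧ ts.map (walkAt H) = Ws then
      2 ^ (ballsAbove x M ts (F Ws) H).card else 0 with hgdef
  have h1 : ∀ H, (if GoodThrough G d M x H then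
      f (ts.map (walkAt H)) * 2 ^ (ballsAbove x M ts (F (ts.map (walkAt H))) H).card else 0) =
      ∑' Ws, f Ws * g Ws H := by
    intro H
    rw [tsum_eq_single (ts.map (walkAt H))]
    · by_cases h : GoodThrough G d M x H <;> simp [hgdef, h]
    · intro Ws hWs
      simp [hgdef, Ne.symm hWs]
  simp only [h1]
  rw [ex_tsum]
  simp only [ex_mul_left]
  rw [ex]
  refine ENNReal.tsum_le_tsum fun Ws => ?_
  rw [mul_left_comm]
  refine mul_le_mul_right ?_ _
  by_cases hlen : Ws.length = ts.length
  swap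
  · refine le_trans (le_of_eq ?_) zero_le
    rw [← ex_const (hist G l x τ) 0]
    congr 1
    ext H
    rw [hgdef]
    simp only
    rw [if_neg]
    rintro ⟨-, h⟩
    exact hlen (by rw [← h, List.length_map])
  -- Prescribes the walk of each ball in `ts`; the default `[]` is never reached for `t ∈ ts`.
  set ω : ℕ → List V := fun t => Ws.getD (ts.idxOf t) [] with hω
  have hωts : ts.map ω = Ws := by
    refine List.ext_getElem (by simp [hlen]) fun i hi hi' => ?_
    simp only [List.getElem_map, hω]
    rw [hts.idxOf_getElem]
    simp [List.getD_eq_getElem?_getD, hi']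
  rw [← hlen, iidWalks_apply]
  calc ex (hist G l x τ) (g Ws)
      ≤ ex (hist G l x τ) (histWeight (witnessWeight G d M x ts ω (F Ws))) := by
        refine ex_mono _ fun H => ?_
        simp only [hgdef]
        split_ifs with h
        · refine le_histWeight_witnessWeight M x ts ω (F Ws) H h.1 fun t ht _ => ?_
          have h2 := h.2
          rw [← hωts] at h2
          exact List.map_inj_left.1 h2 t ht
        · exact zero_le
    _ ≤ ∏ t ∈ Finset.range τ, (if t ∈ ts then nbWalk G l (ω t)
          else 1 + 16 * (F Ws).card * (Fintype.card V : ℝ≥0∞)⁻¹) :=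
        ex_histWeight_le _ (fun t => if t ∈ ts then nbWalk G l (ω t)
          else 1 + 16 * (F Ws).card * (Fintype.card V : ℝ≥0∞)⁻¹)
          (fun H => ex_witnessWeight_le hreg hd hg M x ts ω (F Ws) H) τ
    _ ≤ (ts.map fun t => nbWalk G l (ω t)).prod *
          (1 + 16 * (F Ws).card * (Fintype.card V : ℝ≥0∞)⁻¹) ^ τ :=
        prod_range_ite_mem_le hts hlt _ le_self_add
    _ = _ := by
        congr 2
        conv_rhs => rw [← hωts]
        rw [List.map_map]
        rfl

end History

/-! ### Good load vectors persist -/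

section Bounds
variable {G : SimpleGraph V} {d : ℕ}

omit [Fintype V] [Nonempty V] in
lemma card_hot_le_card_ballsAbove {x : V → ℕ} {M : ℕ} (hx : ∀ v, x v ≤ M) (U : Finset V)
    (H : List (List V × V)) :
    (U.filter fun v => M < loadOf x H v).card ≤ (ballsAbove x M [] U H).card := by
  classical
  have h : ∀ v ∈ U.filter fun v => M < loadOf x H v,
      ∃ t < H.length, nodeAt H t = some v ∧ levelAt x H t = M := fun v hv =>
    exists_ball_at_level x H v M (hx v) (Finset.mem_filter.1 hv).2
  choose! t ht using h
  refine Finset.card_le_card_of_injOn t (fun v hv => ?_) (fun v hv w hw hvw => ?_)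
  · obtain ⟨h1, h2, h3⟩ := ht v hv
    simp only [ballsAbove, Finset.coe_filter, Set.mem_ofPred_eq, Finset.mem_range]
    exact ⟨h1, by simp, v, (Finset.mem_filter.1 hv).1, h2, h3.ge⟩
  · have h1 := (ht v hv).2.1
    rw [hvw, (ht w hw).2.1] at h1
    simpa using h1.symm

/-- Markov's inequality for two to the number of balls placed above `M` in a neighbourhood, with a
union bound over the nodes. A node above `M` must have received a ball at level exactly `M`, so such
balls outnumber the overloaded neighbours. -/
lemma pr_goodThrough_and_not_good_le (hreg : ∀ u, (nextNodes G none u).card = d) (hd : 2 ≤ d)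
    {l : ℕ} (hg : ((2 * l : ℕ) : ℕ∞) < G.egirth) {M : ℕ} {x : V → ℕ} (hx : ∀ v, x v ≤ M) (τ : ℕ) :
    pr (hist G l x τ) (fun H => GoodThrough G d M x H ∧ ¬ Good G d M (loadOf x H)) ≤
      Fintype.card V *
        ((2 ^ (d / 10 + 1))⁻¹ * (1 + 16 * d * (Fintype.card V : ℝ≥0∞)⁻¹) ^ τ) := by
  classical
  calc _ ≤ pr (hist G l x τ) (fun H => ∃ w, GoodThrough G d M x H ∧
          d / 10 + 1 ≤ (ballsAbove x M [] (nextNodes G none w) H).card) := by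
        refine pr_mono _ fun H hH => ?_
        obtain ⟨h1, h2⟩ := hH
        simp only [Good, not_forall, not_le] at h2
        obtain ⟨w, hw⟩ := h2
        refine ⟨w, h1, le_trans ?_ (card_hot_le_card_ballsAbove hx (nextNodes G none w) H)⟩
        omega
    _ ≤ ∑ w, pr (hist G l x τ) (fun H => GoodThrough G d M x H ∧
          d / 10 + 1 ≤ (ballsAbove x M [] (nextNodes G none w) H).card) := pr_exists_le _ _
    _ ≤ ∑ w : V, ((2 ^ (d / 10 + 1))⁻¹ * (1 + 16 * d * (Fintype.card V : ℝ≥0∞)⁻¹) ^ τ) := by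
        refine Finset.sum_le_sum fun w _ => ?_
        have h := ex_hist_witness_le hreg hd hg M x (τ := τ) (ts := []) (by simp) (by simp)
          (fun _ => 1) (fun _ => nextNodes G none w)
        simp only [List.length_nil, iidWalks, ex_pure, one_mul, hreg] at h
        refine le_trans ?_ (mul_le_mul_right h _)
        rw [pr_eq_ex, ← ex_mul_left]
        refine ex_mono _ fun H => ?_
        split_ifs with h1 h2
        · calc (1 : ℝ≥0∞) = (2 ^ (d / 10 + 1))⁻¹ * 2 ^ (d / 10 + 1) :=
                (ENNReal.inv_mul_cancel (by simp) (by simp)).symm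
            _ ≤ _ := by
                gcongr
                · norm_num
                · exact h1.2
        · exact absurd h1.1 h2
        · exact zero_le
        · exact zero_le
    _ = _ := by simp

/-- Union bound over the first round that starts from a load vector that is not good; all earlier
rounds obey the placement bound. -/
lemma pr_not_goodThrough_le (hreg : ∀ u, (nextNodes G none u).card = d) (hd : 2 ≤ d)
    {l : ℕ} (hg : ((2 * l : ℕ) : ℕ∞) < G.egirth) {M : ℕ} {x : V → ℕ} (hx : ∀ v, x v ≤ M) (τ : ℕ) :
    pr (hist G l x τ) (fun H => ¬ GoodThrough G d M x H) ≤ τ * (Fintype.card V *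
        ((2 ^ (d / 10 + 1))⁻¹ * (1 + 16 * d * (Fintype.card V : ℝ≥0∞)⁻¹) ^ τ)) := by
  classical
  suffices h : ∀ t ≤ τ, pr (hist G l x t) (fun H => ¬ GoodThrough G d M x H) ≤
      t * (Fintype.card V * ((2 ^ (d / 10 + 1))⁻¹ *
        (1 + 16 * d * (Fintype.card V : ℝ≥0∞)⁻¹) ^ τ)) from h τ le_rfl
  intro t
  induction t with
  | zero => intro _; simp [hist, pr, ex_pure, GoodThrough]
  | succ t ih =>
    intro ht
    have h1 : pr (hist G l x (t + 1)) (fun H => ¬ GoodThrough G d M x H) =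
        pr (hist G l x t) (fun H => ¬ (Good G d M (loadOf x H) ∧ GoodThrough G d M x H)) := by
      rw [pr_eq_ex, pr_eq_ex, ex_hist_succ]
      congr 1
      ext H
      by_cases h : Good G d M (loadOf x H) ∧ GoodThrough G d M x H <;>
        simp [GoodThrough, h, ex_const]
    rw [h1]
    calc _ ≤ pr (hist G l x t) (fun H => ¬ GoodThrough G d M x H ∨
          (GoodThrough G d M x H ∧ ¬ Good G d M (loadOf x H))) :=
          pr_mono _ fun H hH => by tauto
      _ ≤ _ := pr_or_le _ _ _
      _ ≤ t * (Fintype.card V * ((2 ^ (d / 10 + 1))⁻¹ *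
            (1 + 16 * d * (Fintype.card V : ℝ≥0∞)⁻¹) ^ τ)) +
          (Fintype.card V * ((2 ^ (d / 10 + 1))⁻¹ *
            (1 + 16 * d * (Fintype.card V : ℝ≥0∞)⁻¹) ^ τ)) := by
          gcongr
          · exact ih (by omega)
          · refine (pr_goodThrough_and_not_good_le hreg hd hg hx t).trans ?_
            gcongr 2
            exact pow_le_pow_right' le_self_add (by omega)
      _ = _ := by push_cast; ring

/-! ### Connected families of walks -/

open Classical in
/-- The nodes visited by a family of walks. -/
def nodesOf : List (List V) → Finset V
  | [] => ∅
  | W :: Ws => W.toFinset ∪ nodesOf Ws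

/-- Every walk meets one of the walks further down the list. -/
def Connected : List (List V) → Prop
  | [] => True
  | W :: Ws => Connected Ws ∧ (Ws = [] ∨ ∃ x ∈ nodesOf Ws, x ∈ W)

omit [Fintype V] [Nonempty V] in
lemma mem_nodesOf {Ws : List (List V)} {v : V} : v ∈ nodesOf Ws ↔ ∃ W ∈ Ws, v ∈ W := by
  induction Ws with
  | nil => simp [nodesOf]
  | cons W Ws ih => simp [nodesOf, ih]

omit [Fintype V] [Nonempty V] in
lemma card_nodesOf_le {Ws : List (List V)} {k : ℕ} (h : ∀ W ∈ Ws, W.length ≤ k) :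
    (nodesOf Ws).card ≤ Ws.length * k := by
  classical
  induction Ws with
  | nil => simp [nodesOf]
  | cons W Ws ih =>
    have h1 := ih fun W' hW' => h W' (by simp [hW'])
    have h2 := h W (by simp)
    calc _ ≤ W.toFinset.card + (nodesOf Ws).card := Finset.card_union_le _ _
      _ ≤ k + Ws.length * k := by
          gcongr
          exact (List.toFinset_card_le W).trans h2
      _ = _ := by simp [add_mul, add_comm]

lemma mem_support_iidWalks {l m : ℕ} {Ws : List (List V)}
    (h : Ws ∈ (iidWalks G l m).support) :
    Ws.length = m ∧ ∀ W ∈ Ws, W ∈ (nbWalk G l).support := by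
  induction m generalizing Ws with
  | zero => simp only [iidWalks, PMF.mem_support_pure_iff] at h; simp [h]
  | succ m ih =>
    rw [iidWalks, PMF.mem_support_bind_iff] at h
    obtain ⟨Ws', h1, h2⟩ := h
    rw [PMF.mem_support_map_iff] at h2
    obtain ⟨W, hW, rfl⟩ := h2
    obtain ⟨h3, h4⟩ := ih h1
    refine ⟨by simp [h3], fun W' hW' => ?_⟩
    rcases List.mem_cons.1 hW' with rfl | h
    · exact hW
    · exact h4 W' h

open Classical in
-- A new walk must meet one of at most `m * (l + 1)` nodes at one of its `l + 1` positions. The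
-- first walk is unconstrained, which is the extra factor `n`.
lemma ex_iidWalks_connected_le (hreg : ∀ u, (nextNodes G none u).card = d) (hd : 2 ≤ d)
    (l : ℕ) {T m : ℕ} (hm : m ≤ T) :
    ex (iidWalks G l m) (fun Ws => if Connected Ws then 1 else 0) ≤
      Fintype.card V * (((l + 1) ^ 2 * T : ℕ) * (Fintype.card V : ℝ≥0∞)⁻¹) ^ m := by
  have hn0 : (Fintype.card V : ℝ≥0∞) ≠ 0 := Nat.cast_ne_zero.2 Fintype.card_ne_zero
  induction m with
  | zero =>
    simp only [iidWalks, ex_pure, Connected, pow_zero, mul_one]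
    exact_mod_cast Fintype.card_pos
  | succ m ih =>
    rw [ex_iidWalks_succ]
    rcases Nat.eq_zero_or_pos m with rfl | hm0
    · simp only [iidWalks, ex_pure, Connected, true_and, true_or, if_true, ex_const, zero_add,
        pow_one]
      rw [mul_left_comm, ENNReal.mul_inv_cancel hn0 (by simp), mul_one]
      have : 1 ≤ (l + 1) ^ 2 * T := Nat.mul_pos (by positivity) (by omega)
      exact_mod_cast this
    · calc _ ≤ ex (iidWalks G l m) fun Ws => (if Connected Ws then 1 else 0) *
            (((l + 1) ^ 2 * T : ℕ) * (Fintype.card V : ℝ≥0∞)⁻¹) := by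
            refine ex_mono_support _ fun Ws hWs => ?_
            obtain ⟨hlen, hsup⟩ := mem_support_iidWalks hWs
            have hne : Ws ≠ [] := by rintro rfl; simp at hlen; omega
            simp only [Connected, hne, false_or]
            by_cases hc : Connected Ws
            · simp only [hc, true_and, if_true, one_mul]
              rw [← pr_eq_ex]
              refine (pr_nbWalk_meets hreg hd l (nodesOf Ws)).trans ?_
              gcongr
              have h1 : (nodesOf Ws).card ≤ m * (l + 1) := by
                rw [← hlen]
                exact card_nodesOf_le fun W hW => (mem_support_nbWalk hreg hd (hsup W hW)).1.le
              have h2 : (l + 1) * (nodesOf Ws).card ≤ (l + 1) ^ 2 * T := by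
                calc _ ≤ (l + 1) * (m * (l + 1)) := Nat.mul_le_mul_left _ h1
                  _ = (l + 1) ^ 2 * m := by ring
                  _ ≤ _ := Nat.mul_le_mul_left _ (by omega)
              exact_mod_cast h2
            · simp [hc, ex_const]
        _ ≤ _ := by
            rw [ex_mul_right, pow_succ _ m, ← mul_assoc (Fintype.card V : ℝ≥0∞)]
            exact mul_le_mul_left (ih (by omega)) _

open Classical in
-- Adds one walk at a time with `ex_nbWalk_meets_pow`, the exponent growing by the number of new
-- nodes. The weight is a generating function of the number of visited nodes.
lemma ex_iidWalks_connected_pow_le (hreg : ∀ u, (nextNodes G none u).card = d) (hd : 2 ≤ d)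
    {l : ℕ} (hg : ((2 * l : ℕ) : ℕ∞) < G.egirth) {T m : ℕ} (hm : m ≤ T) :
    ex (iidWalks G l m) (fun Ws => if Connected Ws then
      ((d - 1 : ℕ) : ℝ≥0∞)⁻¹ ^ (nodesOf Ws).card else 0) ≤
      Fintype.card V * ((((l + 1) ^ 2 * T : ℕ) : ℝ≥0∞) ^ 2 *
        ((Fintype.card V : ℝ≥0∞)⁻¹ * ((d - 1 : ℕ) : ℝ≥0∞)⁻¹ ^ l)) ^ m := by
  have hn0 : (Fintype.card V : ℝ≥0∞) ≠ 0 := Nat.cast_ne_zero.2 Fintype.card_ne_zero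
  set θ : ℝ≥0∞ := ((d - 1 : ℕ) : ℝ≥0∞)⁻¹ with hθ
  have hθ1 : θ ≤ 1 := by
    rw [hθ, ENNReal.inv_le_one]
    exact_mod_cast (by omega : 1 ≤ d - 1)
  induction m with
  | zero =>
    simp only [iidWalks, ex_pure, Connected, if_true, pow_zero, mul_one, nodesOf,
      Finset.card_empty]
    exact_mod_cast Fintype.card_pos
  | succ m ih =>
    rw [ex_iidWalks_succ]
    rcases Nat.eq_zero_or_pos m with rfl | hm0
    · simp only [iidWalks, ex_pure, Connected, true_and, true_or, if_true, zero_add,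
        pow_one, nodesOf, Finset.union_empty]
      calc _ ≤ ex (nbWalk G l) fun _ => θ ^ l := by
            refine ex_mono_support _ fun W hW => ?_
            obtain ⟨hl, hnb⟩ := mem_support_nbWalk hreg hd hW
            rw [List.toFinset_card_of_nodup (hnb.nodup_of_egirth hl hg), hl]
            exact pow_le_pow_right_of_le_one' hθ1 (by omega)
        _ = 1 * θ ^ l := by rw [ex_const, one_mul]
        _ ≤ (((l + 1) ^ 2 * T : ℕ) : ℝ≥0∞) ^ 2 * θ ^ l := by
            gcongr
            have : 1 ≤ (l + 1) ^ 2 * T := Nat.mul_pos (by positivity) (by omega)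
            exact_mod_cast Nat.one_le_pow 2 _ this
        _ = _ := by
            rw [mul_left_comm, ← mul_assoc (Fintype.card V : ℝ≥0∞),
              ENNReal.mul_inv_cancel hn0 (by simp), one_mul]
    · calc _ ≤ ex (iidWalks G l m) fun Ws => (if Connected Ws then θ ^ (nodesOf Ws).card else 0) *
            ((((l + 1) ^ 2 * T : ℕ) : ℝ≥0∞) ^ 2 * ((Fintype.card V : ℝ≥0∞)⁻¹ * θ ^ l)) := by
            refine ex_mono_support _ fun Ws hWs => ?_
            obtain ⟨hlen, hsup⟩ := mem_support_iidWalks hWs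
            have hne : Ws ≠ [] := by rintro rfl; simp at hlen; omega
            simp only [Connected, hne, false_or]
            by_cases hc : Connected Ws
            · simp only [hc, true_and, if_true]
              have h1 : (nodesOf Ws).card ≤ m * (l + 1) := by
                rw [← hlen]
                exact card_nodesOf_le fun W hW => (mem_support_nbWalk hreg hd (hsup W hW)).1.le
              have h2 : (l + 1) * (nodesOf Ws).card ≤ (l + 1) ^ 2 * T := by
                calc _ ≤ (l + 1) * (m * (l + 1)) := Nat.mul_le_mul_left _ h1
                  _ = (l + 1) ^ 2 * m := by ring
                  _ ≤ _ := Nat.mul_le_mul_left _ (by omega)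
              calc _ = ex (nbWalk G l) fun W => θ ^ (nodesOf Ws).card *
                    (if ∃ x ∈ nodesOf Ws, x ∈ W then θ ^ (W.toFinset \ nodesOf Ws).card else 0) := by
                    congr 1
                    ext W
                    split_ifs
                    · rw [nodesOf, ← pow_add]
                      congr 1
                      rw [← Finset.sdiff_union_self_eq_union,
                        Finset.card_union_of_disjoint Finset.sdiff_disjoint, add_comm]
                    · simp
                _ ≤ _ := by
                    rw [ex_mul_left]
                    gcongr
                    refine (ex_nbWalk_meets_pow hreg hd l hg (nodesOf Ws)).trans ?_
                    gcongr
                    exact_mod_cast h2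
            · simp [hc, ex_const]
        _ ≤ _ := by
            rw [ex_mul_right, pow_succ _ m, ← mul_assoc (Fintype.card V : ℝ≥0∞)]
            exact mul_le_mul_left (ih (by omega)) _

lemma pr_exists_list_le {α : Type*} (p : PMF α) {τ m : ℕ} (P : List ℕ → α → Prop) {b : ℝ≥0∞}
    (h : ∀ ts : List ℕ, ts.Nodup → (∀ t ∈ ts, t < τ) → ts.length = m → pr p (P ts) ≤ b) :
    pr p (fun a => ∃ ts : List ℕ, ts.Nodup ∧ (∀ t ∈ ts, t < τ) ∧ ts.length = m ∧ P ts a) ≤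
      τ ^ m * b := by
  calc _ ≤ pr p (fun a => ∃ f : Fin m → Fin τ,
          (List.ofFn fun i => (f i : ℕ)).Nodup ∧ P (List.ofFn fun i => (f i : ℕ)) a) := by
        refine pr_mono _ fun a => ?_
        rintro ⟨ts, h1, h2, rfl, h4⟩
        refine ⟨fun i => ⟨ts[i], h2 _ (List.getElem_mem _)⟩, ?_⟩
        simpa using ⟨h1, h4⟩
    _ ≤ ∑ f : Fin m → Fin τ, pr p (fun a =>
          (List.ofFn fun i => (f i : ℕ)).Nodup ∧ P (List.ofFn fun i => (f i : ℕ)) a) :=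
        pr_exists_le _ _
    _ ≤ ∑ f : Fin m → Fin τ, b := by
        refine Finset.sum_le_sum fun f _ => ?_
        by_cases hf : (List.ofFn fun i => (f i : ℕ)).Nodup
        · refine (pr_mono _ fun a ha => ha.2).trans (h _ hf ?_ (by simp))
          intro t ht
          obtain ⟨i, rfl⟩ := List.mem_ofFn.1 ht
          exact (f i).2
        · simp only [hf, false_and]
          simp [pr, ex_const]
    _ = _ := by simp

/-- Markov's inequality for `(d - 1)⁻¹ ^ (visited nodes)`, which is at least `(d - 1)⁻¹ ^ a` on the
event; further balls play no role, hence `F = ∅`. -/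
lemma pr_small_family_le (hreg : ∀ u, (nextNodes G none u).card = d) (hd : 2 ≤ d)
    {l : ℕ} (hg : ((2 * l : ℕ) : ℕ∞) < G.egirth) (M : ℕ) (x : V → ℕ) (τ : ℕ)
    {T m : ℕ} (hm : m ≤ T) (a : ℕ) :
    pr (hist G l x τ) (fun H => ∃ ts : List ℕ, ts.Nodup ∧ (∀ t ∈ ts, t < τ) ∧ ts.length = m ∧
      GoodThrough G d M x H ∧ Connected (ts.map (walkAt H)) ∧
        (nodesOf (ts.map (walkAt H))).card ≤ a) ≤
    τ ^ m * (((d - 1 : ℕ) : ℝ≥0∞) ^ a * (Fintype.card V * ((((l + 1) ^ 2 * T : ℕ) : ℝ≥0∞) ^ 2 *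
        ((Fintype.card V : ℝ≥0∞)⁻¹ * ((d - 1 : ℕ) : ℝ≥0∞)⁻¹ ^ l)) ^ m)) := by
  classical
  refine pr_exists_list_le _ _ fun ts hnd hlt hlen => ?_
  have h := ex_hist_witness_le hreg hd hg M x hnd hlt (fun Ws => if Connected Ws then
      ((d - 1 : ℕ) : ℝ≥0∞)⁻¹ ^ (nodesOf Ws).card else 0) (fun _ => ∅)
  simp only [Finset.card_empty, Nat.cast_zero, mul_zero, zero_mul, add_zero, one_pow,
    mul_one, hlen] at h
  refine le_trans ?_ (mul_le_mul_right
    (h.trans (ex_iidWalks_connected_pow_le hreg hd hg hm)) _)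
  rw [pr_eq_ex, ← ex_mul_left]
  refine ex_mono _ fun H => ?_
  split_ifs with h1 h2 h3
  · have hD0 : ((d - 1 : ℕ) : ℝ≥0∞) ≠ 0 := Nat.cast_ne_zero.2 (by omega)
    have hθ1 : ((d - 1 : ℕ) : ℝ≥0∞)⁻¹ ≤ 1 := by
      rw [ENNReal.inv_le_one]
      exact_mod_cast (by omega : 1 ≤ d - 1)
    calc (1 : ℝ≥0∞) = ((d - 1 : ℕ) : ℝ≥0∞) ^ a * (((d - 1 : ℕ) : ℝ≥0∞)⁻¹ ^ a * 1) := by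
          rw [mul_one, ← mul_pow, ENNReal.mul_inv_cancel hD0 (by simp), one_pow]
      _ ≤ _ := by
          gcongr _ * (?_ * ?_)
          · exact pow_le_pow_right_of_le_one' hθ1 h1.2.2
          · exact one_le_pow₀ (by norm_num)
  · exact absurd h1.2.1 h3
  · exact absurd h1.1 h2
  all_goals exact zero_le

lemma one_add_mul_inv_pow_le {n τ : ℕ} (hn : 0 < n) (hτ : τ ≤ n) (u : ℕ) :
    (1 + 16 * (u : ℝ≥0∞) * (n : ℝ≥0∞)⁻¹) ^ τ ≤ 2 ^ (24 * u) := by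
  have hn' : (0 : ℝ) < n := by exact_mod_cast hn
  have h1 : (1 + 16 * (u : ℝ≥0∞) * (n : ℝ≥0∞)⁻¹) ^ τ =
      ENNReal.ofReal ((1 + 16 * u * (n : ℝ)⁻¹) ^ τ) := by
    rw [ENNReal.ofReal_pow (by positivity), ENNReal.ofReal_add (by positivity) (by positivity),
      ENNReal.ofReal_mul (by positivity), ENNReal.ofReal_mul (by positivity),
      ENNReal.ofReal_inv_of_pos hn']
    simp
  have h2 : (2 : ℝ≥0∞) ^ (24 * u) = ENNReal.ofReal (2 ^ (24 * u)) := by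
    rw [ENNReal.ofReal_pow (by positivity)]; simp
  rw [h1, h2]
  apply ENNReal.ofReal_le_ofReal
  calc (1 + 16 * u * (n : ℝ)⁻¹) ^ τ ≤ (1 + 16 * u * (n : ℝ)⁻¹) ^ n := by
        apply pow_le_pow_right₀ _ hτ
        have : 0 ≤ 16 * u * (n : ℝ)⁻¹ := by positivity
        linarith
    _ ≤ (Real.exp (16 * u * (n : ℝ)⁻¹)) ^ n := by
        gcongr
        linarith [Real.add_one_le_exp (16 * u * (n : ℝ)⁻¹)]
    _ = (Real.exp 1 ^ 16) ^ u := by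
        rw [← Real.exp_nat_mul, ← Real.exp_nat_mul, ← Real.exp_nat_mul]
        congr 1
        push_cast
        field_simp
    _ ≤ (2 ^ 24) ^ u := by
        gcongr
        have he := Real.exp_one_lt_d9.le
        -- The exponent 24 rounds up `16 / log 2`; it is the source of the `ρ - 24` in later bounds.
        calc Real.exp 1 ^ 16 ≤ 2.7182818286 ^ 16 := by gcongr
          _ ≤ 2 ^ 24 := by norm_num
    _ = _ := by rw [← pow_mul]

/-- Markov's inequality for two to the number of further balls in the visited set. With `u` visited
nodes the moment is at most `2 ^ (24 * u)` against a threshold `2 ^ (ρ * u)`. -/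
lemma pr_crowded_family_le (hreg : ∀ u, (nextNodes G none u).card = d) (hd : 2 ≤ d)
    {l : ℕ} (hg : ((2 * l : ℕ) : ℕ∞) < G.egirth) (M : ℕ) (x : V → ℕ) {τ : ℕ}
    (hτ : τ ≤ Fintype.card V) (T ρ a : ℕ) (hρ : 24 ≤ ρ) :
    pr (hist G l x τ) (fun H => ∃ ts : List ℕ, ts.Nodup ∧ (∀ t ∈ ts, t < τ) ∧ ts.length = T ∧
      GoodThrough G d M x H ∧ Connected (ts.map (walkAt H)) ∧
        a ≤ (nodesOf (ts.map (walkAt H))).card ∧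
        ρ * (nodesOf (ts.map (walkAt H))).card ≤
          (ballsAbove x M ts (nodesOf (ts.map (walkAt H))) H).card) ≤
    τ ^ T * ((Fintype.card V * (((l + 1) ^ 2 * T : ℕ) * (Fintype.card V : ℝ≥0∞)⁻¹) ^ T) *
      (2 ^ ((ρ - 24) * a))⁻¹) := by
  classical
  refine pr_exists_list_le _ _ fun ts hnd hlt hlen => ?_
  have h := ex_hist_witness_le hreg hd hg M x hnd hlt (fun Ws => if Connected Ws ∧
      a ≤ (nodesOf Ws).card then (2 ^ (ρ * (nodesOf Ws).card))⁻¹ else 0) nodesOf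
  rw [hlen] at h
  calc _ ≤ _ := ?_
    _ ≤ _ := h
    _ ≤ ex (iidWalks G l T) fun Ws => (if Connected Ws then 1 else 0) *
          (2 ^ ((ρ - 24) * a))⁻¹ := by
        refine ex_mono _ fun Ws => ?_
        by_cases hc : Connected Ws ∧ a ≤ (nodesOf Ws).card
        · simp only [hc, and_self, if_true, one_mul]
          refine (mul_le_mul_right (one_add_mul_inv_pow_le Fintype.card_pos hτ _) _).trans ?_
          set u := (nodesOf Ws).card
          have hu : ρ * u = 24 * u + (ρ - 24) * u := by
            rw [← add_mul]; congr 1; omega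
          rw [hu, pow_add, ENNReal.mul_inv (by simp) (by simp), mul_right_comm,
            ENNReal.inv_mul_cancel (by simp) (by simp), one_mul]
          gcongr
          · norm_num
          · exact hc.2
        · simp [hc]
    _ ≤ _ := by
        rw [ex_mul_right]
        exact mul_le_mul_left (ex_iidWalks_connected_le hreg hd l le_rfl) _
  rw [pr_eq_ex]
  refine ex_mono _ fun H => ?_
  split_ifs with h1 h2 h3
  · calc (1 : ℝ≥0∞) = (2 ^ (ρ * (nodesOf (ts.map (walkAt H))).card))⁻¹ *
          2 ^ (ρ * (nodesOf (ts.map (walkAt H))).card) :=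
          (ENNReal.inv_mul_cancel (by simp) (by simp)).symm
      _ ≤ _ := by
          gcongr
          · norm_num
          · exact h1.2.2.2
  · exact absurd ⟨h1.2.1, h1.2.2.1⟩ h3
  · exact absurd h1.1 h2
  all_goals exact zero_le

end Bounds

/-! ### Growth of connected families -/

section Growth
variable {G : SimpleGraph V} {d : ℕ}

omit [Fintype V] [Nonempty V] in
lemma Connected.append {Ws Ws' : List (List V)} (h : Connected Ws)
    (h' : ∀ W ∈ Ws', ∃ x ∈ nodesOf Ws, x ∈ W) : Connected (Ws' ++ Ws) := by
  induction Ws' with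
  | nil => simpa using h
  | cons W Ws' ih =>
    refine ⟨ih fun W' hW' => h' W' (by simp [hW']), Or.inr ?_⟩
    obtain ⟨x, hx, hxW⟩ := h' W (by simp)
    obtain ⟨W', hW', hxW'⟩ := mem_nodesOf.1 hx
    exact ⟨x, mem_nodesOf.2 ⟨W', by simp [hW'], hxW'⟩, hxW⟩

omit [Fintype V] [Nonempty V] in
-- Walks only need to meet walks further down the list, so removing the head is harmless. This lets
-- families be truncated to a prescribed size.
lemma Connected.drop {Ws : List (List V)} (h : Connected Ws) (k : ℕ) : Connected (Ws.drop k) := by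
  induction k generalizing Ws with
  | zero => simpa using h
  | succ k ih =>
    cases Ws with
    | nil => simpa using h
    | cons W Ws => exact ih h.1

/-- A list of balls with connected walks, all placed on nodes with load at least `b`. -/
def IsFamily (x : V → ℕ) (H : List (List V × V)) (b : ℕ) (ts : List ℕ) : Prop :=
  ts.Nodup ∧ (∀ t ∈ ts, t < H.length ∧ b ≤ levelAt x H t) ∧ Connected (ts.map (walkAt H))

/-- The nodes visited by the walks of the balls `ts`. -/
def visited (H : List (List V × V)) (ts : List ℕ) : Finset V := nodesOf (ts.map (walkAt H))

omit [Fintype V] [Nonempty V] in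
lemma IsFamily.exists_length_eq {x : V → ℕ} {H : List (List V × V)} {b : ℕ} {ts : List ℕ}
    (h : IsFamily x H b ts) {m : ℕ} (hm : m ≤ ts.length) :
    ∃ ts', IsFamily x H b ts' ∧ ts'.length = m := by
  refine ⟨ts.drop (ts.length - m), ⟨h.1.sublist (List.drop_sublist _ _),
    fun t ht => h.2.1 t (List.mem_of_mem_drop ht), ?_⟩, ?_⟩
  · rw [List.map_drop]
    exact h.2.2.drop _
  · rw [List.length_drop]; omega

/-- Each ball went to a least-loaded node of its walk, and loads never decrease. -/
lemma IsFamily.le_load (hreg : ∀ u, (nextNodes G none u).card = d) (hd : 2 ≤ d)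
    {l τ : ℕ} {x : V → ℕ} {H : List (List V × V)} (hH : H ∈ (hist G l x τ).support) {b : ℕ}
    {ts : List ℕ} (h : IsFamily x H b ts) {y : V} (hy : y ∈ visited H ts) :
    b ≤ loadOf x H y := by
  obtain ⟨W, hW, hyW⟩ := mem_nodesOf.1 hy
  obtain ⟨t, ht, rfl⟩ := List.mem_map.1 hW
  obtain ⟨h1, h2⟩ := h.2.1 t ht
  rw [length_of_mem_support_hist hH] at h1
  obtain ⟨-, -, v, -, -, h3⟩ := walkAt_of_mem_support hreg hd hH h1
  exact h2.trans (h3 y hyW)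

/-- Every visited node started at load at most `b` and ended at `b + ρ` or more, so it received a
ball at each of the `ρ` levels between. Node and level distinguish these balls, and their levels are
below those of `ts`. -/
lemma IsFamily.exists_next_balls (hreg : ∀ u, (nextNodes G none u).card = d) (hd : 2 ≤ d)
    {l τ : ℕ} {x : V → ℕ} {H : List (List V × V)} (hH : H ∈ (hist G l x τ).support) {b ρ : ℕ}
    (hx : ∀ v, x v ≤ b) {ts : List ℕ} (h : IsFamily x H (b + ρ) ts) :
    ∃ N : Finset ℕ, N.card = ρ * (visited H ts).card ∧ ∀ t ∈ N, t < H.length ∧ t ∉ ts ∧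
      b ≤ levelAt x H t ∧ ∃ v ∈ visited H ts, nodeAt H t = some v := by
  classical
  have hex : ∀ q ∈ visited H ts ×ˢ Finset.Ico b (b + ρ),
      ∃ t < H.length, nodeAt H t = some q.1 ∧ levelAt x H t = q.2 := by
    intro q hq
    obtain ⟨h1, h2⟩ := Finset.mem_product.1 hq
    obtain ⟨h3, h4⟩ := Finset.mem_Ico.1 h2
    exact exists_ball_at_level x H q.1 q.2 ((hx _).trans h3)
      (h4.trans_le (h.le_load hreg hd hH h1))
  choose! t ht using hex
  refine ⟨(visited H ts ×ˢ Finset.Ico b (b + ρ)).image t, ?_, ?_⟩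
  · rw [Finset.card_image_of_injOn, Finset.card_product, Nat.card_Ico]
    · rw [add_tsub_cancel_left, mul_comm]
    · intro q hq r hr hqr
      obtain ⟨-, h1, h2⟩ := ht q hq
      obtain ⟨-, h3, h4⟩ := ht r hr
      rw [hqr] at h1 h2
      rw [h3] at h1
      exact Prod.ext (by simpa using h1.symm) (h2.symm.trans h4)
  · intro s hs
    obtain ⟨q, hq, rfl⟩ := Finset.mem_image.1 hs
    obtain ⟨h1, h2, h3⟩ := ht q hq
    obtain ⟨h4, h5⟩ := Finset.mem_product.1 hq
    obtain ⟨h6, h7⟩ := Finset.mem_Ico.1 h5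
    refine ⟨h1, fun hmem => ?_, by omega, q.1, h4, h2⟩
    have := (h.2.1 _ hmem).2
    omega

lemma IsFamily.exists_extension (hreg : ∀ u, (nextNodes G none u).card = d) (hd : 2 ≤ d)
    {l τ : ℕ} {x : V → ℕ} {H : List (List V × V)} (hH : H ∈ (hist G l x τ).support) {b ρ : ℕ}
    (hx : ∀ v, x v ≤ b) {ts : List ℕ} (h : IsFamily x H (b + ρ) ts) :
    ∃ ts', IsFamily x H b ts' ∧ ts'.length = ρ * (visited H ts).card + ts.length := by
  obtain ⟨N, hN, hNt⟩ := h.exists_next_balls hreg hd hH hx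
  refine ⟨N.toList ++ ts, ⟨?_, ?_, ?_⟩, by simp [hN]⟩
  · rw [List.nodup_append]
    refine ⟨N.nodup_toList, h.1, fun s hs t ht hst => ?_⟩
    subst hst
    exact (hNt s (Finset.mem_toList.1 hs)).2.1 ht
  · intro t ht
    rcases List.mem_append.1 ht with ht | ht
    · have := hNt t (Finset.mem_toList.1 ht)
      exact ⟨this.1, this.2.2.1⟩
    · have := h.2.1 t ht
      exact ⟨this.1, by omega⟩
  · rw [List.map_append]
    refine h.2.2.append fun W hW => ?_
    obtain ⟨t, ht, rfl⟩ := List.mem_map.1 hW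
    obtain ⟨h1, -, -, v, hv, hvt⟩ := hNt t (Finset.mem_toList.1 ht)
    rw [length_of_mem_support_hist hH] at h1
    obtain ⟨-, -, v', h2, h3, -⟩ := walkAt_of_mem_support hreg hd hH h1
    rw [hvt, Option.some.injEq] at h2
    subst h2
    exact ⟨v, hv, h3⟩

/-- The `h + 1` strips of `ρ` levels are used from the top: `h` of them grow a family to exactly `T`
walks, and the lowest one supplies the further balls. `hbig` says that no connected family is
exceptionally small. -/
lemma exists_crowded_family (hreg : ∀ u, (nextNodes G none u).card = d) (hd : 2 ≤ d)
    {l τ : ℕ} (hg : ((2 * l : ℕ) : ℕ∞) < G.egirth) {x : V → ℕ} {M : ℕ} (hx : ∀ v, x v ≤ M)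
    {H : List (List V × V)} (hH : H ∈ (hist G l x τ).support) {T lam ρ g h : ℕ}
    (hl : 12 ≤ l) (hT : 1 ≤ T) (hTl : 4 * lam ≤ l * T) (hρl : 4 * lam ≤ l * (ρ * l))
    (hg1 : 1 ≤ g) (hg4 : 4 * g ≤ ρ * l) (hgT : T ≤ g ^ h) (hh : 1 ≤ h)
    (hbig : ∀ ts : List ℕ, 1 ≤ ts.length → ts.length ≤ T → IsFamily x H M ts →
      l * ts.length < (visited H ts).card + 6 * ts.length + lam)
    {v : V} (hv : M + (h + 1) * ρ < loadOf x H v) :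
    ∃ ts, IsFamily x H M ts ∧ ts.length = T ∧ l * T ≤ 4 * (visited H ts).card ∧
      ρ * (visited H ts).card ≤ (ballsAbove x M ts (visited H ts) H).card := by
  classical
  have hlen := length_of_mem_support_hist hH
  have hmono : ∀ {b ts}, IsFamily x H (M + b) ts → IsFamily x H M ts := fun hts =>
    ⟨hts.1, fun t ht => ⟨(hts.2.1 t ht).1, by have := (hts.2.1 t ht).2; omega⟩, hts.2.2⟩
  -- Of the `l * m` in `hbig`, the loss `6 * m` takes at most half because `12 ≤ l`, and `lam` takes
  -- at most a quarter.
  have hquarter : ∀ {b ts}, IsFamily x H (M + b) ts → 1 ≤ ts.length → ts.length ≤ T →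
      4 * lam ≤ l * ts.length → l * ts.length ≤ 4 * (visited H ts).card := by
    intro b ts hts h1 h2 h3
    have h4 := hbig ts h1 h2 (hmono hts)
    have h5 : 12 * ts.length ≤ l * ts.length := Nat.mul_le_mul_right _ hl
    omega
  -- The last conjunct keeps `hquarter` applicable. A single walk need not satisfy it, so the
  -- induction starts after the first extension, which has at least `ρ * l` walks.
  have claim : ∀ i, 1 ≤ i → i ≤ h → ∃ ts, IsFamily x H (M + (h + 1 - i) * ρ) ts ∧
      1 ≤ ts.length ∧ ts.length ≤ T ∧ min T (g ^ i) ≤ ts.length ∧ 4 * lam ≤ l * ts.length := by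
    intro i hi
    induction i, hi using Nat.le_induction with
    | base =>
      intro _
      obtain ⟨t, ht, h1, h2⟩ := exists_ball_at_level x H v (M + (h + 1) * ρ)
        ((hx v).trans (by omega)) hv
      have hfam : IsFamily x H (M + h * ρ + ρ) [t] := by
        refine ⟨by simp, fun s hs => ?_, by simp [Connected]⟩
        rw [List.mem_singleton] at hs
        subst hs
        exact ⟨ht, by rw [h2]; ring_nf; omega⟩
      obtain ⟨ts, hts, hlts⟩ := hfam.exists_extension hreg hd hH
        (fun v => (hx v).trans (by omega))
      have hcard : (visited H [t]).card = l + 1 := by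
        rw [hlen] at ht
        obtain ⟨h3, h4, -⟩ := walkAt_of_mem_support hreg hd hH ht
        simp only [visited, List.map_cons, List.map_nil, nodesOf, Finset.union_empty]
        rw [List.toFinset_card_of_nodup (h4.nodup_of_egirth h3 hg), h3]
      rw [hcard, List.length_singleton] at hlts
      have hbound : ρ * l ≤ ts.length := by
        rw [hlts, mul_add]; omega
      obtain ⟨ts', hts', hlts'⟩ := hts.exists_length_eq
        (m := min T (ρ * l)) ((min_le_right _ _).trans hbound)
      refine ⟨ts', ?_, ?_, ?_, ?_, ?_⟩
      · simpa using hts'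
      · rw [hlts']; exact le_min hT (by omega)
      · rw [hlts']; exact min_le_left _ _
      · rw [hlts', pow_one]; exact min_le_min le_rfl (by omega)
      · rw [hlts']
        rcases min_choice T (ρ * l) with h | h <;> rw [h] <;> assumption
    | succ i hi ih =>
      intro hih
      obtain ⟨ts, hts, h1, h2, h3, h4⟩ := ih (by omega)
      have h5 := hquarter hts h1 h2 h4
      have hrho : (h + 1 - i) * ρ = (h + 1 - (i + 1)) * ρ + ρ := by
        rw [← Nat.succ_mul]; congr 1; omega
      rw [hrho, ← add_assoc] at hts
      obtain ⟨ts', hts', hlts'⟩ := hts.exists_extension hreg hd hH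
        (fun v => (hx v).trans (by omega))
      have hbound : g * ts.length ≤ ts'.length := by
        have h6 : 4 * g * ts.length ≤ 4 * (ρ * (visited H ts).card) := by
          calc 4 * g * ts.length ≤ ρ * l * ts.length := Nat.mul_le_mul_right _ hg4
            _ = ρ * (l * ts.length) := by ring
            _ ≤ ρ * (4 * (visited H ts).card) := Nat.mul_le_mul_left _ h5
            _ = _ := by ring
        rw [hlts']
        have h7 : 4 * g * ts.length = 4 * (g * ts.length) := by ring
        omega
      -- The truncation at `T` keeps the family within the range where `hbig` applies.
      obtain ⟨ts'', hts'', hlts''⟩ := hts'.exists_length_eq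
        (m := min T (g * ts.length)) ((min_le_right _ _).trans hbound)
      have hge : ts.length ≤ g * ts.length := Nat.le_mul_of_pos_left _ hg1
      refine ⟨ts'', hts'', ?_, ?_, ?_, ?_⟩
      · rw [hlts'']; exact le_min hT (h1.trans hge)
      · rw [hlts'']; exact min_le_left _ _
      · rw [hlts'']
        refine le_min (min_le_left _ _) ?_
        rcases le_total T (g ^ i) with h8 | h8
        · rw [min_eq_left h8] at h3
          exact (min_le_left _ _).trans (h3.trans hge)
        · rw [min_eq_right h8] at h3
          refine (min_le_right _ _).trans ?_
          rw [pow_succ']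
          exact Nat.mul_le_mul_left _ h3
      · rw [hlts'']
        rcases min_choice T (g * ts.length) with h | h <;> rw [h]
        · assumption
        · exact h4.trans (Nat.mul_le_mul_left _ hge)
  obtain ⟨ts, hts, h1, h2, h3, h4⟩ := claim h hh le_rfl
  rw [min_eq_left hgT] at h3
  have hlT : ts.length = T := le_antisymm h2 h3
  have h5 := hquarter hts h1 h2 h4
  refine ⟨ts, hmono hts, hlT, by rwa [hlT] at h5, ?_⟩
  rw [show h + 1 - h = 1 by omega, one_mul] at hts
  obtain ⟨N, hN, hNt⟩ := hts.exists_next_balls hreg hd hH hx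
  rw [← hN]
  refine Finset.card_le_card fun t ht => ?_
  obtain ⟨h6, h7, h8, w, hw, hwt⟩ := hNt t ht
  exact Finset.mem_filter.2 ⟨Finset.mem_range.2 h6, h7, w, hw, hwt, h8⟩

end Growth

/-! ### The load added by a batch of balls -/

section Batch
variable {G : SimpleGraph V} {d : ℕ}

/-- This fixes the batch size: with `τ ≤ n / 640` the moment is at most `exp (d / 40)`, well below
the threshold `exp (0.069 * d)`, and `d ≥ 100 * log n` turns the gap into `n⁻¹ ^ 3`. -/
lemma inv_two_pow_mul_pow_le {n d τ : ℕ} (hn : 0 < n) (hτ : 640 * τ ≤ n)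
    (hd : 100 * Real.log n ≤ d) :
    ((2 : ℝ≥0∞) ^ (d / 10 + 1))⁻¹ * (1 + 16 * d * (n : ℝ≥0∞)⁻¹) ^ τ ≤ ((n : ℝ≥0∞)⁻¹) ^ 3 := by
  have hn' : (0 : ℝ) < n := by exact_mod_cast hn
  have h1 : ((2 : ℝ≥0∞) ^ (d / 10 + 1))⁻¹ * (1 + 16 * d * (n : ℝ≥0∞)⁻¹) ^ τ =
      ENNReal.ofReal (((2 : ℝ) ^ (d / 10 + 1))⁻¹ * (1 + 16 * d * (n : ℝ)⁻¹) ^ τ) := by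
    rw [ENNReal.ofReal_mul (by positivity), ENNReal.ofReal_inv_of_pos (by positivity),
      ENNReal.ofReal_pow (by positivity), ENNReal.ofReal_pow (by positivity),
      ENNReal.ofReal_add (by positivity) (by positivity),
      ENNReal.ofReal_mul (by positivity), ENNReal.ofReal_mul (by positivity),
      ENNReal.ofReal_inv_of_pos hn']
    simp
  have h2 : ((n : ℝ≥0∞)⁻¹) ^ 3 = ENNReal.ofReal (((n : ℝ)⁻¹) ^ 3) := by
    rw [ENNReal.ofReal_pow (by positivity), ENNReal.ofReal_inv_of_pos hn']; simp
  rw [h1, h2]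
  apply ENNReal.ofReal_le_ofReal
  have e1 : (1 + 16 * d * (n : ℝ)⁻¹) ^ τ ≤ Real.exp (d / 40) := by
    calc (1 + 16 * d * (n : ℝ)⁻¹) ^ τ ≤ (Real.exp (16 * d * (n : ℝ)⁻¹)) ^ τ := by
          gcongr
          linarith [Real.add_one_le_exp (16 * d * (n : ℝ)⁻¹)]
      _ = Real.exp (τ * (16 * d * (n : ℝ)⁻¹)) := by rw [← Real.exp_nat_mul]
      _ ≤ Real.exp (d / 40) := by
          apply Real.exp_le_exp.2
          have h640 : (640 : ℝ) * τ ≤ n := by exact_mod_cast hτ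
          have hdn : (0 : ℝ) ≤ d := by positivity
          rw [show (τ : ℝ) * (16 * d * (n : ℝ)⁻¹) = (640 * τ) * (d / 40) / n by field_simp; ring,
            div_le_iff₀ hn']
          nlinarith
  have e2 : ((2 : ℝ) ^ (d / 10 + 1))⁻¹ ≤ Real.exp (-(d / 10 * 0.69)) := by
    rw [Real.exp_neg]
    gcongr
    calc Real.exp ((d : ℝ) / 10 * 0.69) ≤ Real.exp (((d / 10 + 1 : ℕ) : ℝ) * Real.log 2) := by
          apply Real.exp_le_exp.2
          have h3 : (d : ℝ) / 10 ≤ ((d / 10 + 1 : ℕ) : ℝ) := by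
            rw [div_le_iff₀ (by norm_num)]
            exact_mod_cast (by omega : d ≤ (d / 10 + 1) * 10)
          have h4 := Real.log_two_gt_d9
          have h5 : (0 : ℝ) ≤ d / 10 := by positivity
          nlinarith
      _ = _ := by rw [Real.exp_nat_mul, Real.exp_log (by norm_num)]
  calc ((2 : ℝ) ^ (d / 10 + 1))⁻¹ * (1 + 16 * d * (n : ℝ)⁻¹) ^ τ
      ≤ Real.exp (-(d / 10 * 0.69)) * Real.exp (d / 40) := by gcongr
    _ = Real.exp (-(d / 10 * 0.69) + d / 40) := by rw [Real.exp_add]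
    _ ≤ Real.exp (3 * (-Real.log n)) := by
        apply Real.exp_le_exp.2
        linarith
    _ = _ := by
        rw [show (3 : ℝ) = ((3 : ℕ) : ℝ) by norm_num, Real.exp_nat_mul, Real.exp_neg,
          Real.exp_log hn']

/-- The choices of the balls cancel the `1 / n` per walk, `Q ^ 2 ≤ D ^ 6` costs six nodes per walk,
and `D ^ lam ≥ n ^ 2` absorbs the remaining factor `n`. -/
lemma small_family_bound {n D τ m a lam l Q : ℕ} (hn : 0 < n) (hD : 1 ≤ D) (hτ : τ ≤ n)
    (hlam : n ^ 2 ≤ D ^ lam) (hQ : Q ≤ D ^ 3) (ha : a + 6 * m + lam ≤ l * m) :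
    (τ : ℝ≥0∞) ^ m * ((D : ℝ≥0∞) ^ a * (n * ((Q : ℝ≥0∞) ^ 2 *
        ((n : ℝ≥0∞)⁻¹ * (D : ℝ≥0∞)⁻¹ ^ l)) ^ m)) ≤ (n : ℝ≥0∞)⁻¹ := by
  have hn0 : (n : ℝ≥0∞) ≠ 0 := Nat.cast_ne_zero.2 hn.ne'
  have hD0 : (D : ℝ≥0∞) ≠ 0 := Nat.cast_ne_zero.2 (by omega)
  have hD1 : (1 : ℝ≥0∞) ≤ D := by exact_mod_cast hD
  calc (τ : ℝ≥0∞) ^ m * ((D : ℝ≥0∞) ^ a * (n * ((Q : ℝ≥0∞) ^ 2 *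
        ((n : ℝ≥0∞)⁻¹ * (D : ℝ≥0∞)⁻¹ ^ l)) ^ m))
      ≤ (n : ℝ≥0∞) ^ m * ((D : ℝ≥0∞) ^ a * (n * (((D : ℝ≥0∞) ^ 3) ^ 2 *
        ((n : ℝ≥0∞)⁻¹ * (D : ℝ≥0∞)⁻¹ ^ l)) ^ m)) := by
        gcongr
        exact_mod_cast hQ
    _ = n * ((n : ℝ≥0∞) * (n : ℝ≥0∞)⁻¹) ^ m * ((D : ℝ≥0∞) ^ (a + 6 * m) *
          (D : ℝ≥0∞)⁻¹ ^ (l * m)) := by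
        simp only [mul_pow, pow_add, pow_mul]
        rw [show ((D : ℝ≥0∞) ^ 6) ^ m = (((D : ℝ≥0∞) ^ 3) ^ 2) ^ m by ring]
        ring
    _ = n * ((D : ℝ≥0∞) ^ (a + 6 * m) * (D : ℝ≥0∞)⁻¹ ^ (l * m)) := by
        rw [ENNReal.mul_inv_cancel hn0 (by simp), one_pow, mul_one]
    _ ≤ n * ((D : ℝ≥0∞) ^ (a + 6 * m) * (D : ℝ≥0∞)⁻¹ ^ (a + 6 * m + lam)) := by
        gcongr _ * (_ * ?_)
        exact pow_le_pow_right_of_le_one' (ENNReal.inv_le_one.2 hD1) ha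
    _ = n * ((D : ℝ≥0∞) ^ lam)⁻¹ := by
        rw [pow_add _ _ lam, ← mul_assoc ((D : ℝ≥0∞) ^ (a + 6 * m)), ← mul_pow,
          ENNReal.mul_inv_cancel hD0 (by simp), one_pow, one_mul, ENNReal.inv_pow]
    _ ≤ n * ((n : ℝ≥0∞) ^ 2)⁻¹ :=
        mul_le_mul_right (ENNReal.inv_le_inv.2 (by exact_mod_cast hlam)) _
    _ = (n : ℝ≥0∞)⁻¹ := by
        rw [pow_two, ENNReal.mul_inv (Or.inl hn0) (by simp), ← mul_assoc,
          ENNReal.mul_inv_cancel hn0 (by simp), one_mul]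

lemma crowded_family_bound {n τ T Q E : ℕ} (hn : 0 < n) (hτ : τ ≤ n)
    (hE : n ^ 2 * Q ^ T ≤ 2 ^ E) :
    (τ : ℝ≥0∞) ^ T * ((n * ((Q : ℝ≥0∞) * (n : ℝ≥0∞)⁻¹) ^ T) * (2 ^ E)⁻¹) ≤ (n : ℝ≥0∞)⁻¹ := by
  have hn0 : (n : ℝ≥0∞) ≠ 0 := Nat.cast_ne_zero.2 hn.ne'
  have hE' : (n : ℝ≥0∞) ^ 2 * (Q : ℝ≥0∞) ^ T ≤ 2 ^ E := by exact_mod_cast hE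
  calc _ ≤ (n : ℝ≥0∞) ^ T * ((n * ((Q : ℝ≥0∞) * (n : ℝ≥0∞)⁻¹) ^ T) * (2 ^ E)⁻¹) := by gcongr
    _ = ((n : ℝ≥0∞) * (n : ℝ≥0∞)⁻¹) ^ T * (n * (Q : ℝ≥0∞) ^ T * (2 ^ E)⁻¹) := by
        simp only [mul_pow]; ring
    _ = (n : ℝ≥0∞)⁻¹ * (((n : ℝ≥0∞) ^ 2 * (Q : ℝ≥0∞) ^ T) * (2 ^ E)⁻¹) := by
        rw [ENNReal.mul_inv_cancel hn0 (by simp), one_pow, one_mul, pow_two]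
        have : (n : ℝ≥0∞)⁻¹ * (((n : ℝ≥0∞) * n * (Q : ℝ≥0∞) ^ T) * (2 ^ E)⁻¹) =
          ((n : ℝ≥0∞) * (n : ℝ≥0∞)⁻¹) * (n * (Q : ℝ≥0∞) ^ T * (2 ^ E)⁻¹) := by ring
        rw [this, ENNReal.mul_inv_cancel hn0 (by simp), one_mul]
    _ ≤ (n : ℝ≥0∞)⁻¹ * (2 ^ E * (2 ^ E)⁻¹) := by gcongr
    _ = _ := by rw [ENNReal.mul_inv_cancel (by simp) (by simp), mul_one]

/-- A batch of at most `n / 640` balls raises the maximum load by at most `(h + 1) * ρ`, with high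
probability, if the parameters satisfy the listed inequalities. -/
lemma pr_batch_le (hreg : ∀ u, (nextNodes G none u).card = d) (hd : 2 ≤ d)
    {l τ : ℕ} (hg : ((2 * l : ℕ) : ℕ∞) < G.egirth) {x : V → ℕ} {M : ℕ} (hx : ∀ v, x v ≤ M)
    {T lam ρ g h a : ℕ} (hτ : 640 * τ ≤ Fintype.card V)
    (hdlog : 100 * Real.log (Fintype.card V) ≤ d)
    (hl : 12 ≤ l) (hT : 1 ≤ T) (hTl : 4 * lam ≤ l * T) (hρl : 4 * lam ≤ l * (ρ * l))
    (hg1 : 1 ≤ g) (hg4 : 4 * g ≤ ρ * l) (hgT : T ≤ g ^ h) (hh : 1 ≤ h) (hρ : 24 ≤ ρ)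
    (hlam : Fintype.card V ^ 2 ≤ (d - 1) ^ lam) (hQ : (l + 1) ^ 2 * T ≤ (d - 1) ^ 3)
    (ha : 4 * a ≤ l * T)
    (hE : Fintype.card V ^ 2 * ((l + 1) ^ 2 * T) ^ T ≤ 2 ^ ((ρ - 24) * a)) :
    pr (loadsFrom G l x τ) (fun y => ¬ ∀ v, y v ≤ M + (h + 1) * ρ) ≤
      (T + 2 : ℕ) * (Fintype.card V : ℝ≥0∞)⁻¹ := by
  classical
  set n := Fintype.card V with hn
  have hn1 : 0 < n := Fintype.card_pos
  have hτn : τ ≤ n := by omega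
  have hn0 : (n : ℝ≥0∞) ≠ 0 := Nat.cast_ne_zero.2 hn1.ne'
  let A : ℕ → List (List V × V) → Prop := fun m H =>
    ∃ ts : List ℕ, ts.Nodup ∧ (∀ t ∈ ts, t < τ) ∧ ts.length = m ∧
      GoodThrough G d M x H ∧ Connected (ts.map (walkAt H)) ∧
        (nodesOf (ts.map (walkAt H))).card ≤ l * m - (6 * m + lam)
  let B : List (List V × V) → Prop := fun H =>
    ∃ ts : List ℕ, ts.Nodup ∧ (∀ t ∈ ts, t < τ) ∧ ts.length = T ∧
      GoodThrough G d M x H ∧ Connected (ts.map (walkAt H)) ∧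
        a ≤ (nodesOf (ts.map (walkAt H))).card ∧
        ρ * (nodesOf (ts.map (walkAt H))).card ≤
          (ballsAbove x M ts (nodesOf (ts.map (walkAt H))) H).card
  -- Only for these `m` is the subtraction in `A m` not truncated. For other `m` the lower bound
  -- `hbig` holds trivially.
  let S := (Finset.Icc 1 T).filter fun m => 6 * m + lam ≤ l * m
  have hcover : ∀ H ∈ (hist G l x τ).support, (¬ ∀ v, loadOf x H v ≤ M + (h + 1) * ρ) →
      (¬ GoodThrough G d M x H ∨ (∃ m ∈ S, A m H)) ∨ B H := by
    intro H hH hlarge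
    by_contra hcon
    simp only [not_or, not_not] at hcon
    obtain ⟨⟨hgt, hA⟩, hB⟩ := hcon
    push Not at hlarge
    obtain ⟨v, hv⟩ := hlarge
    have hlenH := length_of_mem_support_hist hH
    obtain ⟨ts, hts, h1, h2, h3⟩ := exists_crowded_family hreg hd hg hx hH hl hT hTl hρl hg1 hg4
      hgT hh (fun ts h1 h2 hts => by
        by_contra hlt
        refine hA ⟨ts.length, Finset.mem_filter.2 ⟨Finset.mem_Icc.2 ⟨h1, h2⟩, ?_⟩, ts, hts.1,
          fun t ht => hlenH ▸ (hts.2.1 t ht).1, rfl, hgt, hts.2.2, ?_⟩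
        · omega
        · change (visited H ts).card ≤ _
          omega) hv
    refine hB ⟨ts, hts.1, fun t ht => hlenH ▸ (hts.2.1 t ht).1, h1, hgt, hts.2.2, ?_, h3⟩
    change a ≤ (visited H ts).card
    omega
  have hgood : pr (hist G l x τ) (fun H => ¬ GoodThrough G d M x H) ≤ (n : ℝ≥0∞)⁻¹ := by
    refine (pr_not_goodThrough_le hreg hd hg hx τ).trans ?_
    calc _ ≤ (n : ℝ≥0∞) * (n * ((n : ℝ≥0∞)⁻¹) ^ 3) := by
          gcongr
          exact inv_two_pow_mul_pow_le hn1 hτ hdlog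
      _ = ((n : ℝ≥0∞) * (n : ℝ≥0∞)⁻¹) * ((n : ℝ≥0∞) * (n : ℝ≥0∞)⁻¹) * (n : ℝ≥0∞)⁻¹ := by ring
      _ = _ := by rw [ENNReal.mul_inv_cancel hn0 (by simp), one_mul, one_mul]
  have hAm : ∀ m ∈ S, pr (hist G l x τ) (A m) ≤ (n : ℝ≥0∞)⁻¹ := by
    intro m hm
    obtain ⟨h1, h2⟩ := Finset.mem_filter.1 hm
    refine (pr_small_family_le hreg hd hg M x τ (Finset.mem_Icc.1 h1).2 _).trans ?_
    exact small_family_bound hn1 (by omega) hτn hlam hQ (by omega)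
  have hBp : pr (hist G l x τ) B ≤ (n : ℝ≥0∞)⁻¹ :=
    (pr_crowded_family_le hreg hd hg M x hτn T ρ a hρ).trans (crowded_family_bound hn1 hτn hE)
  rw [loadsFrom_eq_map, pr_eq_ex, ex_map, Function.comp_def, ← pr_eq_ex]
  refine (pr_mono_support _ hcover).trans ((pr_or_le _ _ _).trans ?_)
  calc _ ≤ ((n : ℝ≥0∞)⁻¹ + ∑ m ∈ S, (n : ℝ≥0∞)⁻¹) + (n : ℝ≥0∞)⁻¹ := by
        gcongr
        refine (pr_or_le _ _ _).trans ?_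
        gcongr
        exact (pr_exists_mem_le _ _ _).trans (Finset.sum_le_sum hAm)
    _ ≤ ((n : ℝ≥0∞)⁻¹ + T * (n : ℝ≥0∞)⁻¹) + (n : ℝ≥0∞)⁻¹ := by
        rw [Finset.sum_const, nsmul_eq_mul]
        gcongr
        have := Finset.card_filter_le (Finset.Icc 1 T) fun m => 6 * m + lam ≤ l * m
        simpa using this
    _ = _ := by push_cast; ring

end Batch

/-! ### The maximum load after all balls -/

section MaxLoad
variable {G : SimpleGraph V} {d : ℕ}

/-- Batches are chained by the Markov property; the uniformity of `h` in the starting vector is what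
allows this. -/
lemma pr_loadsFrom_zero_le {l τ B : ℕ} {ε : ℝ≥0∞}
    (h : ∀ (x : V → ℕ) (M : ℕ), (∀ v, x v ≤ M) → ∀ t ≤ τ,
      pr (loadsFrom G l x t) (fun y => ¬ ∀ v, y v ≤ M + B) ≤ ε) (j : ℕ) :
    ∀ t ≤ j * τ, pr (loadsFrom G l (fun _ => 0) t) (fun y => ¬ ∀ v, y v ≤ j * B) ≤ j * ε := by
  classical
  induction j with
  | zero =>
    intro t ht
    obtain rfl : t = 0 := by omega
    simp [loadsFrom, pr, ex_pure]
  | succ j ih =>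
    intro t ht
    have hta : min t (j * τ) + (t - min t (j * τ)) = t := by omega
    have hb : t - min t (j * τ) ≤ τ := by rw [Nat.succ_mul] at ht; omega
    rw [← hta, loadsFrom_add, pr_eq_ex, ex_bind]
    calc _ ≤ ex (loadsFrom G l (fun _ => 0) (min t (j * τ))) fun y =>
          (if ¬ ∀ v, y v ≤ j * B then 1 else 0) + ε := by
          refine ex_mono _ fun y => ?_
          rw [← pr_eq_ex]
          by_cases hy : ∀ v, y v ≤ j * B
          · rw [if_neg (not_not.2 hy), zero_add, Nat.succ_mul]
            exact h y _ hy _ hb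
          · rw [if_pos hy]
            exact (pr_le_one _ _).trans le_self_add
      _ ≤ _ := by
          rw [ex_add, ex_const, ← pr_eq_ex, Nat.cast_succ, add_mul, one_mul]
          gcongr
          exact ih _ (min_le_right _ _)

lemma le_probMaxLoadLE {l B : ℕ} {ε : ℝ} (hε : 0 ≤ ε) {b : ℝ} (hb : (B : ℝ) ≤ b)
    (h : pr (loads G l (Fintype.card V)) (fun y => ¬ ∀ v, y v ≤ B) ≤ ENNReal.ofReal ε) :
    1 - ε ≤ probMaxLoadLE G l b := by
  unfold probMaxLoadLE
  rw [← pr_eq_toOuterMeasure]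
  have h1 := pr_add_pr_not (loads G l (Fintype.card V)) fun y => ∀ v, y v ≤ B
  have h2 : pr (loads G l (Fintype.card V)) (fun y => ∀ v, y v ≤ B) ≤
      pr (loads G l (Fintype.card V)) (fun y => (maxLoad y : ℝ) ≤ b) := by
    refine pr_mono _ fun y hy => le_trans ?_ hb
    exact_mod_cast Finset.sup_le fun v _ => hy v
  have h3 : ENNReal.ofReal (1 - ε) ≤
      pr (loads G l (Fintype.card V)) (fun y => (maxLoad y : ℝ) ≤ b) := by
    rw [ENNReal.ofReal_sub _ hε, ENNReal.ofReal_one, tsub_le_iff_right, ← h1]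
    exact add_le_add h2 h
  exact (ENNReal.ofReal_le_iff_le_toReal
    ((pr_le_one _ _).trans_lt ENNReal.one_lt_top).ne).1 h3

lemma probMaxLoadLE_mono (l : ℕ) {b b' : ℝ} (h : b ≤ b') :
    probMaxLoadLE G l b ≤ probMaxLoadLE G l b' := by
  unfold probMaxLoadLE
  rw [← pr_eq_toOuterMeasure, ← pr_eq_toOuterMeasure]
  exact ENNReal.toReal_mono ((pr_le_one _ _).trans_lt ENNReal.one_lt_top).ne
    (pr_mono _ fun y hy => le_trans hy h)

/-- A Moore-type bound: walks of length `s` from `x` end at distinct nodes. In probabilities, `1 /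
n` is split over the `n` possible endpoints. -/
lemma pow_le_card_of_egirth (hreg : ∀ u, (nextNodes G none u).card = d) (hd : 2 ≤ d)
    {s : ℕ} (hg : ((2 * s : ℕ) : ℕ∞) < G.egirth) : (d - 1) ^ s ≤ Fintype.card V := by
  classical
  have hn0 : (Fintype.card V : ℝ≥0∞) ≠ 0 := Nat.cast_ne_zero.2 Fintype.card_ne_zero
  have hD0 : ((d - 1 : ℕ) : ℝ≥0∞) ≠ 0 := Nat.cast_ne_zero.2 (by omega)
  obtain ⟨x⟩ := ‹Nonempty V›
  have h1 : (Fintype.card V : ℝ≥0∞)⁻¹ ≤ ((d - 1 : ℕ) : ℝ≥0∞)⁻¹ ^ s := by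
    calc (Fintype.card V : ℝ≥0∞)⁻¹ = pr (nbWalk G s) (fun W => W[0]? = some x) :=
          (pr_nbWalk_getElem? hreg hd (Nat.zero_le s) x).symm
      _ ≤ pr (nbWalk G s) (fun W => ∃ y, W.head? = some x ∧ W.getLast? = some y) := by
          refine pr_mono_support _ fun W hW h => ?_
          have hne : W ≠ [] := by
            rintro rfl; simp at h
          exact ⟨W.getLast hne, by rw [List.head?_eq_getElem?, h],
            List.getLast?_eq_some_getLast hne⟩
      _ ≤ ∑ y, pr (nbWalk G s) (fun W => W.head? = some x ∧ W.getLast? = some y) :=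
          pr_exists_le _ _
      _ ≤ ∑ y : V, (Fintype.card V : ℝ≥0∞)⁻¹ * ((d - 1 : ℕ) : ℝ≥0∞)⁻¹ ^ s :=
          Finset.sum_le_sum fun y _ => (pr_nbWalk_endpoints hreg hd hg x y).trans
            (mul_le_mul_right (walkWeight_le d s) _)
      _ = _ := by
          rw [Finset.sum_const, Finset.card_univ, nsmul_eq_mul, ← mul_assoc,
            ENNReal.mul_inv_cancel hn0 (by simp), one_mul]
  rw [← ENNReal.inv_pow, ENNReal.inv_le_inv] at h1
  exact_mod_cast h1

end MaxLoad

/-! ### Choice of the parameters -/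

section Parameters
variable {G : SimpleGraph V} {n d l : ℕ}

lemma two_mul_log_le_three_mul_log {d : ℕ} (hd : 4 ≤ d) :
    2 * Real.log d ≤ 3 * Real.log ((d - 1 : ℕ) : ℝ) := by
  have hd1 : (4 : ℝ) ≤ d := by exact_mod_cast hd
  rw [Nat.cast_sub (by omega), Nat.cast_one]
  have h : Real.log ((d : ℝ) ^ 2) ≤ Real.log (((d : ℝ) - 1) ^ 3) := by
    apply Real.log_le_log (by positivity)
    nlinarith [mul_nonneg (sub_nonneg.2 hd1) (sub_nonneg.2 hd1),
      mul_nonneg (mul_nonneg (sub_nonneg.2 hd1) (sub_nonneg.2 hd1)) (sub_nonneg.2 hd1)]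
  simpa [Real.log_pow] using h

/-- The Moore bound with `s = 3 * h * l`, combined with `d ^ 2 ≤ (d - 1) ^ 3`. It is the only use of
the factor `h` in the girth condition. -/
lemma two_mul_hParam_mul_le_logb (hn : Fintype.card V = n)
    (hreg : ∀ u, (nextNodes G none u).card = d) (hd : 4 ≤ d) {h : ℕ} (hhl : 1 ≤ h * l)
    (hg : ((10 * h * l : ℕ) : ℕ∞) ≤ G.egirth) : 2 * ((h : ℝ) * l) ≤ Real.logb d n := by
  have hs : ((2 * (3 * (h * l)) : ℕ) : ℕ∞) < G.egirth := by
    refine lt_of_lt_of_le ?_ hg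
    exact_mod_cast (by rw [mul_assoc]; omega : 2 * (3 * (h * l)) < 10 * h * l)
  have h1 := pow_le_card_of_egirth hreg (by omega) hs
  rw [hn] at h1
  have hd1 : (4 : ℝ) ≤ d := by exact_mod_cast hd
  have hlogd : 0 < Real.log d := Real.log_pos (by linarith)
  have hDpos : (0 : ℝ) < ((d - 1 : ℕ) : ℝ) := by exact_mod_cast (by omega : 0 < d - 1)
  have h2 : (3 * (h * l) : ℕ) * Real.log ((d - 1 : ℕ) : ℝ) ≤ Real.log n := by
    rw [← Real.log_pow]
    apply Real.log_le_log (by positivity)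
    exact_mod_cast h1
  have h3 := two_mul_log_le_three_mul_log hd
  rw [Real.logb, le_div_iff₀ hlogd]
  push_cast at h2
  have h4 : (0 : ℝ) ≤ h * l := by positivity
  nlinarith

/-- With `y = log log n`, the left side has logarithm at most `6 * T * y`, because `(l + 1) ^ 2 * T
≤ (log n) ^ 4`. The exponent on the right is at least `ρ * l * T / 16 ≥ 10 * T * y`, and `10 * log 2
> 6`. -/
lemma sq_mul_pow_le_two_pow {n l T ρ : ℕ} (hn0 : 0 < n) (hlog : 2 ≤ Real.log n)
    (hloglog : 1 ≤ Real.log (Real.log n)) (hTge : Real.log n ≤ T) (hTle : (T : ℝ) ≤ Real.log n + 1)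
    (hl : (l : ℝ) + 1 ≤ Real.log n) (hl16 : 16 ≤ l) (hρ : 48 ≤ ρ)
    (hρl : 160 * Real.log (Real.log n) ≤ (ρ : ℝ) * l) :
    n ^ 2 * ((l + 1) ^ 2 * T) ^ T ≤ 2 ^ ((ρ - 24) * (l * T / 4)) := by
  have hn0' : (0 : ℝ) < n := by exact_mod_cast hn0
  set a := l * T / 4 with ha
  set E := (ρ - 24) * a with hE
  have hTpos : (0 : ℝ) < T := by linarith
  have hT1 : 1 ≤ T := by exact_mod_cast hTpos
  have hexp : (ρ : ℝ) * l * T / 16 ≤ (E : ℝ) := by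
    have e1 : l * T ≤ 8 * a := by
      have : 16 * 1 ≤ l * T := Nat.mul_le_mul hl16 hT1
      omega
    have e2 : ρ ≤ 2 * (ρ - 24) := by omega
    have e3 : ρ * (l * T) ≤ (2 * (ρ - 24)) * (8 * a) := Nat.mul_le_mul e2 e1
    have e4 : ρ * (l * T) ≤ 16 * E := by
      refine e3.trans (le_of_eq ?_)
      rw [hE]; ring
    have e5 : (ρ : ℝ) * (l * T) ≤ 16 * (E : ℝ) := by exact_mod_cast e4
    rw [div_le_iff₀ (by norm_num)]
    linarith
  have hQlog : ((l : ℝ) + 1) ^ 2 * T ≤ (Real.log n) ^ 4 := by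
    have e2 : (T : ℝ) ≤ (Real.log n) ^ 2 := by nlinarith
    calc ((l : ℝ) + 1) ^ 2 * T ≤ (Real.log n) ^ 2 * (Real.log n) ^ 2 := by gcongr
      _ = _ := by ring
  have hQpos : (0 : ℝ) < ((l : ℝ) + 1) ^ 2 * T := by positivity
  have f1 : Real.log (((l : ℝ) + 1) ^ 2 * T) ≤ 4 * Real.log (Real.log n) := by
    refine (Real.log_le_log hQpos hQlog).trans (le_of_eq ?_)
    rw [Real.log_pow]; norm_num
  have hreal : (n : ℝ) ^ 2 * (((l : ℝ) + 1) ^ 2 * T) ^ T ≤ (2 : ℝ) ^ E := by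
    rw [← Real.log_le_log_iff (by positivity) (by positivity),
      Real.log_mul (by positivity) (by positivity), Real.log_pow, Real.log_pow, Real.log_pow]
    set y := Real.log (Real.log n)
    have g1 : Real.log n ≤ T * y := by nlinarith
    have g2 : (T : ℝ) * Real.log (((l : ℝ) + 1) ^ 2 * T) ≤ T * (4 * y) := by gcongr
    have g3 : 160 * y * T ≤ (ρ * l) * T := by gcongr
    have g4 : (0.69 : ℝ) ≤ Real.log 2 := by linarith [Real.log_two_gt_d9]
    have g5 : (E : ℝ) * 0.69 ≤ E * Real.log 2 := by gcongr
    have g6 : 0 ≤ (T : ℝ) * y := by positivity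
    push_cast
    linarith
  exact_mod_cast hreal

/-- The bound on the maximum load, for parameters satisfying explicit inequalities. -/
lemma one_sub_le_probMaxLoadLE (hn : Fintype.card V = n)
    (hreg : ∀ u, (nextNodes G none u).card = d)
    (hlog : 2 ≤ Real.log n) (hloglog : 1 ≤ Real.log (Real.log n))
    (hsqrt : 641 * (Real.log n + 3) ≤ (n : ℝ) ^ (1 / 2 : ℝ)) (hn640 : 640 ^ 2 ≤ n)
    (hd : 100 * Real.log n ≤ d) {h : ℕ} (hg : ((10 * h * l : ℕ) : ℕ∞) ≤ G.egirth)
    (hl : 16 ≤ l) (hh : 1 ≤ h) {ρ g : ℕ} (hρ : 48 ≤ ρ)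
    (hρl2 : 16 * Real.logb d n ≤ (ρ : ℝ) * l ^ 2)
    (hρl : 160 * Real.log (Real.log n) ≤ (ρ : ℝ) * l)
    (hg1 : 1 ≤ g) (hg4 : 4 * g ≤ ρ * l) (hgh : Real.log n ≤ (g : ℝ) ^ h)
    {b : ℝ} (hb : (641 : ℝ) * ((h + 1) * ρ) ≤ b) :
    1 - (n : ℝ) ^ (-(1 / 2 : ℝ)) ≤ probMaxLoadLE G l b := by
  have hd200 : (200 : ℝ) ≤ d := by linarith
  have hdnat : 200 ≤ d := by exact_mod_cast hd200
  have hn0 : 0 < n := by omega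
  have hn0' : (0 : ℝ) < n := by exact_mod_cast hn0
  set L := Real.logb d n with hL
  set T := ⌈Real.log n⌉₊ with hT
  have hTge : Real.log n ≤ T := Nat.le_ceil _
  have hTlt : (T : ℝ) < Real.log n + 1 := Nat.ceil_lt_add_one (by linarith)
  have hlogd1 : 1 ≤ Real.log d := by
    rw [Real.le_log_iff_exp_le (by linarith)]
    linarith [Real.exp_one_lt_d9]
  have hLn : L * Real.log d = Real.log n := by
    rw [hL, Real.logb, div_mul_cancel₀ _ (by linarith)]
  have hhl1 : 1 ≤ h * l := Nat.mul_pos hh (by omega)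
  have hLhl : 2 * ((h : ℝ) * l) ≤ L := two_mul_hParam_mul_le_logb hn hreg (by omega) hhl1 hg
  have hh1 : (1 : ℝ) ≤ h := by exact_mod_cast hh
  have hl16 : (16 : ℝ) ≤ l := by exact_mod_cast hl
  have hLl : 2 * (l : ℝ) ≤ L := by nlinarith
  have hLpos : 32 ≤ L := by linarith
  have hLle : L ≤ Real.log n := by nlinarith
  -- Since `(d - 1) ^ 3 ≥ d ^ 2`, the power `(d - 1) ^ (3 * L)` is at least `d ^ (2 * L) = n ^ 2`.
  set lam := ⌈3 * L⌉₊ with hlam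
  have hlamge : 3 * L ≤ lam := Nat.le_ceil _
  have hlamle : (lam : ℝ) ≤ 4 * L := by
    have := Nat.ceil_lt_add_one (a := 3 * L) (by linarith)
    linarith
  have hDcast : ((d - 1 : ℕ) : ℝ) = (d : ℝ) - 1 := by
    rw [Nat.cast_sub (by omega), Nat.cast_one]
  have hTD : T ≤ d - 1 := by
    have : (T : ℝ) ≤ ((d - 1 : ℕ) : ℝ) := by rw [hDcast]; linarith
    exact_mod_cast this
  have hlD : l + 1 ≤ d - 1 := by
    have : ((l + 1 : ℕ) : ℝ) ≤ ((d - 1 : ℕ) : ℝ) := by rw [hDcast]; push_cast; linarith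
    exact_mod_cast this
  have hT1 : 1 ≤ T := Nat.ceil_pos.2 (by linarith)
  have hTl : 4 * lam ≤ l * T := by
    have : (4 : ℝ) * lam ≤ l * T := by
      calc (4 : ℝ) * lam ≤ 16 * L := by linarith
        _ ≤ 16 * T := by linarith
        _ ≤ l * T := by gcongr
    exact_mod_cast this
  have hρl' : 4 * lam ≤ l * (ρ * l) := by
    have : (4 : ℝ) * lam ≤ l * (ρ * l) := by
      calc (4 : ℝ) * lam ≤ 16 * L := by linarith
        _ ≤ ρ * l ^ 2 := hρl2
        _ = _ := by ring
    exact_mod_cast this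
  have hgT : T ≤ g ^ h := Nat.ceil_le.2 (by exact_mod_cast hgh)
  have hlamn : n ^ 2 ≤ (d - 1) ^ lam := by
    have hDpos : (0 : ℝ) < ((d - 1 : ℕ) : ℝ) := by rw [hDcast]; linarith
    have : ((n ^ 2 : ℕ) : ℝ) ≤ (((d - 1) ^ lam : ℕ) : ℝ) := by
      push_cast
      rw [← Real.log_le_log_iff (by positivity) (by positivity), Real.log_pow, Real.log_pow]
      have h3 := two_mul_log_le_three_mul_log (d := d) (by omega)
      have hlogD : 0 ≤ Real.log ((d - 1 : ℕ) : ℝ) := by linarith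
      calc ((2 : ℕ) : ℝ) * Real.log n = L * (2 * Real.log d) := by push_cast; rw [← hLn]; ring
        _ ≤ L * (3 * Real.log ((d - 1 : ℕ) : ℝ)) := by gcongr
        _ = 3 * L * Real.log ((d - 1 : ℕ) : ℝ) := by ring
        _ ≤ lam * Real.log ((d - 1 : ℕ) : ℝ) := by gcongr
    exact_mod_cast this
  have hQ : (l + 1) ^ 2 * T ≤ (d - 1) ^ 3 := by
    calc (l + 1) ^ 2 * T ≤ (d - 1) ^ 2 * (d - 1) := by gcongr
      _ = _ := by ring
  set a := l * T / 4 with ha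
  have hE : n ^ 2 * ((l + 1) ^ 2 * T) ^ T ≤ 2 ^ ((ρ - 24) * a) :=
    sq_mul_pow_le_two_pow hn0 hlog hloglog hTge hTlt.le (by linarith) hl hρ hρl
  have hg' : ((2 * l : ℕ) : ℕ∞) < G.egirth := by
    refine lt_of_lt_of_le ?_ hg
    exact_mod_cast (by nlinarith : 2 * l < 10 * h * l)
  have hbatch : ∀ (x : V → ℕ) (M : ℕ), (∀ v, x v ≤ M) → ∀ t ≤ n / 640,
      pr (loadsFrom G l x t) (fun y => ¬ ∀ v, y v ≤ M + (h + 1) * ρ) ≤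
        (T + 2 : ℕ) * (n : ℝ≥0∞)⁻¹ := by
    intro x M hx t ht
    have := pr_batch_le (τ := t) hreg (by omega) hg' hx (T := T) (lam := lam) (ρ := ρ) (g := g)
      (h := h) (a := a) (by rw [hn]; omega) (by rw [hn]; exact hd) (by omega) hT1 hTl hρl' hg1
      hg4 hgT hh (by omega) (by rw [hn]; exact hlamn) hQ (by omega) (by rw [hn]; exact hE)
    rwa [hn] at this
  -- The 641st batch covers the remainder of `n` modulo 640; `n ≥ 640 ^ 2` makes a batch long enough
  -- for that.
  have hall := pr_loadsFrom_zero_le hbatch 641 n (by omega)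
  rw [← loads_eq_loadsFrom, ← hn] at hall
  refine le_probMaxLoadLE (B := 641 * ((h + 1) * ρ)) (by positivity) (by push_cast; exact hb)
    (hall.trans ?_)
  rw [hn]
  have hreal : (641 : ℝ≥0∞) * ((T + 2 : ℕ) * (n : ℝ≥0∞)⁻¹) =
      ENNReal.ofReal (641 * ((T + 2 : ℕ) * (n : ℝ)⁻¹)) := by
    rw [ENNReal.ofReal_mul (by positivity), ENNReal.ofReal_mul (by positivity),
      ENNReal.ofReal_inv_of_pos hn0', ENNReal.ofReal_natCast, ENNReal.ofReal_natCast]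
    simp
  push_cast at hreal ⊢
  rw [hreal]
  apply ENNReal.ofReal_le_ofReal
  have hsplit : (n : ℝ) ^ (-(1 / 2 : ℝ)) = (n : ℝ) ^ (1 / 2 : ℝ) * (n : ℝ)⁻¹ := by
    rw [← Real.rpow_neg_one, ← Real.rpow_add hn0']
    norm_num
  rw [hsplit, ← mul_assoc]
  gcongr
  linarith

end Parameters

/-! ### Short, long and polylogarithmic walks -/

section Cases
variable {G : SimpleGraph V} {n d l : ℕ}

lemma div_log_le_hParam (n d l : ℕ) :
    Real.log (Real.log n) / Real.log ((kParam n d l : ℝ) - 2) ≤ hParam n d l :=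
  Nat.le_ceil _

lemma hParam_le (n d l : ℕ) (h : 0 ≤ Real.log (Real.log n)) :
    (hParam n d l : ℝ) ≤ Real.log (Real.log n) / Real.log ((kParam n d l : ℝ) - 2) + 1 := by
  refine (Nat.ceil_lt_add_one (div_nonneg h (Real.log_nonneg ?_))).le
  have : (4 : ℝ) ≤ kParam n d l := by exact_mod_cast le_max_left _ _
  linarith

lemma log_kParam_sub_two_pos (n d l : ℕ) : 0 < Real.log ((kParam n d l : ℝ) - 2) := by
  apply Real.log_pos
  have : (4 : ℝ) ≤ kParam n d l := by exact_mod_cast le_max_left _ _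
  linarith

lemma one_le_hParam (n d l : ℕ) (h : 0 < Real.log (Real.log n)) : 1 ≤ hParam n d l :=
  Nat.ceil_pos.2 (div_pos h (log_kParam_sub_two_pos n d l))

lemma log_le_pow_hParam (n d l : ℕ) (h : 0 < Real.log n) :
    Real.log n ≤ ((kParam n d l - 2 : ℕ) : ℝ) ^ hParam n d l := by
  have h4 : 4 ≤ kParam n d l := le_max_left _ _
  have hpos := log_kParam_sub_two_pos n d l
  have hk : ((kParam n d l - 2 : ℕ) : ℝ) = (kParam n d l : ℝ) - 2 := by
    rw [Nat.cast_sub (by omega)]; norm_num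
  have h4' : (4 : ℝ) ≤ kParam n d l := by exact_mod_cast h4
  rw [hk, ← Real.log_le_log_iff h (by apply pow_pos; linarith), Real.log_pow]
  have := div_log_le_hParam n d l
  rwa [div_le_iff₀ hpos] at this

/-- Here `k = 4`, so `h` is of order `log log n` and doubling (`g = 2`) reaches `log n` in `h`
strips. The girth gives `log_d n ≥ 2 * h * l`, so `ρ` of order `log_d n / l²` makes `ρ * l` a large
multiple of `log log n`. -/
lemma probMaxLoadLE_short_walks (hn : Fintype.card V = n)
    (hreg : ∀ u, (nextNodes G none u).card = d)
    (hlog : 2 ≤ Real.log n) (hloglog : 1 ≤ Real.log (Real.log n))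
    (hsqrt : 641 * (Real.log n + 3) ≤ (n : ℝ) ^ (1 / 2 : ℝ)) (hn640 : 640 ^ 2 ≤ n)
    (hd : 100 * Real.log n ≤ d) (hg : ((10 * hParam n d l * l : ℕ) : ℕ∞) ≤ G.egirth)
    (hl : 16 ≤ l) (hlγ : (l : ℝ) ≤ 4 * gam n d) :
    1 - (n : ℝ) ^ (-(1 / 2 : ℝ)) ≤ probMaxLoadLE G l
      (2010176 * (Real.logb d n * Real.log (Real.log n) / (l : ℝ) ^ 2)) := by
  set h := hParam n d l with hh
  set L := Real.logb d n with hL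
  set LL := Real.log (Real.log n) with hLL
  have hl16 : (16 : ℝ) ≤ l := by exact_mod_cast hl
  have hh1 : 1 ≤ h := one_le_hParam n d l (by linarith)
  have hdnat : 4 ≤ d := by
    have : (4 : ℝ) ≤ d := by linarith
    exact_mod_cast this
  have hLhl : 2 * ((h : ℝ) * l) ≤ L :=
    two_mul_hParam_mul_le_logb hn hreg hdnat (Nat.mul_pos hh1 (by omega)) hg
  have hh1' : (1 : ℝ) ≤ h := by exact_mod_cast hh1
  have hLpos : 0 < L := by nlinarith
  have hγ : gam n d ^ 2 = L := Real.sq_sqrt hLpos.le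
  have hγpos : 0 < gam n d := Real.sqrt_pos.2 hLpos
  have hl2 : (l : ℝ) ^ 2 ≤ 16 * L := by
    rw [← hγ]
    calc (l : ℝ) ^ 2 ≤ (4 * gam n d) ^ 2 := by gcongr
      _ = _ := by ring
  have hl2pos : (0 : ℝ) < (l : ℝ) ^ 2 := by positivity
  have hk : kParam n d l = 4 := by
    refine max_eq_left ?_
    have : ⌊(l : ℝ) / gam n d⌋₊ ≤ ⌊(4 : ℝ)⌋₊ :=
      Nat.floor_le_floor ((div_le_iff₀ hγpos).2 hlγ)
    simpa using this
  have hlog2 : Real.log ((kParam n d l : ℝ) - 2) = Real.log 2 := by rw [hk]; norm_num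
  have hl2gt := Real.log_two_gt_d9
  have hl2lt := Real.log_two_lt_d9
  have hLLh : LL ≤ h := by
    have h1 := div_log_le_hParam n d l
    rw [hlog2, div_le_iff₀ (by linarith)] at h1
    have h2 : (h : ℝ) * Real.log 2 ≤ h * 1 := by gcongr; linarith
    linarith
  have hhle : (h : ℝ) + 1 ≤ 4 * LL := by
    have h1 := hParam_le n d l (by linarith)
    rw [hlog2, ← hLL] at h1
    have h2 : LL / Real.log 2 ≤ 2 * LL := by
      rw [div_le_iff₀ (by linarith)]; nlinarith
    linarith
  -- As `l ^ 2 ≤ 16 * L`, the constant `768 = 48 * 16` gives `ρ ≥ 48`, and rounding up costs at most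
  -- `16 * L / l ^ 2`.
  set ρ := ⌈768 * L / (l : ℝ) ^ 2⌉₊ with hρ
  have hρge : 768 * L / (l : ℝ) ^ 2 ≤ ρ := Nat.le_ceil _
  have hLl : 1 ≤ 16 * L / (l : ℝ) ^ 2 := by rwa [one_le_div hl2pos]
  have hρle : (ρ : ℝ) ≤ 784 * L / (l : ℝ) ^ 2 := by
    have h1 : (ρ : ℝ) < 768 * L / (l : ℝ) ^ 2 + 1 := Nat.ceil_lt_add_one (by positivity)
    have h2 : 784 * L / (l : ℝ) ^ 2 = 768 * L / (l : ℝ) ^ 2 + 16 * L / (l : ℝ) ^ 2 := by ring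
    linarith
  have hρ48 : 48 ≤ ρ := by
    have h1 : 768 * L / (l : ℝ) ^ 2 = 48 * (16 * L / (l : ℝ) ^ 2) := by ring
    have : (48 : ℝ) ≤ ρ := by linarith
    exact_mod_cast this
  have hρl2 : 768 * L ≤ ρ * (l : ℝ) ^ 2 := (div_le_iff₀ hl2pos).1 hρge
  have hρl : 160 * LL ≤ (ρ : ℝ) * l := by
    have h1 : 768 * (2 * (h * l)) ≤ (ρ * l) * (l : ℝ) := by
      calc 768 * (2 * ((h : ℝ) * l)) ≤ 768 * L := by linarith
        _ ≤ _ := hρl2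
        _ = _ := by ring
    have h2 : (768 * 2 * (h : ℝ)) * l ≤ (ρ * l) * (l : ℝ) := by linarith
    have h3 := le_of_mul_le_mul_right h2 (by linarith)
    linarith
  refine one_sub_le_probMaxLoadLE hn hreg hlog hloglog hsqrt hn640 hd hg hl hh1 (ρ := ρ) (g := 2)
    hρ48 ?_ hρl (by norm_num) ?_ ?_ ?_
  · linarith
  · have : 48 * 16 ≤ ρ * l := Nat.mul_le_mul hρ48 hl
    omega
  · have := log_le_pow_hParam n d l (by linarith)
    rwa [hk] at this
  · calc (641 : ℝ) * (((h : ℝ) + 1) * ρ) ≤ 641 * ((4 * LL) * (784 * L / (l : ℝ) ^ 2)) := by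
          gcongr
      _ = _ := by ring

lemma log_le_three_mul_log_sub_two {k r : ℝ} (hk : 4 ≤ k) (hr0 : 0 < r) (hr : r ≤ k + 1) :
    Real.log r ≤ 3 * Real.log (k - 2) := by
  have h1 : k + 1 ≤ (k - 2) ^ 3 := by
    have : 2 ^ 2 * (k - 2) ≤ (k - 2) ^ 2 * (k - 2) := by
      apply mul_le_mul_of_nonneg_right _ (by linarith)
      exact pow_le_pow_left₀ (by norm_num) (by linarith) 2
    calc k + 1 ≤ 2 ^ 2 * (k - 2) := by linarith
      _ ≤ _ := this
      _ = _ := by ring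
  calc Real.log r ≤ Real.log ((k - 2) ^ 3) := Real.log_le_log hr0 (hr.trans h1)
    _ = _ := by rw [Real.log_pow]; norm_num

/-- The chain is `LL ≤ h * log (k - 2) ≤ h * r ≤ γ / 2 ≤ r * γ / 2 = l / 2`. It shows that long
walks exceed `log log n`, so a constant `ρ` suffices. -/
lemma two_mul_le_walk_length {LL h k r γ l : ℝ} (hk : 4 ≤ k) (hkr : k ≤ r) (hh : 1 ≤ h)
    (hγr : 2 * (h * r) ≤ γ) (hrγ : r * γ = l) (hLL : LL ≤ h * Real.log (k - 2)) : 2 * LL ≤ l := by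
  have h2 : Real.log (k - 2) ≤ k := by
    have := Real.log_le_sub_one_of_pos (by linarith : (0 : ℝ) < k - 2)
    linarith
  have h3 : h * Real.log (k - 2) ≤ h * r := by gcongr; linarith
  have h4 : 1 * γ ≤ r * γ := by
    have : 0 ≤ h * r := mul_nonneg (by linarith) (by linarith)
    gcongr <;> linarith
  linarith

lemma probMaxLoadLE_long_walks (hn : Fintype.card V = n)
    (hreg : ∀ u, (nextNodes G none u).card = d)
    (hlog : 2 ≤ Real.log n) (hloglog : 8 ≤ Real.log (Real.log n))
    (hsqrt : 641 * (Real.log n + 3) ≤ (n : ℝ) ^ (1 / 2 : ℝ)) (hn640 : 640 ^ 2 ≤ n)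
    (hd : 100 * Real.log n ≤ d) (hg : ((10 * hParam n d l * l : ℕ) : ℕ∞) ≤ G.egirth)
    (hlγ : 4 * gam n d ≤ (l : ℝ)) :
    1 - (n : ℝ) ^ (-(1 / 2 : ℝ)) ≤ probMaxLoadLE G l
      (256400 * (Real.log (Real.log n) / Real.log ((l : ℝ) / gam n d))) := by
  set h := hParam n d l with hh
  set k := kParam n d l with hkdef
  set L := Real.logb d n with hL
  set LL := Real.log (Real.log n) with hLL
  set γ := gam n d with hγdef
  have hh1 : 1 ≤ h := one_le_hParam n d l (by linarith)
  have hd4 : (4 : ℝ) ≤ d := by linarith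
  have hdnat : 4 ≤ d := by exact_mod_cast hd4
  have hlogd1 : 1 ≤ Real.log d := by
    rw [Real.le_log_iff_exp_le (by linarith)]
    linarith [Real.exp_one_lt_d9]
  have hLn : L * Real.log d = Real.log n := by
    rw [hL, Real.logb, div_mul_cancel₀ _ (by linarith)]
  have hLpos : 0 < L := by
    rw [hL, Real.logb]; apply div_pos <;> linarith
  have hγ : γ * γ = L := Real.mul_self_sqrt hLpos.le
  have hγpos : 0 < γ := Real.sqrt_pos.2 hLpos
  have hlpos : (0 : ℝ) < l := by linarith
  have hl1 : 1 ≤ l := by exact_mod_cast hlpos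
  have hLhl : 2 * ((h : ℝ) * l) ≤ L :=
    two_mul_hParam_mul_le_logb hn hreg hdnat (Nat.mul_pos hh1 hl1) hg
  have hh1' : (1 : ℝ) ≤ h := by exact_mod_cast hh1
  set r : ℝ := (l : ℝ) / γ with hr
  have hrγ : r * γ = l := div_mul_cancel₀ _ hγpos.ne'
  have hr4 : 4 ≤ r := (le_div_iff₀ hγpos).2 hlγ
  have hfloor : 4 ≤ ⌊r⌋₊ := Nat.le_floor (by exact_mod_cast hr4)
  have hk : k = ⌊r⌋₊ := max_eq_right hfloor
  have hk4 : 4 ≤ k := hk ▸ hfloor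
  have hk4' : (4 : ℝ) ≤ k := by exact_mod_cast hk4
  have hkr : (k : ℝ) ≤ r := by rw [hk]; exact Nat.floor_le (by linarith)
  have hrk : r < k + 1 := by rw [hk]; exact Nat.lt_floor_add_one r
  have hγr : 2 * (h * r) ≤ γ := by
    have : (2 * (h * r)) * γ ≤ γ * γ := by
      rw [hγ]
      calc (2 * (h * r)) * γ = 2 * (h * (r * γ)) := by ring
        _ ≤ _ := by rw [hrγ]; exact hLhl
    exact le_of_mul_le_mul_right this hγpos
  have hrh : r ≤ h * r := le_mul_of_one_le_left (by linarith) hh1'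
  have hγ1 : 1 ≤ γ := by linarith
  have hpos := log_kParam_sub_two_pos n d l
  rw [← hkdef] at hpos
  have hlLL : 2 * LL ≤ l := by
    have h1 := div_log_le_hParam n d l
    rw [← hkdef, div_le_iff₀ hpos] at h1
    exact two_mul_le_walk_length hk4' hkr hh1' hγr hrγ h1
  have hl16 : 16 ≤ l := by
    have : (16 : ℝ) ≤ l := by linarith
    exact_mod_cast this
  have hrle : r ≤ Real.log n := by
    have h1 : r ≤ γ := by linarith
    have h2 : γ ≤ L := by rw [← hγ]; exact le_mul_of_one_le_left hγpos.le hγ1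
    have h3 : L ≤ Real.log n := by rw [← hLn]; exact le_mul_of_one_le_right hLpos.le hlogd1
    linarith
  have hlogr : 0 < Real.log r := Real.log_pos (by linarith)
  have hlogrLL : Real.log r ≤ LL := Real.log_le_log (by linarith) hrle
  have hlogr3 : Real.log r ≤ 3 * Real.log ((k : ℝ) - 2) :=
    log_le_three_mul_log_sub_two hk4' (by linarith) hrk.le
  have hγl : γ ^ 2 * 16 ≤ (l : ℝ) ^ 2 := by
    rw [← hrγ, mul_pow, mul_comm (r ^ 2)]
    gcongr
    calc (16 : ℝ) = 4 ^ 2 := by norm_num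
      _ ≤ r ^ 2 := by gcongr
  have hrl : r ≤ l := by
    rw [← hrγ]
    exact le_mul_of_one_le_right (by linarith) hγ1
  refine one_sub_le_probMaxLoadLE hn hreg hlog (by linarith) hsqrt hn640 hd hg hl16 hh1
    (ρ := 80) (g := k - 2) (by norm_num) ?_ ?_ (by omega) ?_ ?_ ?_
  · rw [← hL, ← hγ]
    push_cast
    linarith [sq_nonneg (l : ℝ), sq γ]
  · rw [← hLL]; push_cast; linarith
  · have h1 : (k : ℝ) ≤ l := hkr.trans hrl
    have h2 : k ≤ l := by exact_mod_cast h1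
    omega
  · exact log_le_pow_hParam n d l (by linarith)
  · have h1 := hParam_le n d l (by linarith)
    rw [← hkdef, ← hLL] at h1
    have h2 : LL / Real.log ((k : ℝ) - 2) ≤ 3 * (LL / Real.log r) := by
      rw [mul_div_assoc', div_le_div_iff₀ hpos hlogr]
      calc LL * Real.log r ≤ LL * (3 * Real.log ((k : ℝ) - 2)) := by
            gcongr
        _ = _ := by ring
    have h3 : 1 ≤ LL / Real.log r := by rwa [one_le_div hlogr]
    push_cast
    linarith

/-- From `d ≥ log n` one gets `log_d n ≤ log n / log log n`, so `γ` is at most an eighth of `√(log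
n)`. The factor 8 pays for the 4 in the claim and for a loss of 2 in the floor. -/
lemma log_div_gam_ge {ε : ℝ} (hε : 0 < ε)
    (hloglog : 64 ≤ Real.log (Real.log n)) (hd : Real.log n ≤ d)
    (hl : l = ⌊(Real.log n) ^ ((1 + ε) / 2)⌋₊) :
    4 * gam n d ≤ l ∧ ε / 2 * Real.log (Real.log n) ≤ Real.log ((l : ℝ) / gam n d) := by
  set y := Real.log n with hy
  set LL := Real.log y with hLL
  have hy1 : 1 < y := by
    by_contra hcon
    push Not at hcon
    have hy0 : 0 ≤ y := Real.log_natCast_nonneg n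
    have := Real.log_nonpos hy0 hcon
    linarith
  have hypos : 0 < y := by linarith
  have hlogd : LL ≤ Real.log d := Real.log_le_log hypos hd
  have hLdiv : Real.logb d n = y / Real.log d := rfl
  have hγpos : 0 < gam n d := Real.sqrt_pos.2 (by rw [hLdiv]; apply div_pos <;> linarith)
  have hγle : gam n d * 8 ≤ y ^ (1 / 2 : ℝ) := by
    rw [← Real.sqrt_eq_rpow]
    apply Real.le_sqrt_of_sq_le
    rw [mul_pow, gam, Real.sq_sqrt (by rw [hLdiv]; apply div_nonneg <;> linarith), hLdiv,
      div_mul_eq_mul_div, div_le_iff₀ (by linarith)]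
    nlinarith
  have hpow : y ^ ((1 + ε) / 2) = y ^ (ε / 2) * y ^ (1 / 2 : ℝ) := by
    rw [← Real.rpow_add hypos]; congr 1; ring
  have hε1 : 1 ≤ y ^ (ε / 2) := Real.one_le_rpow hy1.le (by positivity)
  have hhalf : 1 ≤ y ^ (1 / 2 : ℝ) := Real.one_le_rpow hy1.le (by positivity)
  have hlge : y ^ (ε / 2) * y ^ (1 / 2 : ℝ) ≤ 2 * l := by
    have h1 : 1 ≤ y ^ (ε / 2) * y ^ (1 / 2 : ℝ) := one_le_mul_of_one_le_of_one_le hε1 hhalf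
    have h2 : y ^ (ε / 2) * y ^ (1 / 2 : ℝ) < l + 1 := by
      rw [← hpow, hl]; exact Nat.lt_floor_add_one _
    have h3 : 1 ≤ l := by rw [hl]; exact Nat.le_floor (by rw [hpow]; exact_mod_cast h1)
    have h4 : (1 : ℝ) ≤ l := by exact_mod_cast h3
    linarith
  have hmain : 4 * y ^ (ε / 2) * gam n d ≤ l := by
    have : y ^ (ε / 2) * (gam n d * 8) ≤ y ^ (ε / 2) * y ^ (1 / 2 : ℝ) := by gcongr
    linarith
  constructor
  · nlinarith
  · have h1 : y ^ (ε / 2) ≤ (l : ℝ) / gam n d := by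
      rw [le_div_iff₀ hγpos]
      have : 0 ≤ y ^ (ε / 2) * gam n d := by positivity
      linarith
    rw [hLL, ← Real.log_rpow hypos]
    exact Real.log_le_log (by positivity) h1

lemma probMaxLoadLE_polylog_walks (hn : Fintype.card V = n)
    (hreg : ∀ u, (nextNodes G none u).card = d)
    (hlog : 2 ≤ Real.log n) (hloglog : 64 ≤ Real.log (Real.log n))
    (hsqrt : 641 * (Real.log n + 3) ≤ (n : ℝ) ^ (1 / 2 : ℝ)) (hn640 : 640 ^ 2 ≤ n)
    (hd : 100 * Real.log n ≤ d) (hg : ((10 * hParam n d l * l : ℕ) : ℕ∞) ≤ G.egirth)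
    {ε : ℝ} (hε : 0 < ε) (hl : l = ⌊(Real.log n) ^ ((1 + ε) / 2)⌋₊) :
    1 - (n : ℝ) ^ (-(1 / 2 : ℝ)) ≤ probMaxLoadLE G l (512800 / ε) := by
  obtain ⟨h1, h2⟩ := log_div_gam_ge (d := d) hε hloglog (by linarith) hl
  refine (probMaxLoadLE_long_walks hn hreg hlog (by linarith) hsqrt hn640 hd hg h1).trans
    (probMaxLoadLE_mono l ?_)
  have h3 : Real.log (Real.log n) / Real.log ((l : ℝ) / gam n d) ≤ 2 / ε := by
    have h4 : 0 < ε / 2 * Real.log (Real.log n) := by positivity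
    rw [div_le_div_iff₀ (by linarith) hε]
    linarith
  calc _ ≤ 256400 * (2 / ε) := by gcongr
    _ = _ := by ring

omit [Nonempty V] in
lemma card_nextNodes_none_of_isRegular {G : SimpleGraph V} [G.LocallyFinite]
    (h : G.IsRegularOfDegree d) (u : V) : (nextNodes G none u).card = d := by
  rw [← h u, ← SimpleGraph.card_neighborFinset_eq_degree]
  congr 1
  ext v
  simp [mem_nextNodes]

end Cases

end
end BalancedAllocation

/-! ### Passage to sequences of graphs -/

lemma eventually_log_bounds : ∀ᶠ n : ℕ in atTop, 2 ≤ Real.log n ∧ 64 ≤ Real.log (Real.log n) ∧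
    641 * (Real.log n + 3) ≤ (n : ℝ) ^ (1 / 2 : ℝ) ∧ 640 ^ 2 ≤ n := by
  have hcast : Tendsto (fun n : ℕ => (n : ℝ)) atTop atTop := tendsto_natCast_atTop_atTop
  have hlog : Tendsto (fun n : ℕ => Real.log n) atTop atTop := Real.tendsto_log_atTop.comp hcast
  have hloglog : Tendsto (fun n : ℕ => Real.log (Real.log n)) atTop atTop :=
    Real.tendsto_log_atTop.comp hlog
  have hlittle : ∀ᶠ n : ℕ in atTop, ‖Real.log n‖ ≤ 1 / 3000 * ‖(n : ℝ) ^ (1 / 2 : ℝ)‖ :=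
    hcast.eventually ((isLittleO_log_rpow_atTop (by norm_num : (0 : ℝ) < 1 / 2)).bound
      (by norm_num))
  filter_upwards [hlog.eventually_ge_atTop 3, hloglog.eventually_ge_atTop 64, hlittle,
    eventually_ge_atTop (640 ^ 2)] with n h1 h2 h3 h4
  refine ⟨by linarith, h2, ?_, h4⟩
  rw [Real.norm_of_nonneg (by linarith), Real.norm_of_nonneg (by positivity)] at h3
  linarith

theorem mainTheorem1 :
    ∃ C : ℝ, 0 < C ∧ ∃ c : ℝ, 0 < c ∧
      ∀ (n d l : ℕ → ℕ) [∀ i, NeZero (n i)]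
        (G : (i : ℕ) → SimpleGraph (Fin (n i))) [∀ i, DecidableRel (G i).Adj],
        Tendsto n atTop atTop →
        (∀ i, (G i).IsRegularOfDegree (d i)) →
        (fun i => Real.log (n i)) =o[atTop] (fun i => (d i : ℝ)) →
        (∀ᶠ i in atTop,
          ((10 * BalancedAllocation.hParam (n i) (d i) (l i) * l i : ℕ) : ℕ∞) ≤ (G i).egirth) →
        -- case `ω(1) ≤ l ≤ 4γ`
        (Tendsto l atTop atTop →
          (∀ᶠ i in atTop, (l i : ℝ) ≤ 4 * BalancedAllocation.gam (n i) (d i)) →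
          ∀ᶠ i in atTop, 1 - (n i : ℝ) ^ (-c) ≤
            BalancedAllocation.probMaxLoadLE (G i) (l i)
              (C * (Real.logb (d i) (n i) * Real.log (Real.log (n i)) / (l i : ℝ) ^ 2))) ∧
        -- case `l ≥ 4γ`
        ((∀ᶠ i in atTop, 4 * BalancedAllocation.gam (n i) (d i) ≤ (l i : ℝ)) →
          ∀ᶠ i in atTop, 1 - (n i : ℝ) ^ (-c) ≤
            BalancedAllocation.probMaxLoadLE (G i) (l i)
              (C * (Real.log (Real.log (n i)) /
                Real.log ((l i : ℝ) / BalancedAllocation.gam (n i) (d i))))) ∧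
        -- the special case `l = ⌊(log n)^((1+ε)/2)⌋`
        (∀ ε : ℝ, 0 < ε → ε < 1 →
          (∀ᶠ i in atTop, l i = ⌊(Real.log (n i)) ^ ((1 + ε) / 2)⌋₊) →
          ∀ᶠ i in atTop, 1 - (n i : ℝ) ^ (-c) ≤
            BalancedAllocation.probMaxLoadLE (G i) (l i) (C / ε)) := by
  -- The constant of the short-walk case, `641 * 4 * 784`, is the largest of the three.
  refine ⟨2010176, by norm_num, 1 / 2, by norm_num, ?_⟩
  intro n d l _ G _ hn hreg hd hg
  have hlarge := hn.eventually eventually_log_bounds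
  have hd' : ∀ᶠ i in atTop, 100 * Real.log (n i) ≤ d i := by
    filter_upwards [hd.bound (by norm_num : (0 : ℝ) < 1 / 100), hlarge] with i h1 h2
    rw [Real.norm_of_nonneg (by linarith [h2.1]), Real.norm_of_nonneg (by positivity)] at h1
    linarith
  have hreg' : ∀ i u, (BalancedAllocation.nextNodes (G i) none u).card = d i := fun i u =>
    BalancedAllocation.card_nextNodes_none_of_isRegular (hreg i) u
  refine ⟨fun hl hlγ => ?_, fun hlγ => ?_, fun ε hε _ hlε => ?_⟩
  · filter_upwards [hlarge, hd', hg, hlγ, hl.eventually_ge_atTop 16]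
      with i ⟨h1, h2, h3, h4⟩ h5 h6 h7 h8
    exact BalancedAllocation.probMaxLoadLE_short_walks (Fintype.card_fin _) (hreg' i) h1
      (by linarith) h3 h4 h5 h6 h8 h7
  · filter_upwards [hlarge, hd', hg, hlγ] with i ⟨h1, h2, h3, h4⟩ h5 h6 h7
    refine (BalancedAllocation.probMaxLoadLE_long_walks (Fintype.card_fin _) (hreg' i) h1
      (by linarith) h3 h4 h5 h6 h7).trans (BalancedAllocation.probMaxLoadLE_mono _ ?_)
    have hγ : 0 ≤ BalancedAllocation.gam (n i) (d i) := Real.sqrt_nonneg _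
    have hlog : 0 ≤ Real.log ((l i : ℝ) / BalancedAllocation.gam (n i) (d i)) := by
      -- For `γ = 0` the quotient is `0` by convention, and so is its logarithm.
      rcases hγ.eq_or_lt with h | h
      · simp [← h]
      · apply Real.log_nonneg
        rw [le_div_iff₀ h]
        linarith
    have : 0 ≤ Real.log (Real.log (n i)) := by linarith
    gcongr
    norm_num
  · filter_upwards [hlarge, hd', hg, hlε] with i ⟨h1, h2, h3, h4⟩ h5 h6 h7
    refine (BalancedAllocation.probMaxLoadLE_polylog_walks (Fintype.card_fin _) (hreg' i) h1
      h2 h3 h4 h5 h6 hε h7).trans (BalancedAllocation.probMaxLoadLE_mono _ ?_)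
    gcongr
    norm_num
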